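/- Let $d\ge 2$, $\lambda>0$, $\Box=[-\tfrac12,\tfrac12)^d$, $\langle\cdot\rangle=\int_\Box\cdot\,dy$, and let $a(y)=\{a_{ij}(y)\}$ be a measurable $1$-periodic real $d\times d$ matrix on $\mathbb R^d$, not necessarily symmetric, with $$\lambda|\xi|^2\le a\xi\cdot\xi,\qquad a\xi\cdot\eta\le\lambda^{-1}|\xi||\eta|\qquad(\xi,\eta\in\mathbb R^d)$$ almost everywhere. Let $a^*$ be the transpose of $a$. For $j=1,\dots,d$ let $N^j,\tilde N^j\in H^1_{\rm per}(\Box)$ be the solutions (which exist) of the cell problems $$\operatorname{div}a(e^j+\nabla N^j)=0,\ \ \langle N^j\rangle=0,\qquad \operatorname{div}a^*(e^j+\nabla\tilde N^j)=0,\ \ \langle\tilde N^j\rangle=0,$$ understood in the weak sense with smooth periodic test functions, and let $a^0$ be the constant matrix with $a^0e^j=\langle a(e^j+\nabla N^j)\rangle$. For $\varepsilon\in(0,1)$ put $A_\varepsilon=-\operatorname{div}a(x/\varepsilon)\nabla$, $A_0=-\operatorname{div}a^0\nabla$, $A_0^*=-\operatorname{div}(a^0)^*\nabla$. The resolvents $(A_\varepsilon+1)^{-1}$,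 $(A_0+1)^{-1}$, $(A_0^*+1)^{-1}$ are the bounded operators in the real space $L^2(\mathbb R^d)$ that take $f$ to the unique weak solution in $H^1(\mathbb R^d)$ of the corresponding equation with right-hand side $f$. Let $S^\varepsilon\varphi(x)=\int_\Box\varphi(x-\varepsilon\omega)\,d\omega$ be the Steklov average and $$\mathcal K_\varepsilon=N(\tfrac{\cdot}{\varepsilon})\cdot S^\varepsilon\nabla(A_0+1)^{-1},\qquad \tilde{\mathcal K}_\varepsilon=\tilde N(\tfrac{\cdot}{\varepsilon})\cdot S^\varepsilon\nabla(A_0^*+1)^{-1},$$ $$\mathcal L=(A_0+1)^{-1}\sum_{i,j,k}\bigl(c_i^{jk}-\tilde c_i^{jk}\bigr)\frac{\partial^3}{\partial x_j\partial x_i\partial x_k}(A_0+1)^{-1},$$ where $c_i^{jk}$ and $\tilde c_i^{jk}$ are the $i$-th components of the vectors $$c^{jk}=\langle N^k a^*(e^j+\nabla\tilde N^j)\rangle,\qquad \tilde c^{jk}=\langle\tilde N^k a(e^j+\nabla N^j)\rangle;$$ here $\mathcal Lf$ is the unique $w\in H^1(\mathbb R^d)$ with $(A_0+1)w=\sum(c_i^{jk}-\tilde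 c_i^{jk})\,\partial_j\partial_i\partial_k(A_0+1)^{-1}f$ in the sense of distributions. Then $\mathcal K_\varepsilon$, $\tilde{\mathcal K}_\varepsilon$ and $\mathcal L$ are bounded operators in $L^2(\mathbb R^d)$ and $$\bigl\|(A_\varepsilon+1)^{-1}-(A_0+1)^{-1}-\varepsilon\mathcal K_\varepsilon-\varepsilon(\tilde{\mathcal K}_\varepsilon)^*-\varepsilon\mathcal L\bigr\|_{L^2(\mathbb R^d)\to L^2(\mathbb R^d)}\le C\varepsilon^2,$$ where the constant $C$ depends only on $d$ and $\lambda$. If $a$ is symmetric (almost everywhere), then $\mathcal L=0$ and $\tilde{\mathcal K}_\varepsilon=\mathcal K_\varepsilon$, so that $$\bigl\|(A_\varepsilon+1)^{-1}-(A_0+1)^{-1}-\varepsilon\mathcal K_\varepsilon-\varepsilon(\mathcal K_\varepsilon)^*\bigr\|_{L^2(\mathbb R^d)\to L^2(\mathbb R^d)}\le C\varepsilon^2.$$ -/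

import Mathlib

open MeasureTheory
open scoped ContDiff

noncomputable section

namespace Homogenization

/-- The space `ℝ^d` with its Euclidean norm and Lebesgue measure. -/
abbrev E (d : ℕ) : Type := EuclideanSpace ℝ (Fin d)

/-- The real Hilbert space `L²(ℝ^d)`. -/
abbrev L2 (d : ℕ) : Type := Lp ℝ 2 (volume : Measure (E d))

/-- A matrix field on `ℝ^d`. -/
abbrev MatrixField (d : ℕ) : Type := E d → Matrix (Fin d) (Fin d) ℝ

/-- The unit cube `[-1/2, 1/2)^d`; cell averages are integrals over it. -/
def cell (d : ℕ) : Set (E d) := {y | ∀ i, y i ∈ Set.Ico (-(1 / 2) : ℝ) (1 / 2)}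

/-- `f` is `1`-periodic in each coordinate. -/
def IsPeriodic {d : ℕ} {α : Type*} (f : E d → α) : Prop :=
  ∀ (z : Fin d → ℤ) (y : E d), f (y + WithLp.toLp 2 (fun i => (z i : ℝ))) = f y

/-- The classical partial derivative `∂φ/∂x_i`. -/
def pd {d : ℕ} (i : Fin d) (φ : E d → ℝ) (x : E d) : ℝ :=
  fderiv ℝ φ x (EuclideanSpace.single i 1)

/-- `φ ∈ C_0^∞(ℝ^d)`. -/
def IsTest {d : ℕ} (φ : E d → ℝ) : Prop := ContDiff ℝ ∞ φ ∧ HasCompactSupport φ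

/-- `φ` is a smooth `1`-periodic function. -/
def IsPeriodicTest {d : ℕ} (φ : E d → ℝ) : Prop := ContDiff ℝ ∞ φ ∧ IsPeriodic φ

/-- `f` is `1`-periodic and square integrable over the cell. -/
def IsL2Per {d : ℕ} (f : E d → ℝ) : Prop :=
  IsPeriodic f ∧ MemLp f 2 (volume.restrict (cell d))

/-- `a` is a measurable `1`-periodic real matrix field with
`λ|ξ|² ≤ aξ·ξ` and `aξ·η ≤ λ⁻¹|ξ||η|` almost everywhere. No symmetry is required. -/
structure IsAdmissible {d : ℕ} (lam : ℝ) (a : MatrixField d) : Prop where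
  measurable : ∀ i j, Measurable fun y => a y i j
  periodic : IsPeriodic a
  lower : ∀ᵐ y, ∀ ξ : E d, lam * ‖ξ‖ ^ 2 ≤ ∑ i, ∑ k, a y i k * ξ k * ξ i
  upper : ∀ᵐ y, ∀ ξ η : E d, ∑ i, ∑ k, a y i k * ξ k * η i ≤ lam⁻¹ * ‖ξ‖ * ‖η‖

/-- The transposed matrix field `a^*`. -/
def transposed {d : ℕ} (a : MatrixField d) : MatrixField d := fun y => (a y).transpose

/-- The rescaled matrix field `a_ε(x) = a(x/ε)`. -/
def rescaled {d : ℕ} (ε : ℝ) (a : MatrixField d) : MatrixField d := fun x => a (ε⁻¹ • x)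

/-! ### Cell problem -/

/-- The `i`-th component of `a(e^j + ∇N^j)`, where `DN j k` stands for `∂N^j/∂y_k`. -/
def cellFlux {d : ℕ} (a : MatrixField d) (DN : Fin d → Fin d → E d → ℝ)
    (j i : Fin d) (y : E d) : ℝ :=
  ∑ k, a y i k * ((if k = j then 1 else 0) + DN j k y)

/-- `N = (N^1, …, N^d)` solves the cell problems `N^j ∈ H^1_per`, `div a(e^j + ∇N^j) = 0`,
`⟨N^j⟩ = 0`; `DN j i` is the weak derivative `∂N^j/∂y_i`. Both the weak derivative and the
equation are tested against smooth periodic functions. -/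
structure IsCellSolution {d : ℕ} (a : MatrixField d) (N : Fin d → E d → ℝ)
    (DN : Fin d → Fin d → E d → ℝ) : Prop where
  memL2 : ∀ j, IsL2Per (N j)
  grad_memL2 : ∀ j i, IsL2Per (DN j i)
  weakDeriv : ∀ j i φ, IsPeriodicTest φ →
    ∫ y in cell d, N j y * pd i φ y = -∫ y in cell d, DN j i y * φ y
  equation : ∀ j φ, IsPeriodicTest φ →
    ∫ y in cell d, ∑ i, cellFlux a DN j i y * pd i φ y = 0
  mean_zero : ∀ j, ∫ y in cell d, N j y = 0

/-- The homogenized matrix: `a⁰ e^j = ⟨a(e^j + ∇N^j)⟩`. -/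
def homMatrix {d : ℕ} (a : MatrixField d) (DN : Fin d → Fin d → E d → ℝ) :
    Matrix (Fin d) (Fin d) ℝ :=
  Matrix.of fun i j => ∫ y in cell d, cellFlux a DN j i y

/-- The `i`-th component of the mean vector `⟨M^k a(e^j + ∇N^j)⟩`. -/
def meanTensor {d : ℕ} (M : Fin d → E d → ℝ) (a : MatrixField d)
    (DN : Fin d → Fin d → E d → ℝ) (i j k : Fin d) : ℝ :=
  ∫ y in cell d, M k y * cellFlux a DN j i y

/-! ### Equations in the whole space -/

/-- `G` is the weak gradient of `u` in `L²(ℝ^d)`; `u ∈ H^1(ℝ^d)` iff such a `G` exists. -/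
def HasWeakGradient {d : ℕ} (u : L2 d) (G : Fin d → L2 d) : Prop :=
  ∀ i φ, IsTest φ → ∫ x, u x * pd i φ x = -∫ x, G i x * φ x

/-- `u ∈ H^1(ℝ^d)` and `-div(a∇u) + u = F` in the sense of distributions, where the right-hand
side is given through its action on test functions. -/
def IsWeakSolution {d : ℕ} (a : MatrixField d) (u : L2 d) (F : (E d → ℝ) → ℝ) : Prop :=
  ∃ G : Fin d → L2 d, HasWeakGradient u G ∧
    ∀ φ, IsTest φ →
      ∫ x, ((∑ i, ∑ k, a x i k * G k x * pd i φ x) + u x * φ x) = F φ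

/-- `R = (A + 1)^{-1}` on `L²(ℝ^d)` for `A = -div a∇`: for each `f ∈ L²` the equation
`u ∈ H^1`, `Au + u = f` has `R f` as its one and only solution. -/
def IsResolvent {d : ℕ} (a : MatrixField d) (R : L2 d →L[ℝ] L2 d) : Prop :=
  ∀ f u : L2 d, IsWeakSolution a u (fun φ => ∫ x, f x * φ x) ↔ u = R f

/-- The Steklov average `S^ε φ(x) = ∫_□ φ(x - εz) dz`. -/
def steklov {d : ℕ} (ε : ℝ) (φ : E d → ℝ) (x : E d) : ℝ :=
  ∫ z in cell d, φ (x - ε • z)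

/-- `K = N(·/ε) · S^ε ∇ R` as an operator in `L²(ℝ^d)`. -/
def IsCorrector {d : ℕ} (ε : ℝ) (N : Fin d → E d → ℝ) (R K : L2 d →L[ℝ] L2 d) : Prop :=
  ∀ f : L2 d, ∃ G : Fin d → L2 d, HasWeakGradient (R f) G ∧
    (K f : E d → ℝ) =ᵐ[volume] fun x => ∑ j, N j (ε⁻¹ • x) * steklov ε (G j) x

/-- The distribution `∑ T_i^{jk} ∂³u/∂x_j∂x_i∂x_k` (its action on a test function). -/
def thirdOrder {d : ℕ} (T : Fin d → Fin d → Fin d → ℝ) (u : L2 d) (φ : E d → ℝ) : ℝ :=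
  -∫ x, u x * ∑ i, ∑ j, ∑ k, T i j k * pd j (pd i (pd k φ)) x

/-- `L = (A₀ + 1)^{-1} (∑ T_i^{jk} ∂³/∂x_j∂x_i∂x_k) R`, where `A₀ = -div a₀∇` with constant `a₀`:
`L f` is the one and only `w ∈ H^1` with `A₀w + w = ∑ T_i^{jk} ∂³(R f)/∂x_j∂x_i∂x_k` in the
sense of distributions. -/
def IsThirdOrderCorrector {d : ℕ} (a₀ : Matrix (Fin d) (Fin d) ℝ)
    (T : Fin d → Fin d → Fin d → ℝ) (R L : L2 d →L[ℝ] L2 d) : Prop :=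
  ∀ f w : L2 d, IsWeakSolution (fun _ => a₀) w (thirdOrder T (R f)) ↔ w = L f

end Homogenization

end

open Homogenization

/-!
The proof replaces Steklov averaging by the sharp Fourier cutoff `Π = lowPass ε` to the dual cell
`|ξ_i| < 1/(2ε)`. Its advantage is exactness: if `g` and `h` are band-limited to the dual cell, the
product `gh` has no frequencies in `ε⁻¹ℤ^d \ {0}`, so for `1`-periodic `b, c ∈ L²(□)`

  `∫ (b(x/ε) g(x)) (c(x/ε) h(x)) dx = ⟨bc⟩ ∫ g h dx`

without any remainder (`BandLimited.integral_mul`, `inner_osc`). In particular `b(x/ε)Πg` is square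
integrable although `b` is unbounded, and smoothness of the coefficients plays no role.

Let `u = (A₀ + 1)⁻¹f` and `w = Πu + εN(x/ε) · Π∇u`. The flux of `w` is `a⁰∇Πu` plus the rescaled
fluctuations `a(e^j + ∇N^j) - a⁰e^j`, which are divergence free of mean zero. Being divergence free
they let an integration by parts fall on the band-limited factor (`sum_inner_osc_divFree`); being of
mean zero they are orthogonal to low frequencies (`inner_osc_eq_sub_lowPass`). The residual of `w`
is therefore `O(ε)` in `H⁻¹`, and coercivity gives `‖(A_ε + 1)⁻¹f - w‖_{H¹} ≤ Cε‖f‖`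
(`IsCellSolution.first_order`), with no flux potential needed.

The second order comes from duality. Let `B_ε` be the form of `A_ε + 1`, let `u_ε = (A_ε + 1)⁻¹f`,
`v_ε = (A_ε^* + 1)⁻¹g`, and let `w̃` be the first approximation of `v_ε`, built from the correctors
`Ñ` of the transposed problem. Then `B_ε(u_ε - w, v_ε - w̃) = O(ε²)` as a product of two first-order
errors. On the other hand it equals `⟪u_ε, g⟫ - ⟪f, w̃⟫ - ⟪w, g⟫ + B_ε(w, w̃)`, and `B_ε(w, w̃)` can
be computed by the factorization above: its leading part is `⟪(A₀ + 1)⁻¹Πf, g⟫`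
(`IsCellSolution.energy_leadGrad_leadGrad`), and the two terms of order `ε` are exactly the pairing
with the third-order operator whose coefficients are the mean tensors
(`IsCellSolution.energy_mixed`). This is `IsCellSolution.second_order`. The remaining cutoffs cost
`O(ε²)` on the resolvent and `O(ε)` on the operators that carry a factor `ε`.

Replacing `Π` by the Steklov average changes each corrector by `O(ε)`
(`norm_mul_steklov_sub_osc_le`). For symmetric `a`, uniqueness in the cell problem gives `Ñ = N`,
so the two mean tensors cancel.
-/

/-! ### The Fourier transform in `L²(ℝ^d)` -/

namespace Homogenization

open scoped FourierTransform Real ComplexConjugate RealInnerProductSpace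

/-- Multiplication by an essentially bounded function is a bounded operator in `L²`. -/
theorem exists_mulCLM {α 𝕜 : Type*} [MeasurableSpace α] [RCLike 𝕜] {μ : Measure α} (m : α → 𝕜)
    (hm : AEStronglyMeasurable m μ) {C : ℝ} (hC : 0 ≤ C) (hb : ∀ᵐ x ∂μ, ‖m x‖ ≤ C) :
    ∃ T : Lp 𝕜 2 μ →L[𝕜] Lp 𝕜 2 μ, (∀ f, T f =ᵐ[μ] fun x => m x * f x) ∧ ‖T‖ ≤ C := by
  have hmem : ∀ f : Lp 𝕜 2 μ, MemLp (fun x => m x * f x) 2 μ := fun f =>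
    (Lp.memLp f).of_le_mul (c := C) (hm.mul (Lp.memLp f).1) (by
      filter_upwards [hb] with x hx
      rw [norm_mul]; gcongr)
  let T₀ : Lp 𝕜 2 μ →ₗ[𝕜] Lp 𝕜 2 μ :=
    { toFun := fun f => (hmem f).toLp _
      map_add' := fun f g => by
        ext1
        filter_upwards [(hmem (f + g)).coeFn_toLp, Lp.coeFn_add f g, (hmem f).coeFn_toLp,
          (hmem g).coeFn_toLp, Lp.coeFn_add ((hmem f).toLp _) ((hmem g).toLp _)]
          with x h1 h2 h3 h4 h5
        rw [h1, h5, Pi.add_apply, h3, h4, h2, Pi.add_apply, mul_add]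
      map_smul' := fun c f => by
        ext1
        filter_upwards [(hmem (c • f)).coeFn_toLp, Lp.coeFn_smul c f, (hmem f).coeFn_toLp,
          Lp.coeFn_smul c ((hmem f).toLp _)] with x h1 h2 h3 h4
        simp only [RingHom.id_apply]
        rw [h1, h4, Pi.smul_apply, h3, h2, Pi.smul_apply, smul_eq_mul, smul_eq_mul]; ring }
  have hT : ∀ f, T₀ f =ᵐ[μ] fun x => m x * f x := fun f => (hmem f).coeFn_toLp
  have hn : ∀ f, ‖T₀ f‖ ≤ C * ‖f‖ := fun f => by
    refine Lp.norm_le_mul_norm_of_ae_le_mul ?_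
    filter_upwards [hT f, hb] with x h1 h2
    rw [h1, norm_mul]; gcongr
  exact ⟨T₀.mkContinuous C hn, hT, T₀.mkContinuous_norm_le hC hn⟩

section Fourier

variable {d : ℕ}

/-- The complex Hilbert space `L²(ℝ^d; ℂ)`. -/
abbrev L2C (d : ℕ) : Type := Lp ℂ 2 (volume : Measure (E d))

/-- The character `t ↦ e^{2πit}`, as a complex number. -/
noncomputable def expi (t : ℝ) : ℂ := Complex.exp ((2 * π * t : ℝ) * Complex.I)

theorem continuous_expi_comp {X : Type*} [TopologicalSpace X] {g : X → ℝ}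
    (hg : Continuous g) : Continuous fun x => expi (g x) := by
  unfold expi
  fun_prop

@[simp] theorem norm_expi (t : ℝ) : ‖expi t‖ = 1 := Complex.norm_exp_ofReal_mul_I _

theorem expi_add (s t : ℝ) : expi (s + t) = expi s * expi t := by
  unfold expi
  rw [← Complex.exp_add]
  push_cast
  ring_nf

theorem conj_expi (t : ℝ) : conj (expi t) = expi (-t) := by
  unfold expi
  rw [← Complex.exp_conj, map_mul, Complex.conj_ofReal, Complex.conj_I]
  push_cast
  ring_nf

theorem fourier_eq_expi (g : E d → ℂ) (ξ : E d) : 𝓕 g ξ = ∫ v, expi (-⟪v, ξ⟫) * g v := by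
  rw [Real.fourier_eq']
  refine integral_congr_ae (Filter.Eventually.of_forall fun y => ?_)
  simp only [expi, smul_eq_mul]
  ring_nf

/-- On `L¹ ∩ L²` the Plancherel transform is given by the Fourier integral; both are compared as
tempered distributions. -/
theorem fourier_toLp_ae (g : E d → ℂ) (h1 : Integrable g) (h2 : MemLp g 2) :
    (𝓕 (h2.toLp g) : L2C d) =ᵐ[volume] 𝓕 g := by
  refine ae_eq_of_integral_contDiff_smul_eq ((Lp.memLp _).locallyIntegrable (by norm_num))
    (Continuous.locallyIntegrable ?_) ?_
  · exact VectorFourier.fourierIntegral_continuous Real.continuous_fourierChar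
      (by exact continuous_inner) h1
  intro φ hφ hc
  have hg₁ : HasCompactSupport (Complex.ofRealCLM ∘ φ) := hc.comp_left rfl
  have hg₂ : ContDiff ℝ ∞ (Complex.ofRealCLM ∘ φ) := by fun_prop
  have key := congrArg (fun T => T (hg₁.toSchwartzMap hg₂))
    (Lp.fourier_toTemperedDistribution_eq (h2.toLp g))
  simp only [TemperedDistribution.fourier_apply, Lp.toTemperedDistribution_apply] at key
  have e1 : ∫ x, φ x • (𝓕 (h2.toLp g) : L2C d) x =
      ∫ x, (hg₁.toSchwartzMap hg₂) x • (𝓕 (h2.toLp g) : L2C d) x := by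
    refine integral_congr_ae (Filter.Eventually.of_forall fun x => ?_)
    simp
  rw [e1, ← key]
  have e2 : ∫ x, (𝓕 (hg₁.toSchwartzMap hg₂)) x • (h2.toLp g) x =
      ∫ x, (𝓕 (hg₁.toSchwartzMap hg₂)) x • g x := by
    refine integral_congr_ae ?_
    filter_upwards [h2.coeFn_toLp] with x hx
    rw [hx]
  rw [e2]
  have e3 := VectorFourier.integral_fourierIntegral_smul_eq_flip (μ := volume) (ν := volume)
    (L := innerₗ (E d)) Real.continuous_fourierChar (by exact continuous_inner)
    (hg₁.toSchwartzMap hg₂).integrable h1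
  rw [flip_innerₗ] at e3
  refine e3.trans ?_
  refine integral_congr_ae (Filter.Eventually.of_forall fun x => ?_)
  simp only [HasCompactSupport.toSchwartzMap_toFun, Function.comp_apply, Complex.ofRealCLM_apply, Complex.real_smul, smul_eq_mul]
  rfl

theorem L2C.ext_of_schwartz {F G : L2C d → L2C d} (hF : Continuous F) (hG : Continuous G)
    (h : ∀ (g : SchwartzMap (E d) ℂ), F ((g.memLp 2 volume).toLp g) = G ((g.memLp 2 volume).toLp g)) :
    F = G := by
  funext f
  refine DenseRange.induction_on (p := fun f => F f = G f)
    (SchwartzMap.denseRange_toLpCLM (p := 2) (μ := (volume : Measure (E d))) (F := ℂ)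
      ENNReal.ofNat_ne_top) f (isClosed_eq hF hG) ?_
  intro g
  exact h g

/-- Pointwise complex conjugation on `L²(ℝ^d; ℂ)`. -/
noncomputable def conjL (d : ℕ) : L2C d →L[ℝ] L2C d :=
  Complex.conjCLE.toContinuousLinearMap.compLpL 2 volume

theorem conjL_ae (f : L2C d) : conjL d f =ᵐ[volume] fun x => conj (f x) :=
  ContinuousLinearMap.coeFn_compLpL _ f

/-- Composition with a measure preserving map of `ℝ^d`. -/
noncomputable abbrev compL {d : ℕ} (τ : E d → E d) (h : MeasurePreserving τ volume volume) : L2C d →ₗᵢ[ℂ] L2C d :=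
  Lp.compMeasurePreservingₗᵢ ℂ τ h

theorem compL_ae (τ : E d → E d) (h : MeasurePreserving τ volume volume) (f : L2C d) :
    compL τ h f =ᵐ[volume] fun x => f (τ x) :=
  Lp.coeFn_compMeasurePreserving f h

theorem fourier_continuous : Continuous (fun f : L2C d => (𝓕 f : L2C d)) :=
  (Lp.fourierTransformₗᵢ (E d) ℂ).continuous

/-- Conjugation becomes Hermitian reflection on the Fourier side. -/
theorem fourier_conjL (f : L2C d) :
    (𝓕 (conjL d f) : L2C d) =
      conjL d (compL (fun x => -x) (Measure.measurePreserving_neg volume) (𝓕 f)) := by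
  refine congrFun (L2C.ext_of_schwartz (F := fun f => 𝓕 (conjL d f)) (G := fun f =>
    conjL d (compL (fun x => -x) (Measure.measurePreserving_neg volume) (𝓕 f))) ?_ ?_ ?_) f
  · exact fourier_continuous.comp (conjL d).continuous
  · exact (conjL d).continuous.comp ((compL _ _).continuous.comp fourier_continuous)
  intro g
  have hi : Integrable (fun x => conj (g x)) :=
    (Complex.conjCLE.toContinuousLinearMap.integrable_comp g.integrable)
  have hm : MemLp (fun x => conj (g x)) 2 volume := (g.memLp 2 volume).star
  have e : conjL d ((g.memLp 2 volume).toLp g) = hm.toLp _ := by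
    ext1
    filter_upwards [conjL_ae ((g.memLp 2 volume).toLp g), hm.coeFn_toLp,
      (g.memLp 2 volume).coeFn_toLp] with x h1 h2 h3
    rw [h1, h2, h3]
  rw [e]
  ext1
  have h5 := (Measure.measurePreserving_neg (volume : Measure (E d))).quasiMeasurePreserving.ae
    (fourier_toLp_ae g g.integrable (g.memLp 2 volume))
  filter_upwards [fourier_toLp_ae _ hi hm, conjL_ae (compL (fun x => -x)
    (Measure.measurePreserving_neg volume) (𝓕 ((g.memLp 2 volume).toLp g))), compL_ae (fun x => -x)
    (Measure.measurePreserving_neg volume) (𝓕 ((g.memLp 2 volume).toLp g)), h5] with x h1 h2 h3 h4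
  rw [h1, h2, h3, h4, fourier_eq_expi, fourier_eq_expi, ← integral_conj]
  refine integral_congr_ae (Filter.Eventually.of_forall fun y => ?_)
  simp only [map_mul, inner_neg_right, neg_neg, conj_expi]

theorem fourier_modulation (y : E d) (f g : L2C d)
    (hg : g =ᵐ[volume] fun x => expi ⟪x, y⟫ * f x) :
    (𝓕 g : L2C d) =ᵐ[volume] fun ξ => (𝓕 f : L2C d) (ξ - y) := by
  obtain ⟨T, hT, -⟩ := exists_mulCLM (μ := (volume : Measure (E d)))
    (fun x => expi ⟪x, y⟫)
    (by
      refine Continuous.aestronglyMeasurable ?_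
      exact continuous_expi_comp (by fun_prop))
    (C := 1) zero_le_one
    (Filter.Eventually.of_forall fun x => by simp)
  have hτ : MeasurePreserving (fun ξ : E d => ξ - y) volume volume := measurePreserving_sub_right _ y
  have key := congrFun (L2C.ext_of_schwartz (F := fun f => 𝓕 (T f)) (G := fun f =>
    compL (fun ξ => ξ - y) hτ (𝓕 f)) (fourier_continuous.comp T.continuous)
    ((compL _ _).continuous.comp fourier_continuous) ?_) f
  · have : T f = g := by
      ext1
      filter_upwards [hT f, hg] with x h1 h2
      rw [h1, h2]
    rw [← this]
    filter_upwards [compL_ae _ hτ (𝓕 f), (Lp.ext_iff.1 key)] with x h1 h2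
    rw [h2, h1]
  intro g
  have hc : AEStronglyMeasurable (fun x => expi ⟪x, y⟫) (volume : Measure (E d)) :=
    (continuous_expi_comp (by fun_prop)).aestronglyMeasurable
  have hi : Integrable (fun x => expi ⟪x, y⟫ * g x) :=
    g.integrable.bdd_mul (c := 1) hc (Filter.Eventually.of_forall fun x => by simp)
  have hm : MemLp (fun x => expi ⟪x, y⟫ * g x) 2 volume :=
    (g.memLp 2 volume).of_le (hc.mul (g.memLp 2 volume).1)
      (Filter.Eventually.of_forall fun x => by simp)
  have e : T ((g.memLp 2 volume).toLp g) = hm.toLp _ := by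
    ext1
    filter_upwards [hT ((g.memLp 2 volume).toLp g), hm.coeFn_toLp,
      (g.memLp 2 volume).coeFn_toLp] with x h1 h2 h3
    rw [h1, h2, h3]
  rw [e]
  ext1
  filter_upwards [fourier_toLp_ae _ hi hm, compL_ae _ hτ (𝓕 ((g.memLp 2 volume).toLp g)),
    hτ.quasiMeasurePreserving.ae (fourier_toLp_ae g g.integrable (g.memLp 2 volume))]
    with x h1 h2 h3
  rw [h1, h2, h3, fourier_eq_expi, fourier_eq_expi]
  refine integral_congr_ae (Filter.Eventually.of_forall fun z => ?_)
  simp only [inner_sub_right, neg_sub]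
  rw [← mul_assoc, ← expi_add]
  congr 2
  ring_nf

theorem fourier_translation (y : E d) (f g : L2C d)
    (hg : g =ᵐ[volume] fun x => f (x - y)) :
    (𝓕 g : L2C d) =ᵐ[volume] fun ξ => expi (-⟪y, ξ⟫) * (𝓕 f : L2C d) ξ := by
  obtain ⟨T, hT, -⟩ := exists_mulCLM (μ := (volume : Measure (E d)))
    (fun ξ => expi (-⟪y, ξ⟫))
    (by
      refine Continuous.aestronglyMeasurable ?_
      exact continuous_expi_comp (by fun_prop))
    (C := 1) zero_le_one
    (Filter.Eventually.of_forall fun x => by simp)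
  have hτ : MeasurePreserving (fun ξ : E d => ξ - y) volume volume := measurePreserving_sub_right _ y
  have key := congrFun (L2C.ext_of_schwartz (F := fun f => 𝓕 (compL (fun ξ => ξ - y) hτ f))
    (G := fun f => T (𝓕 f)) (fourier_continuous.comp (compL _ _).continuous)
    (T.continuous.comp fourier_continuous) ?_) f
  · have : compL (fun ξ => ξ - y) hτ f = g := by
      ext1
      filter_upwards [compL_ae _ hτ f, hg] with x h1 h2
      rw [h1, h2]
    rw [← this]
    filter_upwards [hT (𝓕 f), (Lp.ext_iff.1 key)] with x h1 h2
    rw [h2, h1]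
  intro g
  have hi : Integrable (fun x => g (x - y)) := g.integrable.comp_sub_right y
  have hm : MemLp (fun x => g (x - y)) 2 volume := (g.memLp 2 volume).comp_measurePreserving hτ
  have e : compL (fun ξ => ξ - y) hτ ((g.memLp 2 volume).toLp g) = hm.toLp _ := by
    ext1
    filter_upwards [compL_ae _ hτ ((g.memLp 2 volume).toLp g), hm.coeFn_toLp,
      hτ.quasiMeasurePreserving.ae (g.memLp 2 volume).coeFn_toLp] with x h1 h2 h3
    rw [h1, h2, h3]
  rw [e]
  ext1
  filter_upwards [fourier_toLp_ae _ hi hm, hT (𝓕 ((g.memLp 2 volume).toLp g)),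
    (fourier_toLp_ae g g.integrable (g.memLp 2 volume))]
    with x h1 h2 h3
  rw [h1, h2, h3, fourier_eq_expi, fourier_eq_expi]
  rw [← integral_add_right_eq_self _ y, ← integral_const_mul]
  refine integral_congr_ae (Filter.Eventually.of_forall fun z => ?_)
  simp only [inner_add_left, add_sub_cancel_right]
  rw [← mul_assoc, ← expi_add]
  congr 3
  ring_nf

end Fourier

end Homogenization

/-! ### Fourier multipliers on the real space `L²(ℝ^d)` -/

namespace Homogenization

open scoped FourierTransform Real ComplexConjugate RealInnerProductSpace

variable {d : ℕ}

section TestFunctions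

theorem contDiff_pd (i : Fin d) {φ : E d → ℝ} (h : ContDiff ℝ ∞ φ) : ContDiff ℝ ∞ (pd i φ) :=
  (h.fderiv_right (m := ∞) le_rfl).clm_apply contDiff_const

theorem IsTest.pd {φ : E d → ℝ} (h : IsTest φ) (i : Fin d) : IsTest (pd i φ) :=
  ⟨contDiff_pd i h.1, h.2.fderiv_apply (𝕜 := ℝ) _⟩

theorem IsTest.mul_smooth {φ ψ : E d → ℝ} (h : IsTest φ) (hψ : ContDiff ℝ ∞ ψ) :
    IsTest (fun x => ψ x * φ x) :=
  ⟨hψ.mul h.1, h.2.mul_left⟩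

theorem IsTest.memLp {φ : E d → ℝ} (h : IsTest φ) : MemLp φ 2 (volume : Measure (E d)) :=
  h.1.continuous.memLp_of_hasCompactSupport h.2

theorem pd_mul (i : Fin d) {φ ψ : E d → ℝ} (hφ : ContDiff ℝ ∞ φ) (hψ : ContDiff ℝ ∞ ψ) (x : E d) :
    pd i (fun x => φ x * ψ x) x = φ x * pd i ψ x + pd i φ x * ψ x := by
  have h1 := (hφ.differentiable (by simp)) x
  have h2 := (hψ.differentiable (by simp)) x
  unfold pd
  rw [fderiv_fun_mul h1 h2]
  simp only [_root_.add_apply, _root_.smul_apply, smul_eq_mul]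
  ring

theorem pd_comp_smul (i : Fin d) (c : ℝ) {φ : E d → ℝ} (hφ : ContDiff ℝ ∞ φ) (x : E d) :
    pd i (fun x => φ (c • x)) x = c * pd i φ (c • x) := by
  have h1 : HasFDerivAt φ (fderiv ℝ φ (c • x)) (c • x) :=
    ((hφ.differentiable (by simp)) _).hasFDerivAt
  have h2 : HasFDerivAt (fun x : E d => c • x) (c • ContinuousLinearMap.id ℝ (E d)) x :=
    (hasFDerivAt_id x).const_smul c
  unfold pd
  have h3 : HasFDerivAt (fun x => φ (c • x)) _ x := h1.comp x h2
  rw [h3.fderiv]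
  simp

end TestFunctions

section Real

theorem integrable_L2_mul {f g : E d → ℝ} (hf : MemLp f 2 (volume : Measure (E d)))
    (hg : MemLp g 2 (volume : Measure (E d))) : Integrable (fun x => f x * g x) :=
  hf.integrable_mul hg

theorem inner_eq_integral_mul (f g : L2 d) : ⟪f, g⟫ = ∫ x, f x * g x := by
  rw [L2.inner_def]
  refine integral_congr_ae (Filter.Eventually.of_forall fun x => ?_)
  simp [mul_comm]

/-- The inclusion of the real space `L²(ℝ^d)` into the complex one. -/
noncomputable def complexify (d : ℕ) : L2 d →L[ℝ] L2C d :=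
  Complex.ofRealCLM.compLpL 2 volume

theorem complexify_ae (f : L2 d) : complexify d f =ᵐ[volume] fun x => (f x : ℂ) :=
  ContinuousLinearMap.coeFn_compLpL _ f

/-- The Fourier transform of a real function. -/
noncomputable def hat : L2 d →L[ℝ] L2C d :=
  ((Lp.fourierTransformₗᵢ (E d) ℂ).toContinuousLinearEquiv.toContinuousLinearMap.restrictScalars ℝ)
    ∘L complexify d

theorem hat_apply (f : L2 d) : hat f = (𝓕 (complexify d f) : L2C d) := rfl

theorem inner_hat (f g : L2 d) : inner ℂ (hat f) (hat g) = ((⟪f, g⟫ : ℝ) : ℂ) := by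
  rw [hat_apply, hat_apply, Lp.inner_fourier_eq, L2.inner_def, inner_eq_integral_mul,
    ← integral_complex_ofReal]
  refine integral_congr_ae ?_
  filter_upwards [complexify_ae f, complexify_ae g] with x h1 h2
  rw [h1, h2]
  simp [mul_comm]

theorem norm_hat (f : L2 d) : ‖hat f‖ = ‖f‖ := by
  have h1 := inner_self_eq_norm_sq_to_K (𝕜 := ℂ) (hat f)
  rw [inner_hat, real_inner_self_eq_norm_sq] at h1
  have h2 : ‖f‖ ^ 2 = ‖hat f‖ ^ 2 := Complex.ofReal_injective (by simpa using h1)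
  exact ((sq_eq_sq₀ (norm_nonneg _) (norm_nonneg _)).1 h2).symm

theorem inner_eq_integral_hat (f g : L2 d) :
    ((⟪f, g⟫ : ℝ) : ℂ) = ∫ ξ, conj (hat f ξ) * hat g ξ := by
  refine (inner_hat f g).symm.trans ((L2.inner_def (hat f) (hat g)).trans ?_)
  refine integral_congr_ae (Filter.Eventually.of_forall fun x => ?_)
  exact RCLike.inner_apply' _ _

theorem integrable_hat_mul (f g : L2 d) : Integrable fun ξ => conj (hat f ξ) * hat g ξ :=
  (Lp.memLp (hat f)).star.integrable_mul (Lp.memLp (hat g))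

theorem hat_injective : Function.Injective (hat : L2 d → L2C d) := by
  rw [injective_iff_map_eq_zero]
  intro f hf
  rw [← norm_eq_zero, ← norm_hat, hf, norm_zero]

theorem hat_neg_arg (f : L2 d) : ∀ᵐ ξ, hat f (-ξ) = conj (hat f ξ) := by
  have h : conjL d (complexify d f) = complexify d f := by
    ext1
    filter_upwards [conjL_ae (complexify d f), complexify_ae f] with x h1 h2
    rw [h1, h2, Complex.conj_ofReal]
  have key := fourier_conjL (complexify d f)
  rw [h] at key
  filter_upwards [Lp.ext_iff.1 key, conjL_ae (compL (fun x => -x)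
    (Measure.measurePreserving_neg volume) (𝓕 (complexify d f))), compL_ae (fun x => -x)
    (Measure.measurePreserving_neg volume) (𝓕 (complexify d f))] with ξ h1 h2 h3
  rw [hat_apply, h1, h2, h3, Complex.conj_conj]

/-- A function in `L²(ℝ^d; ℂ)` with Hermitian symmetry is the Fourier transform of a real
function. -/
theorem exists_hat_eq (g : L2C d) (hg : ∀ᵐ ξ, g (-ξ) = conj (g ξ)) : ∃ f : L2 d, hat f = g := by
  have hn : MeasurePreserving (fun x : E d => -x) volume volume :=
    Measure.measurePreserving_neg volume
  have e1 : (𝓕 (conjL d (𝓕⁻ g)) : L2C d) = g := by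
    rw [fourier_conjL, FourierTransform.fourier_fourierInv_eq]
    ext1
    filter_upwards [conjL_ae (compL (fun x => -x) hn g), compL_ae _ hn g, hg] with x h1 h2 h3
    rw [h1, h2, h3, Complex.conj_conj]
  have e2 : conjL d (𝓕⁻ g) = 𝓕⁻ g := by
    apply (Lp.fourierTransformₗᵢ (E d) ℂ).injective
    exact e1.trans (FourierTransform.fourier_fourierInv_eq (E := L2C d) (F := L2C d) g).symm
  refine ⟨Complex.reCLM.compLpL 2 volume (𝓕⁻ g), ?_⟩
  have e3 : complexify d (Complex.reCLM.compLpL 2 volume (𝓕⁻ g)) = 𝓕⁻ g := by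
    ext1
    filter_upwards [complexify_ae (Complex.reCLM.compLpL 2 volume (𝓕⁻ g)),
      ContinuousLinearMap.coeFn_compLpL Complex.reCLM (𝓕⁻ g), conjL_ae (𝓕⁻ g : L2C d)]
      with x h1 h2 h3
    rw [e2] at h3
    rw [h1, h2]
    exact Complex.conj_eq_iff_re.1 h3.symm
  rw [hat_apply, e3, FourierTransform.fourier_fourierInv_eq]

end Real

section Multipliers

/-- `T` is the Fourier multiplier with symbol `m`. -/
def IsMultiplier (m : E d → ℂ) (T : L2 d →L[ℝ] L2 d) : Prop :=
  ∀ f : L2 d, hat (T f) =ᵐ[volume] fun ξ => m ξ * hat f ξ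

/-- The Hermitian symmetry of the symbol makes the multiplier preserve real functions. -/
theorem exists_multiplier (m : E d → ℂ) (hm : Measurable m) {C : ℝ} (hb : ∀ ξ, ‖m ξ‖ ≤ C)
    (hs : ∀ ξ, m (-ξ) = conj (m ξ)) : ∃ T : L2 d →L[ℝ] L2 d, IsMultiplier m T := by
  have hC : 0 ≤ C := (norm_nonneg _).trans (hb 0)
  obtain ⟨S, hS, hSn⟩ := exists_mulCLM (μ := (volume : Measure (E d))) m hm.aestronglyMeasurable hC
    (Filter.Eventually.of_forall hb)
  have hex : ∀ f : L2 d, ∃ g : L2 d, hat g = S (hat f) := fun f => by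
    refine exists_hat_eq _ ?_
    filter_upwards [hS (hat f), (Measure.measurePreserving_neg
      (volume : Measure (E d))).quasiMeasurePreserving.ae (hS (hat f)), hat_neg_arg f]
      with ξ h1 h2 h3
    rw [h1, h2, h3, hs, map_mul]
  choose T hT using hex
  let T' : L2 d →ₗ[ℝ] L2 d :=
    { toFun := T
      map_add' := fun f g => hat_injective (by rw [map_add, hT, hT, hT, map_add, map_add])
      map_smul' := fun c f => hat_injective (by
        rw [RingHom.id_apply, map_smul, hT, hT, map_smul, ← algebraMap_smul ℂ c (hat f),
          map_smul, algebraMap_smul]) }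
  refine ⟨T'.mkContinuous C fun f => ?_, fun f => ?_⟩
  · change ‖T f‖ ≤ _
    rw [← norm_hat (T f), hT, ← norm_hat f]
    exact (S.le_opNorm _).trans (by gcongr)
  · change hat (T f) =ᵐ[volume] _
    rw [hT]
    exact hS _

theorem IsMultiplier.norm_apply_le {m : E d → ℂ} {T : L2 d →L[ℝ] L2 d} (h : IsMultiplier m T)
    {C : ℝ} (hb : ∀ ξ, ‖m ξ‖ ≤ C) (f : L2 d) : ‖T f‖ ≤ C * ‖f‖ := by
  rw [← norm_hat (T f), ← norm_hat f]
  refine Lp.norm_le_mul_norm_of_ae_le_mul ?_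
  filter_upwards [h f] with ξ h1
  rw [h1, norm_mul]
  gcongr
  exact hb ξ

theorem IsMultiplier.comp {m n : E d → ℂ} {T S : L2 d →L[ℝ] L2 d} (hT : IsMultiplier m T)
    (hS : IsMultiplier n S) : IsMultiplier (fun ξ => m ξ * n ξ) (T ∘L S) := fun f => by
  filter_upwards [hT (S f), hS f] with ξ h1 h2
  rw [ContinuousLinearMap.comp_apply, h1, h2, mul_assoc]

theorem hat_smul_ae (c : ℝ) (f : L2 d) : hat (c • f) =ᵐ[volume] fun ξ => (c : ℂ) * hat f ξ := by
  rw [map_smul]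
  filter_upwards [Lp.coeFn_smul c (hat f)] with ξ h1
  rw [h1, Pi.smul_apply, Complex.real_smul]

theorem hat_sub_ae (f g : L2 d) : hat (f - g) =ᵐ[volume] fun ξ => hat f ξ - hat g ξ := by
  rw [map_sub]
  exact Lp.coeFn_sub _ _

theorem hat_sum_ae {ι : Type*} (s : Finset ι) (f : ι → L2 d) :
    hat (∑ i ∈ s, f i) =ᵐ[volume] fun ξ => ∑ i ∈ s, hat (f i) ξ := by
  rw [map_sum]
  filter_upwards [Lp.coeFn_finsetSum s (fun i => hat (f i))] with ξ h1
  rw [h1, Finset.sum_apply]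

theorem IsMultiplier.smul {m : E d → ℂ} {T : L2 d →L[ℝ] L2 d} (hT : IsMultiplier m T) (c : ℝ) :
    IsMultiplier (fun ξ => c * m ξ) (c • T) := fun f => by
  filter_upwards [hT f, hat_smul_ae c (T f)] with ξ h1 h2
  rw [_root_.smul_apply, h2, h1, mul_assoc]

theorem IsMultiplier.sub {m n : E d → ℂ} {T S : L2 d →L[ℝ] L2 d} (hT : IsMultiplier m T)
    (hS : IsMultiplier n S) : IsMultiplier (fun ξ => m ξ - n ξ) (T - S) := fun f => by
  filter_upwards [hT f, hS f, hat_sub_ae (T f) (S f)] with ξ h1 h2 h3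
  rw [_root_.sub_apply, h3, h1, h2, sub_mul]

theorem isMultiplier_one : IsMultiplier (fun _ : E d => (1 : ℂ)) (ContinuousLinearMap.id ℝ (L2 d)) :=
  fun f => Filter.Eventually.of_forall fun ξ => by simp

theorem IsMultiplier.congr {m n : E d → ℂ} {T : L2 d →L[ℝ] L2 d} (hT : IsMultiplier m T)
    (h : ∀ ξ, m ξ = n ξ) : IsMultiplier n T := by
  rwa [← show m = n from funext h]

theorem IsMultiplier.unique {m : E d → ℂ} {T S : L2 d →L[ℝ] L2 d} (hT : IsMultiplier m T)
    (hS : IsMultiplier m S) : T = S := by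
  ext1 f
  refine hat_injective (Lp.ext ?_)
  filter_upwards [hT f, hS f] with ξ h1 h2
  rw [h1, h2]

theorem IsMultiplier.adjoint {m : E d → ℂ} {T : L2 d →L[ℝ] L2 d} (hT : IsMultiplier m T)
    {S : L2 d →L[ℝ] L2 d} (hS : IsMultiplier (fun ξ => conj (m ξ)) S) (f g : L2 d) :
    ⟪T f, g⟫ = ⟪f, S g⟫ := by
  have h : ((⟪T f, g⟫ : ℝ) : ℂ) = ((⟪f, S g⟫ : ℝ) : ℂ) := by
    rw [inner_eq_integral_hat, inner_eq_integral_hat]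
    refine integral_congr_ae ?_
    filter_upwards [hT f, hS g] with ξ h1 h2
    rw [h1, h2, map_mul]
    ring
  exact_mod_cast h

end Multipliers

end Homogenization

/-! ### Weak derivatives on the Fourier side -/

namespace Homogenization

open scoped FourierTransform Real ComplexConjugate RealInnerProductSpace LineDeriv
open Filter Topology

variable {d : ℕ}

section WeakIdentity

/-- The symbol `2πiξ_i` of `∂/∂x_i`. -/
noncomputable def dsym (i : Fin d) (ξ : E d) : ℂ := 2 * π * Complex.I * (ξ i : ℂ)

theorem continuous_dsym (i : Fin d) : Continuous (dsym i : E d → ℂ) := by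
  unfold dsym
  fun_prop

/-- Cutoffs converging to `1` with bounded derivatives converging to `0`: dilations of one bump
function. -/
theorem exists_cutoff (d : ℕ) : ∃ (χ : ℕ → E d → ℝ) (C : ℝ), (∀ n, IsTest (χ n)) ∧
    (∀ n x, ‖χ n x‖ ≤ C) ∧ (∀ n i x, ‖pd i (χ n) x‖ ≤ C) ∧
    (∀ x, Tendsto (fun n => χ n x) atTop (𝓝 1)) ∧
    (∀ i x, Tendsto (fun n => pd i (χ n) x) atTop (𝓝 0)) := by
  let b : ContDiffBump (0 : E d) := ⟨1, 2, one_pos, one_lt_two⟩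
  have hb : IsTest (b : E d → ℝ) := ⟨b.contDiff, b.hasCompactSupport⟩
  have hbd : ∀ i, ∃ C, ∀ x, ‖pd i (b : E d → ℝ) x‖ ≤ C := fun i =>
    (contDiff_pd i hb.1).continuous.bounded_above_of_compact_support (hb.pd i).2
  choose Cb hCb using hbd
  let c : ℕ → ℝ := fun n => ((n : ℝ) + 1)⁻¹
  have hc0 : ∀ n, 0 < c n := fun n => by positivity
  have hc1 : ∀ n, c n ≤ 1 := fun n => inv_le_one_of_one_le₀ (by simp)
  have hct : Tendsto c atTop (𝓝 0) := by
    simpa [c, one_div] using tendsto_one_div_add_atTop_nhds_zero_nat (𝕜 := ℝ)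
  have hpd : ∀ n i x, pd i (fun x => b (c n • x)) x = c n * pd i b (c n • x) := fun n i x =>
    pd_comp_smul i _ hb.1 x
  have hCb0 : ∀ i, 0 ≤ Cb i := fun i => (norm_nonneg _).trans (hCb i 0)
  refine ⟨fun n x => b (c n • x), 1 + ∑ i, Cb i, fun n => ⟨?_, ?_⟩, ?_, ?_, ?_, ?_⟩
  · exact hb.1.comp (contDiff_const_smul _)
  · exact hb.2.comp_homeomorph (Homeomorph.smulOfNeZero (c n) (hc0 n).ne')
  · intro n x
    rw [Real.norm_of_nonneg b.nonneg]
    exact b.le_one.trans (by linarith [Finset.sum_nonneg fun i (_ : i ∈ Finset.univ) => hCb0 i])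
  · intro n i x
    rw [hpd, norm_mul, Real.norm_of_nonneg (hc0 n).le]
    have h1 := Finset.single_le_sum (f := Cb) (fun i _ => hCb0 i) (Finset.mem_univ i)
    calc c n * ‖pd i b (c n • x)‖ ≤ 1 * Cb i := by
          gcongr
          · exact hc1 n
          · exact hCb i _
      _ ≤ _ := by linarith
  · intro x
    have h1 : Tendsto (fun n => c n • x) atTop (𝓝 0) := by simpa using hct.smul_const x
    have h2 := (hb.1.continuous.tendsto (0 : E d)).comp h1
    rwa [b.one_of_mem_closedBall (by simp [b])] at h2
  · intro i x
    simp only [hpd]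
    refine squeeze_zero_norm (a := fun n => c n * Cb i) (fun n => ?_) (by simpa using hct.mul_const _)
    rw [norm_mul, Real.norm_of_nonneg (hc0 n).le]
    exact mul_le_mul_of_nonneg_left (hCb i _) (hc0 n).le

/-- A first-order identity that holds against test functions also holds against smooth functions
that are square integrable together with their first derivatives. -/
theorem weak_identity_extend (g₀ : L2 d) (g : Fin d → L2 d)
    (h : ∀ φ, IsTest φ → (∫ x, g₀ x * φ x) + ∑ i, ∫ x, g i x * pd i φ x = 0)
    {f : E d → ℝ} (hf : ContDiff ℝ ∞ f) (hf2 : MemLp f 2 (volume : Measure (E d)))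
    (hfd : ∀ i, MemLp (pd i f) 2 (volume : Measure (E d))) :
    (∫ x, g₀ x * f x) + ∑ i, ∫ x, g i x * pd i f x = 0 := by
  obtain ⟨χ, C, hχ, hχb, hχd, hχ1, hχ0⟩ := exists_cutoff d
  have hlim : Tendsto (fun n => (∫ x, g₀ x * (f x * χ n x)) +
      ∑ i, ∫ x, g i x * pd i (fun x => f x * χ n x) x) atTop
      (𝓝 ((∫ x, g₀ x * f x) + ∑ i, ∫ x, g i x * pd i f x)) := by
    refine Tendsto.add ?_ (tendsto_finsetSum _ fun i _ => ?_)
    · refine tendsto_integral_of_dominated_convergence (fun x => ‖g₀ x * f x‖ * C) ?_ ?_ ?_ ?_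
      · exact fun n => (Lp.memLp g₀).1.mul (hf2.1.mul (hχ n).1.continuous.aestronglyMeasurable)
      · exact (integrable_L2_mul (Lp.memLp g₀) hf2).norm.mul_const _
      · refine fun n => Eventually.of_forall fun x => ?_
        rw [← mul_assoc, norm_mul]
        gcongr
        exact hχb n x
      · refine Eventually.of_forall fun x => ?_
        simpa using ((hχ1 x).const_mul (f x)).const_mul (g₀ x)
    · have e : ∀ n x, pd i (fun x => f x * χ n x) x = f x * pd i (χ n) x + pd i f x * χ n x :=
        fun n x => pd_mul i hf (hχ n).1 x
      simp only [e]
      refine tendsto_integral_of_dominated_convergence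
        (fun x => ‖g i x * f x‖ * C + ‖g i x * pd i f x‖ * C) ?_ ?_ ?_ ?_
      · exact fun n => (Lp.memLp (g i)).1.mul
          ((hf2.1.mul ((hχ n).pd i).1.continuous.aestronglyMeasurable).add
          ((hfd i).1.mul (hχ n).1.continuous.aestronglyMeasurable))
      · exact ((integrable_L2_mul (Lp.memLp (g i)) hf2).norm.mul_const _).add
          ((integrable_L2_mul (Lp.memLp (g i)) (hfd i)).norm.mul_const _)
      · refine fun n => Eventually.of_forall fun x => ?_
        rw [mul_add, ← mul_assoc, ← mul_assoc]
        refine (norm_add_le _ _).trans ?_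
        rw [norm_mul (_ * _), norm_mul (_ * _)]
        gcongr
        · exact hχd n i x
        · exact hχb n x
      · refine Eventually.of_forall fun x => ?_
        simpa using (((hχ0 i x).const_mul (f x)).add ((hχ1 x).const_mul (pd i f x))).const_mul
          (g i x)
  refine tendsto_nhds_unique hlim ?_
  have : ∀ n, (∫ x, g₀ x * (f x * χ n x)) +
      ∑ i, ∫ x, g i x * pd i (fun x => f x * χ n x) x = 0 := fun n =>
    h _ ((hχ n).mul_smooth hf)
  simp [this]

/-- The duality `∫ 𝓕ψ G = ∫ ψ 𝓕G` for a first-order expression. -/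
theorem integral_fourier_schwartz (G₀ : L2C d) (G : Fin d → L2C d) (ψ : SchwartzMap (E d) ℂ) :
    (∫ x, (𝓕 ψ) x * G₀ x) + ∑ i, ∫ x, (∂_{EuclideanSpace.single i (1 : ℝ)} (𝓕 ψ)) x * G i x =
      ∫ ξ, ψ ξ * ((𝓕 G₀ : L2C d) ξ - ∑ i, dsym i ξ * (𝓕 (G i) : L2C d) ξ) := by
  have dual : ∀ (F : L2C d) (η : SchwartzMap (E d) ℂ),
      ∫ x, (𝓕 η) x * F x = ∫ ξ, η ξ * (𝓕 F : L2C d) ξ := fun F η => by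
    have key := congrArg (fun T => T η) (Lp.fourier_toTemperedDistribution_eq F)
    simpa only [TemperedDistribution.fourier_apply, Lp.toTemperedDistribution_apply,
      smul_eq_mul] using key
  have int : ∀ (F : L2C d) (η : SchwartzMap (E d) ℂ), Integrable fun x => η x * F x := fun F η =>
    (η.memLp 2 volume).integrable_mul (Lp.memLp F)
  have hη : ∀ i, ∃ η : SchwartzMap (E d) ℂ, (∂_{EuclideanSpace.single i (1 : ℝ)} (𝓕 ψ)) = 𝓕 η ∧
      ∀ ξ, η ξ = -(dsym i ξ * ψ ξ) := fun i => by
    refine ⟨_, SchwartzMap.lineDerivOp_fourier_eq ψ _, fun ξ => ?_⟩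
    have ht : (fun x : E d => inner ℝ x (EuclideanSpace.single i (1 : ℝ))).HasTemperateGrowth := by
      fun_prop
    have hin : inner ℝ ξ (EuclideanSpace.single i (1 : ℝ)) = ξ i := by
      rw [EuclideanSpace.inner_single_right]
      simp
    simp only [_root_.neg_smul, _root_.neg_apply, _root_.smul_apply,
      SchwartzMap.smulLeftCLM_apply_apply ht, hin, dsym, smul_eq_mul, Complex.real_smul]
    ring
  choose η hη1 hη2 using hη
  simp only [hη1]
  rw [dual, Finset.sum_congr rfl fun i _ => dual (G i) (η i), ← integral_finsetSum _
    (fun i _ => int _ _), ← integral_add (int _ _) (integrable_finsetSum _ fun i _ => int _ _)]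
  refine integral_congr_ae (Eventually.of_forall fun ξ => ?_)
  simp only [hη2]
  rw [mul_sub, sub_eq_add_neg, Finset.mul_sum, ← Finset.sum_neg_distrib]
  congr 1
  refine Finset.sum_congr rfl fun i _ => ?_
  ring

/-- Applied to the real and the imaginary part of a complex Schwartz function. -/
theorem schwartz_comp_clm (f : SchwartzMap (E d) ℂ) (L : ℂ →L[ℝ] ℝ) :
    ContDiff ℝ ∞ (fun x => L (f x)) ∧ MemLp (fun x => L (f x)) 2 (volume : Measure (E d)) ∧
      ∀ i x, pd i (fun x => L (f x)) x = L ((∂_{EuclideanSpace.single i (1 : ℝ)} f) x) := by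
  refine ⟨L.contDiff.comp f.smooth', L.comp_memLp' (f.memLp 2 volume), fun i x => ?_⟩
  have h1 : HasFDerivAt f (fderiv ℝ f x) x := f.differentiableAt.hasFDerivAt
  have h2 : HasFDerivAt (fun x => L (f x)) (L ∘L fderiv ℝ f x) x := L.hasFDerivAt.comp x h1
  unfold pd
  rw [h2.fderiv, SchwartzMap.lineDerivOp_apply_eq_fderiv]
  rfl

/-- For square integrable functions, `g₀ = ∑ ∂_i g_i` in the sense of distributions if and only if
the Fourier transforms satisfy the corresponding pointwise identity. -/
theorem weak_identity_iff (g₀ : L2 d) (g : Fin d → L2 d) :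
    (∀ φ, IsTest φ → (∫ x, g₀ x * φ x) + ∑ i, ∫ x, g i x * pd i φ x = 0) ↔
      ∀ᵐ ξ, hat g₀ ξ = ∑ i, dsym i ξ * hat (g i) ξ := by
  have intc : ∀ (F : L2C d) (η : SchwartzMap (E d) ℂ), Integrable fun x => η x * F x := fun F η =>
    (η.memLp 2 volume).integrable_mul (Lp.memLp F)
  constructor
  · intro h
    have hS : ∀ Φ : SchwartzMap (E d) ℂ, (∫ x, Φ x * complexify d g₀ x) +
        ∑ i, ∫ x, (∂_{EuclideanSpace.single i (1 : ℝ)} Φ) x * complexify d (g i) x = 0 := by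
      intro Φ
      have part : ∀ L : ℂ →L[ℝ] ℝ, (∫ x, g₀ x * L (Φ x)) +
          ∑ i, ∫ x, g i x * L ((∂_{EuclideanSpace.single i (1 : ℝ)} Φ) x) = 0 := fun L => by
        obtain ⟨h1, h2, h3⟩ := schwartz_comp_clm Φ L
        have := weak_identity_extend g₀ g h h1 h2 fun i => by
          simpa only [funext (h3 i)] using
            (schwartz_comp_clm (∂_{EuclideanSpace.single i (1 : ℝ)} Φ) L).2.1
        simpa only [h3] using this
      have split : ∀ (f : L2 d) (η : SchwartzMap (E d) ℂ), ∫ x, η x * complexify d f x =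
          ((∫ x, f x * Complex.reCLM (η x) : ℝ) : ℂ) +
            ((∫ x, f x * Complex.imCLM (η x) : ℝ) : ℂ) * Complex.I := fun f η => by
        have i1 := integrable_L2_mul (Lp.memLp f) (schwartz_comp_clm η Complex.reCLM).2.1
        have i2 := integrable_L2_mul (Lp.memLp f) (schwartz_comp_clm η Complex.imCLM).2.1
        rw [← integral_complex_ofReal, ← integral_complex_ofReal, ← integral_mul_const,
          ← integral_add i1.ofReal (i2.ofReal.mul_const _)]
        refine integral_congr_ae ?_
        filter_upwards [complexify_ae f] with x hx
        rw [hx]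
        conv_lhs => rw [← Complex.re_add_im (η x)]
        simp only [Complex.reCLM_apply, Complex.imCLM_apply]
        push_cast
        ring
      have pr := part Complex.reCLM
      have pi := part Complex.imCLM
      simp only [split]
      rw [Finset.sum_add_distrib, ← Finset.sum_mul, add_add_add_comm, ← add_mul]
      have pr' := congrArg (fun t : ℝ => (t : ℂ)) pr
      have pi' := congrArg (fun t : ℝ => (t : ℂ)) pi
      push_cast at pr' pi'
      rw [pr', pi']
      simp
    have hloc : LocallyIntegrable
        (fun ξ => hat g₀ ξ - ∑ i, dsym i ξ * hat (g i) ξ) (volume : Measure (E d)) := by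
      refine LocallyIntegrable.sub ((Lp.memLp _).locallyIntegrable (by norm_num)) ?_
      refine locallyIntegrable_finsetSum _ fun i _ => ?_
      have h1 : LocallyIntegrable (hat (g i)) (volume : Measure (E d)) :=
        (Lp.memLp _).locallyIntegrable (by norm_num)
      refine (locallyIntegrableOn_univ.1 ?_)
      exact (locallyIntegrableOn_univ.2 h1).continuousOn_mul (continuous_dsym i).continuousOn
        isOpen_univ.isLocallyClosed
    have hz := ae_eq_zero_of_integral_contDiff_smul_eq_zero hloc fun φ hφ hc => by
      have hg₁ : HasCompactSupport (Complex.ofRealCLM ∘ φ) := hc.comp_left rfl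
      have hg₂ : ContDiff ℝ ∞ (Complex.ofRealCLM ∘ φ) := by fun_prop
      have key := integral_fourier_schwartz (complexify d g₀) (fun i => complexify d (g i))
        (hg₁.toSchwartzMap hg₂)
      rw [hS] at key
      rw [key]
      refine integral_congr_ae (Eventually.of_forall fun x => ?_)
      simp [hat_apply]
    filter_upwards [hz] with ξ hξ
    exact sub_eq_zero.1 hξ
  · intro h φ hφ
    have hg₁ : HasCompactSupport (Complex.ofRealCLM ∘ φ) := hφ.2.comp_left rfl
    have hφ' := hφ.1
    have hg₂ : ContDiff ℝ ∞ (Complex.ofRealCLM ∘ φ) := by fun_prop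
    have key := integral_fourier_schwartz (complexify d g₀) (fun i => complexify d (g i))
      (𝓕⁻ (hg₁.toSchwartzMap hg₂))
    rw [FourierTransform.fourier_fourierInv_eq] at key
    have hz : ∫ ξ, (𝓕⁻ (hg₁.toSchwartzMap hg₂)) ξ * ((𝓕 (complexify d g₀) : L2C d) ξ -
        ∑ i, dsym i ξ * (𝓕 (complexify d (g i)) : L2C d) ξ) = 0 := by
      rw [← integral_zero (E d) ℂ]
      refine integral_congr_ae ?_
      filter_upwards [h] with ξ hξ
      simp only [hat_apply] at hξ
      rw [hξ, sub_self, mul_zero]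
    rw [hz] at key
    have hre := schwartz_comp_clm (hg₁.toSchwartzMap hg₂) Complex.reCLM
    have hd : ∀ i x, (∂_{EuclideanSpace.single i (1 : ℝ)} (hg₁.toSchwartzMap hg₂)) x
        = (pd i φ x : ℂ) := fun i x => by
      have h1 : HasFDerivAt φ (fderiv ℝ φ x) x := (hφ.1.differentiable (by simp) x).hasFDerivAt
      have h2 : HasFDerivAt (Complex.ofRealCLM ∘ φ) (Complex.ofRealCLM ∘L fderiv ℝ φ x) x :=
        Complex.ofRealCLM.hasFDerivAt.comp x h1
      rw [SchwartzMap.lineDerivOp_apply_eq_fderiv]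
      change fderiv ℝ (Complex.ofRealCLM ∘ φ) x _ = _
      rw [h2.fderiv]
      rfl
    have conv : ∀ (f : L2 d) (η : E d → ℝ), ∫ x, (η x : ℂ) * complexify d f x =
        ((∫ x, f x * η x : ℝ) : ℂ) := fun f η => by
      rw [← integral_complex_ofReal]
      refine integral_congr_ae ?_
      filter_upwards [complexify_ae f] with x hx
      rw [hx]
      push_cast
      ring
    simp only [hd, conv] at key
    have e0 : ∫ x, (hg₁.toSchwartzMap hg₂) x * complexify d g₀ x = ((∫ x, g₀ x * φ x : ℝ) : ℂ) :=
      conv g₀ φ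
    rw [e0] at key
    exact_mod_cast key

/-- The weak gradient is multiplication by `2πiξ` on the Fourier side. -/
theorem hasWeakGradient_iff (u : L2 d) (G : Fin d → L2 d) :
    HasWeakGradient u G ↔ ∀ i, ∀ᵐ ξ, hat (G i) ξ = dsym i ξ * hat u ξ := by
  refine forall_congr' fun i => ?_
  classical
  have h := weak_identity_iff (G i) (fun k => if k = i then u else 0)
  have e1 : ∀ φ : E d → ℝ, ∑ k, ∫ x, (if k = i then u else (0 : L2 d)) x * pd k φ x =
      ∫ x, u x * pd i φ x := fun φ => by
    rw [Finset.sum_eq_single i]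
    · simp
    · intro k _ hk
      rw [if_neg hk, ← integral_zero (E d) ℝ]
      refine integral_congr_ae ?_
      filter_upwards [Lp.coeFn_zero ℝ 2 (volume : Measure (E d))] with x hx
      rw [hx, Pi.zero_apply, zero_mul]
    · simp
  simp only [e1] at h
  have e2 : (∀ᵐ ξ, hat (G i) ξ = ∑ k, dsym k ξ * hat (if k = i then u else (0 : L2 d)) ξ) ↔
      ∀ᵐ ξ, hat (G i) ξ = dsym i ξ * hat u ξ := by
    refine eventually_congr ?_
    filter_upwards [Lp.coeFn_zero ℂ 2 (volume : Measure (E d))] with ξ hξ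
    rw [Finset.sum_eq_single i]
    · simp
    · intro k _ hk
      rw [if_neg hk, map_zero, hξ]
      simp
    · simp
  rw [← e2, ← h]
  refine forall_congr' fun φ => forall_congr' fun _ => ?_
  rw [add_comm, eq_neg_iff_add_eq_zero]

/-- Distributional identities between square integrable functions may be tested against `H¹`. -/
theorem weak_identity_inner (g₀ : L2 d) (g : Fin d → L2 d)
    (h : ∀ φ, IsTest φ → (∫ x, g₀ x * φ x) + ∑ i, ∫ x, g i x * pd i φ x = 0)
    {z : L2 d} {Z : Fin d → L2 d} (hz : HasWeakGradient z Z) :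
    ⟪g₀, z⟫ + ∑ i, ⟪g i, Z i⟫ = 0 := by
  have h1 := (weak_identity_iff g₀ g).1 h
  have h2 := ae_all_iff.2 ((hasWeakGradient_iff z Z).1 hz)
  have key : ((⟪g₀, z⟫ + ∑ i, ⟪g i, Z i⟫ : ℝ) : ℂ) = 0 := by
    push_cast
    rw [inner_eq_integral_hat, Finset.sum_congr rfl fun i _ => inner_eq_integral_hat (g i) (Z i),
      ← integral_finsetSum _ fun i _ => integrable_hat_mul _ _,
      ← integral_add (integrable_hat_mul _ _)
        (integrable_finsetSum _ fun i _ => integrable_hat_mul _ _),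
      ← integral_zero (E d) ℂ]
    refine integral_congr_ae ?_
    filter_upwards [h1, h2] with ξ h3 h4
    simp only [h3, h4, map_sum, map_mul, Finset.sum_mul, ← Finset.sum_add_distrib]
    refine Finset.sum_eq_zero fun i _ => ?_
    have : conj (dsym i ξ) = -dsym i ξ := by
      simp [dsym, Complex.conj_ofReal, Complex.conj_ofNat]
    rw [this]
    ring
  exact_mod_cast key

end WeakIdentity

end Homogenization

/-! ### Periodic functions and the torus -/

namespace Homogenization

open scoped Real ComplexConjugate RealInnerProductSpace ENNReal
open Filter Topology

variable {d : ℕ}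

section Torus

attribute [local instance] instMeasureSpaceUnitAddCircle

local instance isAddHaarMeasure_unitAddCircle :
    Measure.IsAddHaarMeasure (volume : Measure UnitAddCircle) :=
  inferInstanceAs (Measure.IsAddHaarMeasure AddCircle.haarAddCircle)

local instance isProbabilityMeasure_unitAddCircle :
    IsProbabilityMeasure (volume : Measure UnitAddCircle) :=
  inferInstanceAs (IsProbabilityMeasure AddCircle.haarAddCircle)

/-- The projection of `ℝ^d` onto the torus `ℝ^d / ℤ^d`. -/
def toTorus (y : E d) : UnitAddTorus (Fin d) := fun i => (y i : UnitAddCircle)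

/-- The representative in the unit cell of a point of the torus. -/
noncomputable def fromTorus (t : UnitAddTorus (Fin d)) : E d :=
  WithLp.toLp 2 fun i => (AddCircle.equivIco 1 (-(1 / 2) : ℝ) (t i)).1

theorem measurable_toTorus : Measurable (toTorus : E d → UnitAddTorus (Fin d)) :=
  measurable_pi_lambda _ fun i => AddCircle.measurable_mk'.comp (by fun_prop)

theorem measurable_fromTorus : Measurable (fromTorus : UnitAddTorus (Fin d) → E d) := by
  refine (WithLp.measurable_toLp 2 _).comp (measurable_pi_lambda _ fun i => ?_)
  exact measurable_subtype_coe.comp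
    ((AddCircle.measurableEquivIco 1 (-(1 / 2) : ℝ)).measurable.comp (measurable_pi_apply i))

theorem toTorus_fromTorus (t : UnitAddTorus (Fin d)) : toTorus (fromTorus t) = t := by
  funext i
  exact AddCircle.coe_equivIco

theorem fromTorus_mem_cell (t : UnitAddTorus (Fin d)) : fromTorus t ∈ cell d := by
  intro i
  have h := (AddCircle.equivIco 1 (-(1 / 2) : ℝ) (t i)).2
  constructor
  · exact h.1
  · have := h.2
    calc (fromTorus t) i < -(1 / 2) + 1 := this
      _ = 1 / 2 := by norm_num

theorem fromTorus_toTorus {y : E d} (hy : y ∈ cell d) : fromTorus (toTorus y) = y := by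
  ext i
  have h : y i ∈ Set.Ico (-(1 / 2) : ℝ) (-(1 / 2) + 1) := ⟨(hy i).1, by
    have := (hy i).2
    linarith⟩
  change ((AddCircle.equivIco 1 (-(1 / 2) : ℝ)) (y i : UnitAddCircle) : ℝ) = y i
  rw [AddCircle.equivIco_coe_eq h]

theorem exists_eq_fromTorus_add (y : E d) :
    ∃ z : Fin d → ℤ, y = fromTorus (toTorus y) + WithLp.toLp 2 (fun i => (z i : ℝ)) := by
  have h : ∀ i, ∃ n : ℤ, y i = (fromTorus (toTorus y)) i + n := fun i => by
    have h1 : ((fromTorus (toTorus y) i : ℝ) : UnitAddCircle) = (y i : UnitAddCircle) :=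
      congrFun (toTorus_fromTorus (toTorus y)) i
    have h2 : ((y i - fromTorus (toTorus y) i : ℝ) : UnitAddCircle) = 0 := by
      rw [AddCircle.coe_sub, h1, sub_self]
    obtain ⟨n, hn⟩ := (AddCircle.coe_eq_zero_iff 1).1 h2
    refine ⟨n, ?_⟩
    rw [zsmul_one] at hn
    linarith
  choose z hz using h
  exact ⟨z, by ext i; simp [hz i]⟩

/-- Periodic functions factor through the torus. -/
theorem IsPeriodic.apply_fold {α : Type*} {f : E d → α} (hf : IsPeriodic f) (y : E d) :
    f (fromTorus (toTorus y)) = f y := by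
  obtain ⟨z, hz⟩ := exists_eq_fromTorus_add y
  conv_rhs => rw [hz]
  exact (hf z _).symm

theorem toTorus_add (x y : E d) : toTorus (x + y) = toTorus x + toTorus y := by
  funext i
  simp [toTorus]

theorem measurableSet_cell : MeasurableSet (cell d) := by
  have : cell d = ⋂ i, (fun y : E d => y i) ⁻¹' Set.Ico (-(1 / 2) : ℝ) (1 / 2) := by
    ext y
    simp [cell]
  rw [this]
  exact MeasurableSet.iInter fun i => (by fun_prop : Measurable fun y : E d => y i) measurableSet_Ico

/-- The cell is a fundamental domain of the torus. -/
theorem measurePreserving_toTorus :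
    MeasurePreserving (toTorus : E d → UnitAddTorus (Fin d)) (volume.restrict (cell d)) volume := by
  refine ⟨measurable_toTorus, ?_⟩
  ext S hS
  rw [Measure.map_apply measurable_toTorus hS, Measure.restrict_apply (measurable_toTorus hS),
    ← lintegral_indicator_one hS, UnitAddTorus.lintegral_preimage _ fun _ => (-(1 / 2) : ℝ)]
  have hm : Measurable (fun (x : Fin d → ℝ) => (fun i => x i : UnitAddTorus (Fin d))) :=
    measurable_pi_lambda _ fun i => AddCircle.measurable_mk'.comp (measurable_pi_apply i)
  have e1 : (fun x : Fin d → ℝ => S.indicator (1 : UnitAddTorus (Fin d) → ℝ≥0∞)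
      (fun i => (x i : UnitAddCircle))) =
      ((fun (x : Fin d → ℝ) => (fun i => x i : UnitAddTorus (Fin d))) ⁻¹' S).indicator 1 := by
    funext x
    rfl
  rw [e1, lintegral_indicator_one (hm hS), Measure.restrict_apply (hm hS)]
  have e2 : {x : Fin d → ℝ | ∀ i, x i ∈ Set.Ioc (-(1 / 2) : ℝ) (-(1 / 2) + 1)} =ᵐ[volume]
      {x : Fin d → ℝ | ∀ i, x i ∈ Set.Ico (-(1 / 2) : ℝ) (1 / 2)} := by
    have h1 := Measure.univ_pi_Ioc_ae_eq_Icc (μ := fun _ : Fin d => (volume : Measure ℝ))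
      (f := fun _ => (-(1 / 2) : ℝ)) (g := fun _ => (-(1 / 2) + 1 : ℝ))
    have h2 := Measure.univ_pi_Ico_ae_eq_Icc (μ := fun _ : Fin d => (volume : Measure ℝ))
      (f := fun _ => (-(1 / 2) : ℝ)) (g := fun _ => (-(1 / 2) + 1 : ℝ))
    have h3 := h1.trans h2.symm
    have e3 : {x : Fin d → ℝ | ∀ i, x i ∈ Set.Ioc (-(1 / 2) : ℝ) (-(1 / 2) + 1)} =
        Set.univ.pi fun _ => Set.Ioc (-(1 / 2) : ℝ) (-(1 / 2) + 1) := by ext; simp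
    have e4 : {x : Fin d → ℝ | ∀ i, x i ∈ Set.Ico (-(1 / 2) : ℝ) (1 / 2)} =
        Set.univ.pi fun _ => Set.Ico (-(1 / 2) : ℝ) (-(1 / 2) + 1) := by
      norm_num
      ext
      simp
    rw [e3, e4]
    exact h3
  rw [measure_congr ((ae_eq_refl _).inter e2)]
  have hp := PiLp.volume_preserving_ofLp (Fin d)
  have hmc : MeasurableSet {x : Fin d → ℝ | ∀ i, x i ∈ Set.Ico (-(1 / 2) : ℝ) (1 / 2)} := by
    have : {x : Fin d → ℝ | ∀ i, x i ∈ Set.Ico (-(1 / 2) : ℝ) (1 / 2)} =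
      Set.univ.pi fun _ => Set.Ico (-(1 / 2) : ℝ) (1 / 2) := by ext; simp
    rw [this]
    exact MeasurableSet.univ_pi fun _ => measurableSet_Ico
  rw [← hp.measure_preimage ((hm hS).inter hmc).nullMeasurableSet]
  rfl

theorem measurePreserving_fromTorus :
    MeasurePreserving (fromTorus : UnitAddTorus (Fin d) → E d) volume (volume.restrict (cell d)) := by
  refine ⟨measurable_fromTorus, ?_⟩
  rw [← (measurePreserving_toTorus (d := d)).map_eq, Measure.map_map measurable_fromTorus
    measurable_toTorus]
  conv_rhs => rw [← Measure.map_id (μ := volume.restrict (cell d))]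
  refine Measure.map_congr ?_
  filter_upwards [ae_restrict_mem measurableSet_cell] with y hy
  exact fromTorus_toTorus hy

theorem isProbabilityMeasure_cell :
    IsProbabilityMeasure ((volume : Measure (E d)).restrict (cell d)) := by
  rw [← (measurePreserving_fromTorus (d := d)).map_eq]
  exact Measure.isProbabilityMeasure_map measurable_fromTorus.aemeasurable

theorem ae_of_ae_cell {P : E d → Prop} (hP : IsPeriodic P)
    (h : ∀ᵐ y ∂volume.restrict (cell d), P y) : ∀ᵐ y, P y := by
  rw [ae_restrict_iff' measurableSet_cell, ae_iff] at h
  rw [ae_iff]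
  refine measure_mono_null (t := ⋃ z : Fin d → ℤ,
    (fun y => y + WithLp.toLp 2 (fun i => (z i : ℝ))) ⁻¹' {y | ¬(y ∈ cell d → P y)}) ?_ ?_
  · intro y hy
    obtain ⟨z, hz⟩ := exists_eq_fromTorus_add y
    refine Set.mem_iUnion.2 ⟨-z, ?_⟩
    have e' : y + WithLp.toLp 2 (fun i => (((-z) i : ℤ) : ℝ)) = fromTorus (toTorus y) := by
      conv_lhs => rw [hz]
      ext i
      simp
    simp only [Set.mem_preimage, Set.mem_ofPred_eq, e', hP.apply_fold]
    exact fun hc => hy (hc (fromTorus_mem_cell _))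
  · refine measure_iUnion_null fun z => ?_
    rw [measure_preimage_add_right]
    exact h

theorem ae_rescale {P : E d → Prop} {ε : ℝ} (hε : 0 < ε) (h : ∀ᵐ y, P y) :
    ∀ᵐ x : E d, P (ε⁻¹ • x) :=
  (Measure.quasiMeasurePreserving_smul volume (inv_ne_zero hε.ne')).ae h

theorem quasiMeasurePreserving_toTorus :
    Measure.QuasiMeasurePreserving (toTorus : E d → UnitAddTorus (Fin d)) volume volume := by
  refine ⟨measurable_toTorus, Measure.AbsolutelyContinuous.mk fun S hS h0 => ?_⟩
  rw [Measure.map_apply measurable_toTorus hS]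
  have h1 : ∀ᵐ t : UnitAddTorus (Fin d), t ∉ S := measure_eq_zero_iff_ae_notMem.1 h0
  have h2 := measurePreserving_toTorus.quasiMeasurePreserving.ae h1
  have h3 : ∀ᵐ y : E d, toTorus y ∉ S := ae_of_ae_cell (fun z y => by
    have : toTorus (WithLp.toLp 2 (fun i => (z i : ℝ)) : E d) = 0 := by
      funext i
      simp [toTorus]
    rw [toTorus_add, this, add_zero]) h2
  exact measure_eq_zero_iff_ae_notMem.2 h3

theorem aestronglyMeasurable_of_cell {β : Type*} [TopologicalSpace β]
    {f : E d → β} (hf : IsPeriodic f)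
    (h : AEStronglyMeasurable f (volume.restrict (cell d))) :
    AEStronglyMeasurable f volume := by
  have h1 : AEStronglyMeasurable (f ∘ fromTorus) (volume : Measure (UnitAddTorus (Fin d))) :=
    h.comp_measurePreserving measurePreserving_fromTorus
  have h2 := h1.comp_quasiMeasurePreserving quasiMeasurePreserving_toTorus
  rwa [show (f ∘ fromTorus) ∘ toTorus = f from funext fun y => hf.apply_fold y] at h2

theorem lintegral_fromTorus {f : E d → ℝ≥0∞} (hf : AEMeasurable f (volume.restrict (cell d))) :
    ∫⁻ t : UnitAddTorus (Fin d), f (fromTorus t) = ∫⁻ y in cell d, f y := by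
  rw [← (measurePreserving_fromTorus (d := d)).map_eq,
    lintegral_map' (by rwa [measurePreserving_fromTorus.map_eq]) measurable_fromTorus.aemeasurable]

theorem integral_fromTorus {G : Type*} [NormedAddCommGroup G] [NormedSpace ℝ G] {f : E d → G}
    (hf : AEStronglyMeasurable f (volume.restrict (cell d))) :
    ∫ t : UnitAddTorus (Fin d), f (fromTorus t) = ∫ y in cell d, f y := by
  rw [← (measurePreserving_fromTorus (d := d)).map_eq,
    integral_map measurable_fromTorus.aemeasurable (by rwa [measurePreserving_fromTorus.map_eq])]

/-- The integral over the cell of a periodic function is invariant under translations. -/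
theorem lintegral_cell_shift {f : E d → ℝ≥0∞} (hf : IsPeriodic f) (hm : Measurable f) (v : E d) :
    ∫⁻ y in cell d, f (y + v) = ∫⁻ y in cell d, f y := by
  have e : ∀ y, f (y + v) = f (fromTorus (toTorus y + toTorus v)) := fun y => by
    rw [← toTorus_add, hf.apply_fold]
  have h1 : ∫⁻ y in cell d, f (fromTorus (toTorus y + toTorus v)) =
      ∫⁻ t : UnitAddTorus (Fin d), f (fromTorus (t + toTorus v)) := by
    rw [← (measurePreserving_toTorus (d := d)).map_eq]
    exact (lintegral_map (hm.comp (measurable_fromTorus.comp (measurable_add_const _)))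
      measurable_toTorus).symm
  simp only [e]
  rw [h1, lintegral_add_right_eq_self (fun t => f (fromTorus t)), lintegral_fromTorus hm.aemeasurable]

/-- The inner product of `m ∈ ℤ^d` and `y ∈ ℝ^d`. -/
def zdot (m : Fin d → ℤ) (y : E d) : ℝ := ∑ i, (m i : ℝ) * y i

theorem mFourier_eq (m : Fin d → ℤ) (t : UnitAddTorus (Fin d)) :
    UnitAddTorus.mFourier m t = expi (zdot m (fromTorus t)) := by
  conv_lhs => rw [← toTorus_fromTorus t]
  simp only [UnitAddTorus.mFourier, ContinuousMap.coe_mk, toTorus, fourier_coe_apply, expi, zdot]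
  rw [← Complex.exp_sum]
  congr 1
  push_cast
  rw [Finset.mul_sum, Finset.sum_mul]
  refine Finset.sum_congr rfl fun i _ => ?_
  ring

theorem expi_zdot_periodic (m : Fin d → ℤ) : IsPeriodic fun y : E d => expi (zdot m y) := by
  intro z y
  have h : expi (zdot m (WithLp.toLp 2 (fun i => (z i : ℝ)) : E d)) = 1 := by
    unfold expi zdot
    rw [Complex.exp_eq_one_iff]
    refine ⟨∑ i, m i * z i, ?_⟩
    push_cast
    ring
  have : zdot m (y + WithLp.toLp 2 (fun i => (z i : ℝ))) =
      zdot m y + zdot m (WithLp.toLp 2 (fun i => (z i : ℝ)) : E d) := by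
    simp [zdot, mul_add, Finset.sum_add_distrib]
  dsimp only
  rw [this, expi_add, h, mul_one]

/-- The Fourier coefficients of a periodic function. -/
noncomputable def cellCoeff (f : E d → ℝ) (m : Fin d → ℤ) : ℂ :=
  ∫ y in cell d, expi (-zdot m y) * (f y : ℂ)

theorem continuous_zdot (m : Fin d → ℤ) : Continuous (zdot m : E d → ℝ) := by
  unfold zdot
  fun_prop

theorem memLp_fromTorus {f : E d → ℝ} (hf : MemLp f 2 (volume.restrict (cell d))) :
    MemLp (fun t : UnitAddTorus (Fin d) => (f (fromTorus t) : ℂ)) 2 volume :=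
  (hf.comp_measurePreserving measurePreserving_fromTorus).ofReal

theorem mFourierCoeff_fromTorus {f : E d → ℝ} (hf : MemLp f 2 (volume.restrict (cell d)))
    (m : Fin d → ℤ) :
    UnitAddTorus.mFourierCoeff ((memLp_fromTorus hf).toLp _) m = cellCoeff f m := by
  unfold UnitAddTorus.mFourierCoeff cellCoeff
  rw [← integral_fromTorus]
  · refine integral_congr_ae ?_
    filter_upwards [(memLp_fromTorus hf).coeFn_toLp] with t ht
    rw [ht, UnitAddTorus.mFourier_neg, mFourier_eq, conj_expi, smul_eq_mul]
  · exact (continuous_expi_comp (continuous_zdot m).neg).aestronglyMeasurable.mul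
      hf.ofReal.aestronglyMeasurable

/-- Parseval's identity on the cell. -/
theorem hasSum_cellCoeff {f g : E d → ℝ} (hf : MemLp f 2 (volume.restrict (cell d)))
    (hg : MemLp g 2 (volume.restrict (cell d))) :
    HasSum (fun m => conj (cellCoeff f m) * cellCoeff g m)
      ((∫ y in cell d, f y * g y : ℝ) : ℂ) := by
  have h := UnitAddTorus.hasSum_prod_mFourierCoeff ((memLp_fromTorus hf).toLp _)
    ((memLp_fromTorus hg).toLp _)
  have h' : HasSum (fun m => conj (cellCoeff f m) * cellCoeff g m)
      (∫ t, conj ((memLp_fromTorus hf).toLp _ t) * (memLp_fromTorus hg).toLp _ t) := by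
    refine h.congr_fun fun m => ?_
    rw [mFourierCoeff_fromTorus hf m, mFourierCoeff_fromTorus hg m]
  convert! h' using 1
  rw [← integral_fromTorus (f := fun y => f y * g y)
    (hf.aestronglyMeasurable.mul hg.aestronglyMeasurable),
    ← integral_complex_ofReal]
  refine integral_congr_ae ?_
  filter_upwards [(memLp_fromTorus hf).coeFn_toLp, (memLp_fromTorus hg).coeFn_toLp] with t h1 h2
  rw [h1, h2]
  simp

/-- A finite measure on the torus whose nonzero Fourier coefficients vanish is a multiple of the
Haar measure. -/
theorem measure_eq_of_mFourier (ν : Measure (UnitAddTorus (Fin d))) [IsFiniteMeasure ν]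
    (h : ∀ m : Fin d → ℤ, m ≠ 0 → ∫ t, UnitAddTorus.mFourier m t ∂ν = 0) :
    ν = ν Set.univ • volume := by
  have int : ∀ (μ : Measure (UnitAddTorus (Fin d))) [IsFiniteMeasure μ]
      (f : C(UnitAddTorus (Fin d), ℂ)), Integrable f μ := fun μ _ f =>
    (BoundedContinuousFunction.mkOfCompact f).integrable μ
  let L : ∀ (μ : Measure (UnitAddTorus (Fin d))) [IsFiniteMeasure μ],
      C(UnitAddTorus (Fin d), ℂ) →ₗ[ℂ] ℂ := fun μ _ =>
    { toFun := fun f => ∫ t, f t ∂μ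
      map_add' := fun f g => integral_add (int μ f) (int μ g)
      map_smul' := fun c f => integral_const_mul c _ }
  have hL : ∀ (μ : Measure (UnitAddTorus (Fin d))) [IsFiniteMeasure μ], Continuous (L μ) :=
    fun μ _ => AddMonoidHomClass.continuous_of_bound (L μ) (μ.real Set.univ) fun f => by
      rw [mul_comm]
      exact norm_integral_le_of_norm_le_const (Eventually.of_forall fun t => f.norm_coe_le_norm t)
  have hν : IsFiniteMeasure (ν Set.univ • (volume : Measure (UnitAddTorus (Fin d)))) :=
    Measure.smul_finite _ (measure_ne_top _ _)
  have hmon : ∀ m : Fin d → ℤ, m ≠ 0 →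
      ∫ t, UnitAddTorus.mFourier m t ∂(volume : Measure (UnitAddTorus (Fin d))) = 0 := fun m hm => by
    have := orthonormal_iff_ite.1 (UnitAddTorus.orthonormal_mFourier (d := Fin d)) 0 m
    simpa [ContinuousMap.inner_toLp, hm.symm, UnitAddTorus.mFourier_zero] using this
  have hclosed : ∀ f : C(UnitAddTorus (Fin d), ℂ),
      L ν f = L (ν Set.univ • volume) f := by
    have hs : Submodule.span ℂ (Set.range (UnitAddTorus.mFourier (d := Fin d))) ≤
        LinearMap.ker (L ν - L (ν Set.univ • volume)) := by
      rw [Submodule.span_le]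
      rintro _ ⟨m, rfl⟩
      rw [SetLike.mem_coe, LinearMap.mem_ker, LinearMap.sub_apply, sub_eq_zero]
      change ∫ t, UnitAddTorus.mFourier m t ∂ν =
        ∫ t, UnitAddTorus.mFourier m t ∂(ν Set.univ • volume)
      rw [integral_smul_measure]
      by_cases hm : m = 0
      · subst hm
        simp [UnitAddTorus.mFourier_zero, Measure.real]
      · rw [h m hm, hmon m hm, smul_zero]
    have hcl : IsClosed ((LinearMap.ker (L ν - L (ν Set.univ • volume)) :
        Submodule ℂ C(UnitAddTorus (Fin d), ℂ)) : Set C(UnitAddTorus (Fin d), ℂ)) :=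
      isClosed_eq (f := fun f => L ν f - L (ν Set.univ • volume) f) (g := fun _ => 0)
        ((hL ν).sub (hL _)) continuous_const
    have htop := Submodule.topologicalClosure_minimal _ hs hcl
    rw [UnitAddTorus.span_mFourier_closure_eq_top] at htop
    intro f
    exact sub_eq_zero.1 (htop (Submodule.mem_top (x := f)))
  refine ext_of_forall_integral_eq_of_IsFiniteMeasure fun f => ?_
  have := hclosed ⟨fun t => (f t : ℂ), by fun_prop⟩
  have e : ((∫ t, f t ∂ν : ℝ) : ℂ) = ((∫ t, f t ∂(ν Set.univ • volume) : ℝ) : ℂ) := by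
    rw [← integral_complex_ofReal, ← integral_complex_ofReal]
    exact this
  exact_mod_cast e

/-- If the measure `|ψ|² dx` has no Fourier mass at the nonzero frequencies of `ε⁻¹ℤ^d`, then its
periodization with period `ε` is uniform. -/
theorem lintegral_periodic_mul_sq {ε : ℝ} {ψ : E d → ℝ} (hψ : MemLp ψ 2 (volume : Measure (E d)))
    (h : ∀ m : Fin d → ℤ, m ≠ 0 → ∫ x, expi (zdot m (ε⁻¹ • x)) * ((ψ x ^ 2 : ℝ) : ℂ) = 0)
    {b : E d → ℝ≥0∞} (hb : IsPeriodic b) (hbm : Measurable b) :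
    ∫⁻ x, b (ε⁻¹ • x) * ENNReal.ofReal (ψ x ^ 2) =
      (∫⁻ y in cell d, b y) * ENNReal.ofReal (∫ x, ψ x ^ 2) := by
  have hi : Integrable (fun x => ψ x ^ 2) := hψ.integrable_sq
  have hsq : AEMeasurable (fun x => ENNReal.ofReal (ψ x ^ 2)) (volume : Measure (E d)) :=
    hi.1.aemeasurable.ennreal_ofReal
  have hq : Measurable fun x : E d => toTorus (ε⁻¹ • x) :=
    measurable_toTorus.comp (measurable_const_smul _)
  set μ := (volume : Measure (E d)).withDensity fun x => ENNReal.ofReal (ψ x ^ 2) with hμ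
  have hfin : IsFiniteMeasure μ := isFiniteMeasure_withDensity_ofReal hi.2
  have htot : μ Set.univ = ENNReal.ofReal (∫ x, ψ x ^ 2) := by
    rw [hμ, withDensity_apply _ MeasurableSet.univ, Measure.restrict_univ,
      ofReal_integral_eq_lintegral_ofReal hi (Eventually.of_forall fun x => sq_nonneg _)]
  have hfin' : IsFiniteMeasure (μ.map fun x : E d => toTorus (ε⁻¹ • x)) :=
    Measure.isFiniteMeasure_map _ _
  have key := measure_eq_of_mFourier (μ.map fun x : E d => toTorus (ε⁻¹ • x)) fun m hm => by
    rw [integral_map hq.aemeasurable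
      (UnitAddTorus.mFourier m).continuous.aestronglyMeasurable, hμ,
      integral_withDensity_eq_integral_toReal_smul₀ hsq (Eventually.of_forall fun x => by simp),
      ← h m hm]
    refine integral_congr_ae (Eventually.of_forall fun x => ?_)
    dsimp only
    rw [mFourier_eq, (expi_zdot_periodic m).apply_fold (ε⁻¹ • x), ENNReal.toReal_ofReal (sq_nonneg _),
      Complex.real_smul, mul_comm]
  have e1 : ∫⁻ x, b (ε⁻¹ • x) * ENNReal.ofReal (ψ x ^ 2) =
      ∫⁻ t, b (fromTorus t) ∂(μ.map fun x : E d => toTorus (ε⁻¹ • x)) := by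
    have hbt : Measurable fun t : UnitAddTorus (Fin d) => b (fromTorus t) :=
      hbm.comp measurable_fromTorus
    have hbq : Measurable fun x : E d => b (fromTorus (toTorus (ε⁻¹ • x))) := hbt.comp hq
    rw [lintegral_map hbt hq, hμ,
      lintegral_withDensity_eq_lintegral_mul₀ hsq
        hbq.aemeasurable]
    refine lintegral_congr fun x => ?_
    rw [Pi.mul_apply, hb.apply_fold, mul_comm]
  rw [e1, key, lintegral_smul_measure, Measure.map_apply hq MeasurableSet.univ, Set.preimage_univ,
    htot, lintegral_fromTorus hbm.aemeasurable, smul_eq_mul, mul_comm]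

end Torus

end Homogenization

/-! ### Sobolev functions on the torus -/

namespace Homogenization

open scoped Real ComplexConjugate RealInnerProductSpace ENNReal
open Filter Topology

variable {d : ℕ}

attribute [local instance] isProbabilityMeasure_cell

section PeriodicL2

theorem IsPeriodic.comp₂ {α β γ : Type*} {f : E d → α} {g : E d → β} (hf : IsPeriodic f)
    (hg : IsPeriodic g) (F : α → β → γ) : IsPeriodic fun y => F (f y) (g y) := fun z y => by
  dsimp only
  rw [hf z y, hg z y]

theorem IsPeriodic.comp {α β : Type*} {f : E d → α} (hf : IsPeriodic f) (F : α → β) :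
    IsPeriodic fun y => F (f y) := fun z y => by
  dsimp only
  rw [hf z y]

theorem isPeriodic_const {α : Type*} (c : α) : IsPeriodic fun _ : E d => c := fun _ _ => rfl

theorem IsPeriodic.sum {ι : Type*} {s : Finset ι} {f : ι → E d → ℝ}
    (hf : ∀ i ∈ s, IsPeriodic (f i)) : IsPeriodic fun y => ∑ i ∈ s, f i y := fun z y =>
  Finset.sum_congr rfl fun i hi => hf i hi z y

theorem IsL2Per.add {f g : E d → ℝ} (hf : IsL2Per f) (hg : IsL2Per g) :
    IsL2Per fun y => f y + g y :=
  ⟨hf.1.comp₂ hg.1 _, hf.2.add hg.2⟩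

theorem IsL2Per.sub {f g : E d → ℝ} (hf : IsL2Per f) (hg : IsL2Per g) :
    IsL2Per fun y => f y - g y :=
  ⟨hf.1.comp₂ hg.1 _, hf.2.sub hg.2⟩

theorem IsL2Per.const_mul {f : E d → ℝ} (hf : IsL2Per f) (c : ℝ) : IsL2Per fun y => c * f y :=
  ⟨hf.1.comp _, hf.2.const_mul c⟩

theorem isL2Per_const (c : ℝ) : IsL2Per fun _ : E d => c :=
  ⟨isPeriodic_const c, memLp_const c⟩

theorem IsL2Per.sum {ι : Type*} {s : Finset ι} {f : ι → E d → ℝ}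
    (hf : ∀ i ∈ s, IsL2Per (f i)) : IsL2Per fun y => ∑ i ∈ s, f i y :=
  ⟨IsPeriodic.sum fun i hi => (hf i hi).1, memLp_finsetSum s fun i hi => (hf i hi).2⟩

theorem IsL2Per.bdd_mul {c f : E d → ℝ} (hf : IsL2Per f) (hc : IsPeriodic c)
    (hcm : AEStronglyMeasurable c (volume.restrict (cell d))) {C : ℝ}
    (hb : ∀ᵐ y ∂volume.restrict (cell d), ‖c y‖ ≤ C) : IsL2Per fun y => c y * f y := by
  refine ⟨hc.comp₂ hf.1 _, hf.2.of_le_mul (c := C) (hcm.mul hf.2.1) ?_⟩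
  filter_upwards [hb] with y hy
  rw [norm_mul]
  gcongr

theorem IsL2Per.integrable_mul {f g : E d → ℝ} (hf : IsL2Per f) (hg : IsL2Per g) :
    Integrable (fun y => f y * g y) (volume.restrict (cell d)) :=
  hf.2.integrable_mul hg.2

theorem IsL2Per.integrable {f : E d → ℝ} (hf : IsL2Per f) :
    Integrable f (volume.restrict (cell d)) :=
  hf.2.integrable (by norm_num)

theorem cell_subset_closedBall : cell d ⊆ Metric.closedBall (0 : E d) (Real.sqrt d) := by
  intro y hy
  rw [mem_closedBall_zero_iff, EuclideanSpace.norm_eq]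
  refine Real.sqrt_le_sqrt ?_
  calc ∑ i, ‖y i‖ ^ 2 ≤ ∑ _i : Fin d, (1 : ℝ) := by
        refine Finset.sum_le_sum fun i _ => ?_
        have h1 := (hy i).1
        have h2 := (hy i).2
        rw [Real.norm_eq_abs, sq_abs]
        nlinarith
    _ = d := by simp

theorem isL2Per_of_continuous {f : E d → ℝ} (hf : IsPeriodic f) (hc : Continuous f) :
    IsL2Per f := by
  obtain ⟨C, hC⟩ := (isCompact_closedBall (0 : E d) (Real.sqrt d)).exists_bound_of_continuousOn
    hc.continuousOn
  refine ⟨hf, MemLp.of_bound hc.aestronglyMeasurable C ?_⟩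
  filter_upwards [ae_restrict_mem measurableSet_cell] with y hy
  exact hC y (cell_subset_closedBall hy)

theorem isPeriodic_pd {φ : E d → ℝ} (hφ : IsPeriodic φ) (i : Fin d) : IsPeriodic (pd i φ) := by
  intro z y
  unfold pd
  have : (fun x => φ (x + WithLp.toLp 2 (fun i => (z i : ℝ)))) = φ := funext fun x => hφ z x
  rw [← fderiv_comp_add_right, this]

theorem IsPeriodicTest.pd {φ : E d → ℝ} (h : IsPeriodicTest φ) (i : Fin d) :
    IsPeriodicTest (pd i φ) :=
  ⟨contDiff_pd i h.1, isPeriodic_pd h.2 i⟩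

theorem IsPeriodicTest.isL2Per {φ : E d → ℝ} (h : IsPeriodicTest φ) : IsL2Per φ :=
  isL2Per_of_continuous h.2 h.1.continuous

end PeriodicL2

section Trigonometric

theorem contDiff_zdot (m : Fin d → ℤ) : ContDiff ℝ ∞ (zdot m : E d → ℝ) := by
  unfold zdot
  fun_prop

theorem hasFDerivAt_comp_zdot (m : Fin d → ℤ) {F : ℝ → ℝ} {F' : ℝ} {y : E d}
    (h : HasDerivAt F F' (2 * π * zdot m y)) (i : Fin d) :
    pd i (fun y => F (2 * π * zdot m y)) y = 2 * π * m i * F' := by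
  let ℓ : E d →L[ℝ] ℝ := ∑ k, (m k : ℝ) • EuclideanSpace.proj k
  have hℓ : ∀ x, ℓ x = zdot m x := fun x => by
    simp [ℓ, zdot]
  have h1 : HasFDerivAt (fun y : E d => 2 * π * zdot m y) ((2 * π) • ℓ) y := by
    have := (ℓ.hasFDerivAt (x := y)).const_mul (2 * π)
    simpa only [hℓ] using this
  have h2 : HasFDerivAt (fun y => F (2 * π * zdot m y)) (F' • ((2 * π) • ℓ)) y :=
    h.comp_hasFDerivAt y h1
  unfold pd
  rw [h2.fderiv]
  have : ℓ (EuclideanSpace.single i 1) = m i := by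
    rw [hℓ]
    simp [zdot]
  simp only [_root_.smul_apply, this, smul_eq_mul]
  ring

theorem isPeriodicTest_cos (m : Fin d → ℤ) :
    IsPeriodicTest fun y : E d => Real.cos (2 * π * zdot m y) := by
  refine ⟨Real.contDiff_cos.comp (contDiff_const.mul (contDiff_zdot m)), ?_⟩
  have := (expi_zdot_periodic m).comp Complex.re
  simpa only [expi, Complex.exp_ofReal_mul_I_re] using this

theorem isPeriodicTest_sin (m : Fin d → ℤ) :
    IsPeriodicTest fun y : E d => Real.sin (2 * π * zdot m y) := by
  refine ⟨Real.contDiff_sin.comp (contDiff_const.mul (contDiff_zdot m)), ?_⟩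
  have := (expi_zdot_periodic m).comp Complex.im
  simpa only [expi, Complex.exp_ofReal_mul_I_im] using this

theorem pd_cos (m : Fin d → ℤ) (i : Fin d) (y : E d) :
    pd i (fun y => Real.cos (2 * π * zdot m y)) y =
      2 * π * m i * -Real.sin (2 * π * zdot m y) :=
  hasFDerivAt_comp_zdot m (Real.hasDerivAt_cos _) i

theorem pd_sin (m : Fin d → ℤ) (i : Fin d) (y : E d) :
    pd i (fun y => Real.sin (2 * π * zdot m y)) y =
      2 * π * m i * Real.cos (2 * π * zdot m y) :=
  hasFDerivAt_comp_zdot m (Real.hasDerivAt_sin _) i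

theorem cellCoeff_eq {f : E d → ℝ} (hf : IsL2Per f) (m : Fin d → ℤ) :
    cellCoeff f m = ((∫ y in cell d, f y * Real.cos (2 * π * zdot m y) : ℝ) : ℂ) -
      ((∫ y in cell d, f y * Real.sin (2 * π * zdot m y) : ℝ) : ℂ) * Complex.I := by
  have i1 := hf.integrable_mul (isPeriodicTest_cos m).isL2Per
  have i2 := hf.integrable_mul (isPeriodicTest_sin m).isL2Per
  rw [← integral_complex_ofReal, ← integral_complex_ofReal, ← integral_mul_const,
    ← integral_sub i1.ofReal (i2.ofReal.mul_const _), cellCoeff]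
  refine integral_congr_ae (Eventually.of_forall fun y => ?_)
  have : expi (-zdot m y) = Real.cos (2 * π * zdot m y) - Real.sin (2 * π * zdot m y) * Complex.I := by
    unfold expi
    rw [Complex.exp_mul_I]
    push_cast
    rw [mul_neg, Complex.cos_neg, Complex.sin_neg]
    ring
  simp only [this]
  push_cast
  ring

end Trigonometric

section PeriodicGradient

/-- `N` belongs to `H¹_per` and `D` is its gradient. -/
structure HasPeriodicGradient (N : E d → ℝ) (D : Fin d → E d → ℝ) : Prop where
  memL2 : IsL2Per N
  grad_memL2 : ∀ i, IsL2Per (D i)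
  weak : ∀ i φ, IsPeriodicTest φ →
    ∫ y in cell d, N y * pd i φ y = -∫ y in cell d, D i y * φ y

theorem HasPeriodicGradient.cellCoeff {N : E d → ℝ} {D : Fin d → E d → ℝ}
    (h : HasPeriodicGradient N D) (i : Fin d) (m : Fin d → ℤ) :
    cellCoeff (D i) m = 2 * π * m i * Complex.I * cellCoeff N m := by
  rw [cellCoeff_eq (h.grad_memL2 i), cellCoeff_eq h.memL2]
  have hc := h.weak i _ (isPeriodicTest_cos m)
  have hs := h.weak i _ (isPeriodicTest_sin m)
  simp only [pd_cos, pd_sin] at hc hs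
  have e1 : ∀ y, N y * (2 * π * m i * -Real.sin (2 * π * zdot m y)) =
      -(2 * π * m i) * (N y * Real.sin (2 * π * zdot m y)) := fun y => by ring
  have e2 : ∀ y, N y * (2 * π * m i * Real.cos (2 * π * zdot m y)) =
      (2 * π * m i) * (N y * Real.cos (2 * π * zdot m y)) := fun y => by ring
  simp only [e1, e2, integral_const_mul] at hc hs
  have hc' : ∫ y in cell d, D i y * Real.cos (2 * π * zdot m y) =
    2 * π * m i * ∫ y in cell d, N y * Real.sin (2 * π * zdot m y) := by linarith
  have hs' : ∫ y in cell d, D i y * Real.sin (2 * π * zdot m y) =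
    -(2 * π * m i * ∫ y in cell d, N y * Real.cos (2 * π * zdot m y)) := by linarith
  rw [hc', hs']
  push_cast
  linear_combination (2 * π * m i * (∫ y in cell d, N y * Real.sin (2 * π * zdot m y) : ℝ) : ℂ) *
    Complex.I_sq

theorem cellCoeff_zero_index {f : E d → ℝ} : cellCoeff f 0 = ((∫ y in cell d, f y : ℝ) : ℂ) := by
  rw [cellCoeff, ← integral_complex_ofReal]
  refine integral_congr_ae (Eventually.of_forall fun y => ?_)
  simp [zdot, expi]

/-- Integration by parts on the torus. -/
theorem HasPeriodicGradient.integral_mul {N P : E d → ℝ} {D Q : Fin d → E d → ℝ}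
    (h : HasPeriodicGradient N D) (h' : HasPeriodicGradient P Q) (i : Fin d) :
    (∫ y in cell d, N y * Q i y) + ∫ y in cell d, D i y * P y = 0 := by
  have h1 := hasSum_cellCoeff h.memL2.2 (h'.grad_memL2 i).2
  have h2 := hasSum_cellCoeff (h.grad_memL2 i).2 h'.memL2.2
  have h3 := h1.add h2
  have h4 : (fun m => conj (Homogenization.cellCoeff N m) * Homogenization.cellCoeff (Q i) m +
      conj (Homogenization.cellCoeff (D i) m) * Homogenization.cellCoeff P m) = fun _ => 0 := by
    funext m
    rw [h.cellCoeff, h'.cellCoeff]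
    simp only [map_mul, Complex.conj_ofNat, Complex.conj_ofReal, Complex.conj_I, map_intCast]
    ring
  rw [h4] at h3
  have := h3.unique hasSum_zero
  exact_mod_cast this

/-- A divergence free periodic field is orthogonal to all gradients of `H¹_per` functions. -/
theorem HasPeriodicGradient.integral_divFree {P : E d → ℝ} {F Q : Fin d → E d → ℝ}
    (h : HasPeriodicGradient P Q) (hF : ∀ i, IsL2Per (F i))
    (hdiv : ∀ φ, IsPeriodicTest φ → ∫ y in cell d, ∑ i, F i y * pd i φ y = 0) :
    ∑ i, ∫ y in cell d, F i y * Q i y = 0 := by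
  have hco : ∀ m : Fin d → ℤ, ∑ i, (m i : ℂ) * Homogenization.cellCoeff (F i) m = 0 := fun m => by
    have hc := hdiv _ (isPeriodicTest_cos m)
    have hs := hdiv _ (isPeriodicTest_sin m)
    rw [integral_finsetSum _ fun i _ =>
      (hF i).integrable_mul ((isPeriodicTest_cos m).pd i).isL2Per] at hc
    rw [integral_finsetSum _ fun i _ =>
      (hF i).integrable_mul ((isPeriodicTest_sin m).pd i).isL2Per] at hs
    simp only [pd_cos, pd_sin] at hc hs
    have e1 : ∀ i y, F i y * (2 * π * m i * -Real.sin (2 * π * zdot m y)) =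
        -(2 * π) * (m i * (F i y * Real.sin (2 * π * zdot m y))) := fun i y => by ring
    have e2 : ∀ i y, F i y * (2 * π * m i * Real.cos (2 * π * zdot m y)) =
        (2 * π) * (m i * (F i y * Real.cos (2 * π * zdot m y))) := fun i y => by ring
    simp only [e1, e2, integral_const_mul, ← Finset.mul_sum] at hc hs
    have hc' := (mul_eq_zero.1 hc).resolve_left (by simp [Real.pi_ne_zero])
    have hs' := (mul_eq_zero.1 hs).resolve_left (by simp [Real.pi_ne_zero])
    simp only [cellCoeff_eq (hF _), mul_sub, Finset.sum_sub_distrib, ← mul_assoc]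
    rw [← Finset.sum_mul]
    have hc'' := congrArg (fun t : ℝ => (t : ℂ)) hc'
    have hs'' := congrArg (fun t : ℝ => (t : ℂ)) hs'
    push_cast at hc'' hs''
    rw [hc'', hs'']
    simp
  have h1 := hasSum_sum (f := fun i m => conj (Homogenization.cellCoeff (F i) m) *
    Homogenization.cellCoeff (Q i) m) (s := Finset.univ) fun i _ =>
    hasSum_cellCoeff (hF i).2 (h.grad_memL2 i).2
  have h2 : (fun m : Fin d → ℤ => ∑ i, conj (Homogenization.cellCoeff (F i) m) *
    Homogenization.cellCoeff (Q i) m) = fun _ => 0 := by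
    funext m
    have h3 : ∑ i, conj (Homogenization.cellCoeff (F i) m) * Homogenization.cellCoeff (Q i) m =
        (2 * π * Complex.I * Homogenization.cellCoeff P m) *
          conj (∑ i, (m i : ℂ) * Homogenization.cellCoeff (F i) m) := by
      rw [map_sum, Finset.mul_sum]
      refine Finset.sum_congr rfl fun i _ => ?_
      rw [h.cellCoeff, map_mul, map_intCast]
      ring
    rw [h3, hco, map_zero, mul_zero]
  rw [h2] at h1
  have := h1.unique hasSum_zero
  exact_mod_cast this

theorem hasSum_cellCoeff_sq {f : E d → ℝ} (hf : IsL2Per f) :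
    HasSum (fun m => ‖cellCoeff f m‖ ^ 2) (∫ y in cell d, f y ^ 2) := by
  have h := Complex.hasSum_re (hasSum_cellCoeff hf.2 hf.2)
  simp only [Complex.ofReal_re, ← pow_two] at h
  refine h.congr_fun fun m => ?_
  rw [mul_comm, Complex.mul_conj, Complex.normSq_eq_norm_sq, Complex.ofReal_re]

/-- The Poincaré inequality on the torus. -/
theorem HasPeriodicGradient.poincare {N : E d → ℝ} {D : Fin d → E d → ℝ}
    (h : HasPeriodicGradient N D) (h0 : ∫ y in cell d, N y = 0) :
    ∫ y in cell d, N y ^ 2 ≤ ∑ i, ∫ y in cell d, D i y ^ 2 := by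
  refine hasSum_le (fun m => ?_) (hasSum_cellCoeff_sq h.memL2)
    (hasSum_sum (f := fun i m => ‖Homogenization.cellCoeff (D i) m‖ ^ 2) (s := Finset.univ)
      fun i _ => hasSum_cellCoeff_sq (h.grad_memL2 i))
  by_cases hm : m = 0
  · subst hm
    rw [cellCoeff_zero_index, h0]
    simp only [Complex.ofReal_zero, norm_zero, ne_eq, OfNat.ofNat_ne_zero, not_false_eq_true, zero_pow]
    exact Finset.sum_nonneg fun i _ => sq_nonneg _
  · obtain ⟨i, hi⟩ := Function.ne_iff.1 hm
    refine le_trans ?_ (Finset.single_le_sum (f := fun i => ‖Homogenization.cellCoeff (D i) m‖ ^ 2)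
      (fun i _ => sq_nonneg _) (Finset.mem_univ i))
    have h1 : (1 : ℝ) ≤ |(m i : ℝ)| := by
      have : 1 ≤ |m i| := Int.one_le_abs hi
      exact_mod_cast this
    have h2 : ‖Homogenization.cellCoeff (D i) m‖ =
        2 * π * |(m i : ℝ)| * ‖Homogenization.cellCoeff N m‖ := by
      rw [h.cellCoeff]
      simp [abs_of_pos Real.pi_pos]
    rw [h2]
    gcongr
    have := Real.pi_gt_three
    refine le_mul_of_one_le_left (norm_nonneg _) ?_
    nlinarith

theorem exists_bound_of_periodic {G : Type*} [NormedAddCommGroup G] {f : E d → G}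
    (hf : IsPeriodic f) (hc : Continuous f) : ∃ C, ∀ y, ‖f y‖ ≤ C := by
  obtain ⟨C, hC⟩ := (isCompact_closedBall (0 : E d) (Real.sqrt d)).exists_bound_of_continuousOn
    hc.continuousOn
  refine ⟨C, fun y => ?_⟩
  rw [← hf.apply_fold y]
  exact hC _ (cell_subset_closedBall (fromTorus_mem_cell _))

theorem integral_cell_shift {f : E d → ℝ} (hf : IsPeriodic f) (hc : Continuous f) (v : E d) :
    ∫ y in cell d, f (y + v) = ∫ y in cell d, f y := by
  obtain ⟨C, hC⟩ := exists_bound_of_periodic hf hc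
  have hi : ∀ g : E d → ℝ, Continuous g → (∀ y, ‖g y‖ ≤ C) →
      Integrable g (volume.restrict (cell d)) := fun g hg hb =>
    Integrable.of_bound hg.aestronglyMeasurable C (Eventually.of_forall hb)
  have h := lintegral_cell_shift (f := fun y => ENNReal.ofReal (f y + C))
    (hf.comp fun t => ENNReal.ofReal (t + C))
    (by fun_prop) v
  have hpos : ∀ y, 0 ≤ f y + C := fun y => by
    have := neg_abs_le (f y)
    have := hC y
    rw [Real.norm_eq_abs] at this
    linarith
  have i1 : Integrable (fun y => f (y + v) + C) (volume.restrict (cell d)) :=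
    (hi (fun y => f (y + v)) (by fun_prop) fun y => hC _).add (integrable_const _)
  have i2 : Integrable (fun y => f y + C) (volume.restrict (cell d)) :=
    (hi f hc hC).add (integrable_const _)
  rw [← ofReal_integral_eq_lintegral_ofReal i1 (Eventually.of_forall fun y => hpos _),
    ← ofReal_integral_eq_lintegral_ofReal i2 (Eventually.of_forall fun y => hpos _),
    ENNReal.ofReal_eq_ofReal_iff (integral_nonneg fun y => hpos _)
      (integral_nonneg fun y => hpos _),
    integral_add (hi (fun y => f (y + v)) (by fun_prop) fun y => hC _) (integrable_const _),
    integral_add (hi f hc hC) (integrable_const _)] at h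
  linarith

/-- `t ↦ ∫_□ f(y + te_i) dy` is constant by periodicity, and its derivative at `0` is the integral
of `∂_i f`. -/
theorem integral_cell_pd {f : E d → ℝ} (hf : IsPeriodicTest f) (i : Fin d) :
    ∫ y in cell d, pd i f y = 0 := by
  obtain ⟨C, hC⟩ := exists_bound_of_periodic (hf.pd i).2 (hf.pd i).1.continuous
  have hcf : Continuous f := hf.1.continuous
  have hd : ∀ (y : E d) (t : ℝ), HasDerivAt (fun t : ℝ => f (y + t • EuclideanSpace.single i 1))
      (pd i f (y + t • EuclideanSpace.single i 1)) t := fun y t => by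
    have h1 : HasFDerivAt f (fderiv ℝ f (y + t • EuclideanSpace.single i 1)) _ :=
      (hf.1.differentiable (by simp) _).hasFDerivAt
    have h2 : HasDerivAt (fun t : ℝ => y + t • (EuclideanSpace.single i 1 : E d))
        (EuclideanSpace.single i 1) t := by
      simpa using ((hasDerivAt_id t).smul_const (EuclideanSpace.single i 1 : E d)).const_add y
    exact h1.comp_hasDerivAt t h2
  have key := (hasDerivAt_integral_of_dominated_loc_of_deriv_le
    (μ := (volume : Measure (E d)).restrict (cell d)) (s := Set.univ) (x₀ := (0 : ℝ))
    (F := fun t y => f (y + t • EuclideanSpace.single i 1))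
    (F' := fun t y => pd i f (y + t • EuclideanSpace.single i 1)) (bound := fun _ => C)
    Filter.univ_mem (Eventually.of_forall fun t => by
      have : Continuous fun y : E d => f (y + t • EuclideanSpace.single i 1) := by fun_prop
      exact this.aestronglyMeasurable)
    (by simpa using hf.isL2Per.integrable)
    (by
      have := (hf.pd i).1.continuous
      have : Continuous fun y : E d => pd i f (y + (0 : ℝ) • EuclideanSpace.single i 1) := by fun_prop
      exact this.aestronglyMeasurable)
    (Eventually.of_forall fun y t _ => hC _) (integrable_const _)
    (Eventually.of_forall fun y t _ => hd y t)).2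
  simp only [integral_cell_shift hf.2 hcf, zero_smul, add_zero] at key
  exact key.unique (hasDerivAt_const _ _)

theorem IsPeriodicTest.hasPeriodicGradient {φ : E d → ℝ} (h : IsPeriodicTest φ) :
    HasPeriodicGradient φ (fun i => Homogenization.pd i φ) := by
  refine ⟨h.isL2Per, fun i => (h.pd i).isL2Per, fun i ψ hψ => ?_⟩
  have h1 : IsPeriodicTest fun y => φ y * ψ y := ⟨h.1.mul hψ.1, h.2.comp₂ hψ.2 _⟩
  have h2 := integral_cell_pd h1 i
  simp only [pd_mul i h.1 hψ.1] at h2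
  rw [integral_add (h.isL2Per.integrable_mul (hψ.pd i).isL2Per)
    ((h.pd i).isL2Per.integrable_mul hψ.isL2Per)] at h2
  linarith

theorem IsCellSolution.hasPeriodicGradient {a : MatrixField d} {N : Fin d → E d → ℝ}
    {DN : Fin d → Fin d → E d → ℝ} (h : IsCellSolution a N DN) (j : Fin d) :
    HasPeriodicGradient (N j) (DN j) :=
  ⟨h.memL2 j, h.grad_memL2 j, h.weakDeriv j⟩

end PeriodicGradient

end Homogenization

/-! ### Band-limited functions and oscillating factors -/

namespace Homogenization

open scoped Real ComplexConjugate RealInnerProductSpace ENNReal FourierTransform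
open Filter Topology

variable {d : ℕ}

attribute [local instance] isProbabilityMeasure_cell

section LowPass

open Classical in
/-- The indicator function of the dual cell `|ξ_i| < 1/(2ε)`. -/
noncomputable def lowPassSymbol (ε : ℝ) (ξ : E d) : ℂ := if ∀ i, |ξ i| < 1 / (2 * ε) then 1 else 0

theorem exists_lowPass (ε : ℝ) : ∃ T : L2 d →L[ℝ] L2 d, IsMultiplier (lowPassSymbol ε) T := by
  refine exists_multiplier _ ?_ (C := 1) (fun ξ => ?_) fun ξ => ?_
  · unfold lowPassSymbol
    refine Measurable.ite ?_ measurable_const measurable_const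
    have : {ξ : E d | ∀ i, |ξ i| < 1 / (2 * ε)} = ⋂ i, {ξ : E d | |ξ i| < 1 / (2 * ε)} := by
      ext ξ
      simp
    rw [this]
    exact MeasurableSet.iInter fun i => measurableSet_lt (by fun_prop) measurable_const
  · unfold lowPassSymbol
    split_ifs <;> simp
  · unfold lowPassSymbol
    simp only [PiLp.neg_apply, abs_neg]
    split_ifs <;> simp

/-- The sharp Fourier cutoff to the dual cell `|ξ_i| < 1/(2ε)`. -/
noncomputable def lowPass (ε : ℝ) : L2 d →L[ℝ] L2 d := (exists_lowPass ε).choose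

theorem isMultiplier_lowPass (ε : ℝ) : IsMultiplier (lowPassSymbol ε : E d → ℂ) (lowPass ε) :=
  (exists_lowPass ε).choose_spec

theorem norm_lowPassSymbol_le (ε : ℝ) (ξ : E d) : ‖lowPassSymbol ε ξ‖ ≤ 1 := by
  unfold lowPassSymbol
  split_ifs <;> simp

theorem conj_lowPassSymbol (ε : ℝ) (ξ : E d) : conj (lowPassSymbol ε ξ) = lowPassSymbol ε ξ := by
  unfold lowPassSymbol
  split_ifs <;> simp

theorem lowPassSymbol_mul_self (ε : ℝ) (ξ : E d) :
    lowPassSymbol ε ξ * lowPassSymbol ε ξ = lowPassSymbol ε ξ := by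
  unfold lowPassSymbol
  split_ifs <;> simp

theorem norm_lowPass_le (ε : ℝ) (f : L2 d) : ‖lowPass ε f‖ ≤ ‖f‖ := by
  simpa using (isMultiplier_lowPass ε).norm_apply_le (norm_lowPassSymbol_le ε) f

theorem inner_lowPass (ε : ℝ) (f g : L2 d) : ⟪lowPass ε f, g⟫ = ⟪f, lowPass ε g⟫ :=
  (isMultiplier_lowPass ε).adjoint
    ((isMultiplier_lowPass ε).congr fun ξ => (conj_lowPassSymbol ε ξ).symm) f g

theorem lowPass_lowPass (ε : ℝ) (f : L2 d) : lowPass ε (lowPass ε f) = lowPass ε f :=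
  congrArg (fun T : L2 d →L[ℝ] L2 d => T f)
    ((((isMultiplier_lowPass ε).comp (isMultiplier_lowPass ε)).congr
      (lowPassSymbol_mul_self ε)).unique (isMultiplier_lowPass ε))

theorem IsMultiplier.comm {m n : E d → ℂ} {T S : L2 d →L[ℝ] L2 d} (hT : IsMultiplier m T)
    (hS : IsMultiplier n S) (f : L2 d) : T (S f) = S (T f) :=
  congrArg (fun T : L2 d →L[ℝ] L2 d => T f)
    (((hT.comp hS).congr fun _ => mul_comm _ _).unique (hS.comp hT))

theorem HasWeakGradient.lowPass {u : L2 d} {G : Fin d → L2 d} (h : HasWeakGradient u G) (ε : ℝ) :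
    HasWeakGradient (lowPass ε u) fun i => lowPass ε (G i) := by
  rw [hasWeakGradient_iff] at h ⊢
  intro i
  filter_upwards [h i, isMultiplier_lowPass ε u, isMultiplier_lowPass ε (G i)] with ξ h1 h2 h3
  rw [h3, h2, h1]
  ring

theorem exists_le_of_lowPassSymbol {ε : ℝ} {ξ : E d} (h : lowPassSymbol ε ξ ≠ 1) :
    ∃ i, 1 / (2 * ε) ≤ |ξ i| := by
  by_contra! hc
  exact h (by unfold lowPassSymbol; exact if_pos hc)

theorem norm_dsym (i : Fin d) (ξ : E d) : ‖dsym i ξ‖ = 2 * π * |ξ i| := by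
  simp [dsym, abs_of_pos Real.pi_pos]

/-- Outside of the dual cell the frequency is of order `ε⁻¹`. -/
theorem norm_one_sub_lowPassSymbol_le {ε : ℝ} (hε : 0 < ε) (ξ : E d) :
    ‖1 - lowPassSymbol ε ξ‖ ^ 2 ≤ ε ^ 2 * ∑ i, ‖dsym i ξ‖ ^ 2 := by
  by_cases h : lowPassSymbol ε ξ = 1
  · rw [h, sub_self, norm_zero, zero_pow two_ne_zero]
    exact mul_nonneg (sq_nonneg _) (Finset.sum_nonneg fun i _ => sq_nonneg _)
  · obtain ⟨i, hi⟩ := exists_le_of_lowPassSymbol h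
    have h0 : lowPassSymbol ε ξ = 0 := by
      unfold lowPassSymbol at h ⊢
      exact if_neg fun h1 => h (if_pos h1)
    rw [h0, sub_zero, norm_one]
    have h1 : (1 : ℝ) ≤ ε * ‖dsym i ξ‖ := by
      rw [norm_dsym]
      have h2 : ε * (2 * π * (1 / (2 * ε))) ≤ ε * (2 * π * |ξ i|) := by gcongr
      have h3 : ε * (2 * π * (1 / (2 * ε))) = π := by field_simp
      linarith [Real.pi_gt_three]
    calc (1 : ℝ) ^ 2 ≤ (ε * ‖dsym i ξ‖) ^ 2 := by gcongr
      _ = ε ^ 2 * ‖dsym i ξ‖ ^ 2 := by ring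
      _ ≤ _ := by
        gcongr
        exact Finset.single_le_sum (f := fun i => ‖dsym i ξ‖ ^ 2) (fun i _ => sq_nonneg _)
          (Finset.mem_univ i)

theorem norm_sq_eq_integral_hat (f : L2 d) : ‖f‖ ^ 2 = ∫ ξ, ‖hat f ξ‖ ^ 2 := by
  have h := inner_eq_integral_hat f f
  rw [real_inner_self_eq_norm_sq] at h
  have h2 : ∀ ξ, conj (hat f ξ) * hat f ξ = ((‖hat f ξ‖ ^ 2 : ℝ) : ℂ) := fun ξ => by
    rw [mul_comm, Complex.mul_conj, Complex.normSq_eq_norm_sq]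
  simp only [h2] at h
  rw [integral_complex_ofReal] at h
  exact_mod_cast h

theorem integrable_norm_hat_sq (f : L2 d) : Integrable fun ξ => ‖hat f ξ‖ ^ 2 :=
  (Lp.memLp (hat f)).integrable_norm_pow (by norm_num)

/-- The high frequencies of an `H¹` function are of order `ε` in `L²`. -/
theorem norm_sub_lowPass_sq_le {ε : ℝ} (hε : 0 < ε) {z : L2 d} {Z : Fin d → L2 d}
    (hz : HasWeakGradient z Z) : ‖z - lowPass ε z‖ ^ 2 ≤ ε ^ 2 * ∑ i, ‖Z i‖ ^ 2 := by
  simp only [norm_sq_eq_integral_hat]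
  rw [← integral_finsetSum _ fun i _ => integrable_norm_hat_sq _, ← integral_const_mul]
  refine integral_mono_ae (integrable_norm_hat_sq _)
    ((integrable_finsetSum _ fun i _ => integrable_norm_hat_sq _).const_mul _) ?_
  filter_upwards [ae_all_iff.2 ((hasWeakGradient_iff z Z).1 hz), hat_sub_ae z (lowPass ε z),
    isMultiplier_lowPass ε z] with ξ h1 h2 h3
  have e : hat z ξ - lowPassSymbol ε ξ * hat z ξ = (1 - lowPassSymbol ε ξ) * hat z ξ := by ring
  simp only [h1, h2, h3, e, norm_mul, mul_pow]
  rw [← Finset.sum_mul, ← mul_assoc]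
  gcongr
  exact norm_one_sub_lowPassSymbol_le hε ξ

/-- The Fourier transform of `ψ` is carried by the dual cell. -/
def BandLimited (ε : ℝ) (ψ : L2 d) : Prop := lowPass ε ψ = ψ

theorem bandLimited_lowPass (ε : ℝ) (f : L2 d) : BandLimited ε (lowPass ε f) := lowPass_lowPass ε f

theorem BandLimited.hat_eq {ε : ℝ} {ψ : L2 d} (h : BandLimited ε ψ) :
    ∀ᵐ ξ, hat ψ ξ = lowPassSymbol ε ξ * hat ψ ξ := by
  have := isMultiplier_lowPass ε ψ
  rwa [show lowPass ε ψ = ψ from h] at this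

/-- The square of a band-limited function has no frequencies in `ε⁻¹ℤ^d \ {0}`. -/
theorem BandLimited.integral_expi {ε : ℝ} (hε : 0 < ε) {ψ : L2 d} (h : BandLimited ε ψ)
    (m : Fin d → ℤ) (hm : m ≠ 0) :
    ∫ x, expi (zdot m (ε⁻¹ • x)) * ((ψ x ^ 2 : ℝ) : ℂ) = 0 := by
  let v : E d := ε⁻¹ • WithLp.toLp 2 fun i => (m i : ℝ)
  have hv : ∀ x : E d, zdot m (ε⁻¹ • x) = ⟪x, v⟫ := fun x => by
    simp only [v, zdot, PiLp.inner_apply, PiLp.smul_apply, smul_eq_mul]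
    refine Finset.sum_congr rfl fun i _ => ?_
    simp
    ring
  have hc : Continuous fun x : E d => expi ⟪x, v⟫ := continuous_expi_comp (by fun_prop)
  obtain ⟨T, hT, -⟩ := exists_mulCLM (μ := (volume : Measure (E d))) (fun x => expi ⟪x, v⟫)
    hc.aestronglyMeasurable zero_le_one (Eventually.of_forall fun x => by simp)
  have e1 : ∫ x, expi (zdot m (ε⁻¹ • x)) * ((ψ x ^ 2 : ℝ) : ℂ) =
      inner ℂ (complexify d ψ) (T (complexify d ψ)) := by
    rw [L2.inner_def]
    refine integral_congr_ae ?_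
    filter_upwards [complexify_ae ψ, hT (complexify d ψ)] with x h1 h2
    rw [RCLike.inner_apply', h2, h1, hv]
    simp
    ring
  rw [e1, ← Lp.inner_fourier_eq, L2.inner_def, ← integral_zero (E d) ℂ]
  refine integral_congr_ae ?_
  have hbl := h.hat_eq
  filter_upwards [fourier_modulation v (complexify d ψ) (T (complexify d ψ)) (hT _), hbl,
    (measurePreserving_sub_right volume v).quasiMeasurePreserving.ae hbl] with ξ h1 h2 h3
  rw [RCLike.inner_apply', h1]
  rw [← hat_apply, h2, h3]
  -- The dual cell has side `ε⁻¹`, hence is disjoint from its translate by `v = ε⁻¹m`.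
  have : lowPassSymbol ε ξ = 0 ∨ lowPassSymbol ε (ξ - v) = 0 := by
    unfold lowPassSymbol
    by_contra! hcon
    have a1 : ∀ i, |ξ i| < 1 / (2 * ε) := by
      by_contra hcc
      exact hcon.1 (if_neg hcc)
    have a2 : ∀ i, |(ξ - v) i| < 1 / (2 * ε) := by
      by_contra hcc
      exact hcon.2 (if_neg hcc)
    obtain ⟨i, hi⟩ := Function.ne_iff.1 hm
    have b1 := a1 i
    have b2 := a2 i
    have b3 : v i = ε⁻¹ * m i := by simp [v]
    rw [PiLp.sub_apply, b3] at b2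
    have b4 : |ε⁻¹ * (m i : ℝ)| < ε⁻¹ := by
      have : ε⁻¹ * (m i : ℝ) = ξ i - (ξ i - ε⁻¹ * m i) := by ring
      rw [this]
      calc _ ≤ |ξ i| + |ξ i - ε⁻¹ * m i| := abs_sub _ _
        _ < 1 / (2 * ε) + 1 / (2 * ε) := add_lt_add b1 b2
        _ = ε⁻¹ := by field_simp; norm_num
    rw [abs_mul, abs_of_pos (inv_pos.2 hε)] at b4
    have b5 : |(m i : ℝ)| < 1 := by
      have := inv_pos.2 hε
      by_contra! hge
      nlinarith
    have b6 : |m i| < 1 := by exact_mod_cast b5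
    exact hi (by simpa using Int.abs_lt_one_iff.1 b6)
  rcases this with h0 | h0 <;> simp [h0]

end LowPass

section Oscillating

/-- The periodic function which agrees with `f` on the cell. -/
noncomputable def periodicExt (f : E d → ℝ) (y : E d) : ℝ := f (fromTorus (toTorus y))

theorem isPeriodic_periodicExt (f : E d → ℝ) : IsPeriodic (periodicExt f) := fun z y => by
  have : toTorus (WithLp.toLp 2 (fun i => (z i : ℝ)) : E d) = 0 := by
    funext i
    simp [toTorus]
  unfold periodicExt
  rw [toTorus_add, this, add_zero]

theorem periodicExt_ae (f : E d → ℝ) : periodicExt f =ᵐ[volume.restrict (cell d)] f := by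
  filter_upwards [ae_restrict_mem measurableSet_cell] with y hy
  rw [periodicExt, fromTorus_toTorus hy]

theorem isL2Per_periodicExt {f : E d → ℝ} (h : MemLp f 2 (volume.restrict (cell d))) :
    IsL2Per (periodicExt f) :=
  ⟨isPeriodic_periodicExt f, (memLp_congr_ae (periodicExt_ae f)).2 h⟩

/-- A periodic function has a Borel measurable representative which is again periodic. -/
theorem exists_measurable_periodic {b : E d → ℝ} (hb : IsPeriodic b)
    (hm : AEStronglyMeasurable b (volume.restrict (cell d))) :
    ∃ b' : E d → ℝ, IsPeriodic b' ∧ Measurable b' ∧ b =ᵐ[volume] b' ∧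
      b =ᵐ[volume.restrict (cell d)] b' := by
  have h1 := isPeriodic_periodicExt (hm.mk b)
  have h2 : b =ᵐ[volume.restrict (cell d)] periodicExt (hm.mk b) :=
    hm.ae_eq_mk.trans (periodicExt_ae _).symm
  exact ⟨_, h1, hm.stronglyMeasurable_mk.measurable.comp
    (measurable_fromTorus.comp measurable_toTorus),
    ae_of_ae_cell (P := fun y => b y = periodicExt (hm.mk b) y) (hb.comp₂ h1 _) h2, h2⟩

/-- The identity `‖b(·/ε)ψ‖ = ‖b‖ ‖ψ‖` for band-limited `ψ`. The lower Lebesgue integral is used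
because square integrability of the product is a consequence. -/
theorem BandLimited.lintegral {ε : ℝ} (hε : 0 < ε) {ψ : L2 d} (h : BandLimited ε ψ) {b : E d → ℝ}
    (hb : IsL2Per b) :
    ∫⁻ x, ENNReal.ofReal ((b (ε⁻¹ • x) * ψ x) ^ 2) =
      ENNReal.ofReal (∫ y in cell d, b y ^ 2) * ENNReal.ofReal (∫ x, ψ x ^ 2) := by
  obtain ⟨b', h1, h2, h3, h4⟩ := exists_measurable_periodic hb.1 hb.2.1
  have key := lintegral_periodic_mul_sq (ε := ε) (Lp.memLp ψ) (h.integral_expi hε)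
    (b := fun y => ENNReal.ofReal (b' y ^ 2)) (h1.comp fun t => ENNReal.ofReal (t ^ 2))
    (by fun_prop)
  have e : ∫⁻ y in cell d, ENNReal.ofReal (b' y ^ 2) =
      ENNReal.ofReal (∫ y in cell d, b y ^ 2) := by
    rw [ofReal_integral_eq_lintegral_ofReal hb.2.integrable_sq
      (Eventually.of_forall fun y => sq_nonneg _)]
    refine lintegral_congr_ae ?_
    filter_upwards [h4] with y hy
    rw [hy]
  rw [← e, ← key]
  refine lintegral_congr_ae ?_
  filter_upwards [ae_rescale hε h3] with x hx
  rw [hx, mul_pow, ENNReal.ofReal_mul (sq_nonneg _)]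

theorem aestronglyMeasurable_rescale {ε : ℝ} (hε : 0 < ε) {b : E d → ℝ} (hb : IsPeriodic b)
    (hm : AEStronglyMeasurable b (volume.restrict (cell d))) :
    AEStronglyMeasurable (fun x : E d => b (ε⁻¹ • x)) volume :=
  (aestronglyMeasurable_of_cell hb hm).comp_quasiMeasurePreserving
    (Measure.quasiMeasurePreserving_smul volume (inv_ne_zero hε.ne'))

theorem BandLimited.memLp_mul {ε : ℝ} (hε : 0 < ε) {ψ : L2 d} (h : BandLimited ε ψ) {b : E d → ℝ}
    (hb : IsL2Per b) : MemLp (fun x => b (ε⁻¹ • x) * ψ x) 2 volume := by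
  have hm : AEStronglyMeasurable (fun x => b (ε⁻¹ • x) * ψ x) volume :=
    (aestronglyMeasurable_rescale hε hb.1 hb.2.1).mul (Lp.memLp ψ).1
  rw [memLp_two_iff_integrable_sq hm]
  refine ⟨hm.pow 2, ?_⟩
  rw [hasFiniteIntegral_iff_ofReal (Eventually.of_forall fun x => sq_nonneg _), h.lintegral hε hb]
  exact ENNReal.mul_lt_top ENNReal.ofReal_lt_top ENNReal.ofReal_lt_top

theorem BandLimited.integral_sq {ε : ℝ} (hε : 0 < ε) {ψ : L2 d} (h : BandLimited ε ψ)
    {b : E d → ℝ} (hb : IsL2Per b) :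
    ∫ x, (b (ε⁻¹ • x) * ψ x) ^ 2 = (∫ y in cell d, b y ^ 2) * ∫ x, ψ x ^ 2 := by
  have hi := (h.memLp_mul hε hb).integrable_sq
  have key := h.lintegral hε hb
  rw [← ofReal_integral_eq_lintegral_ofReal hi (Eventually.of_forall fun x => sq_nonneg _),
    ← ENNReal.ofReal_mul (integral_nonneg fun y => sq_nonneg _),
    ENNReal.ofReal_eq_ofReal_iff (integral_nonneg fun x => sq_nonneg _)
      (mul_nonneg (integral_nonneg fun y => sq_nonneg _) (integral_nonneg fun x => sq_nonneg _))]
    at key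
  exact key

theorem BandLimited.add {ε : ℝ} {ψ η : L2 d} (h : BandLimited ε ψ) (h' : BandLimited ε η) :
    BandLimited ε (ψ + η) := by
  unfold BandLimited at *
  rw [map_add, h, h']

/-- Products of two band-limited functions see only the mean values of oscillating factors. -/
theorem BandLimited.integral_mul {ε : ℝ} (hε : 0 < ε) {ψ η : L2 d} (h : BandLimited ε ψ)
    (h' : BandLimited ε η) {b c : E d → ℝ} (hb : IsL2Per b) (hc : IsL2Per c) :
    ∫ x, (b (ε⁻¹ • x) * ψ x) * (c (ε⁻¹ • x) * η x) =
      (∫ y in cell d, b y * c y) * ∫ x, ψ x * η x := by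
  -- Polarization, first in the band-limited factor and then in the oscillating one.
  have step : ∀ b : E d → ℝ, IsL2Per b →
      ∫ x, (b (ε⁻¹ • x) * ψ x) * (b (ε⁻¹ • x) * η x) =
        (∫ y in cell d, b y ^ 2) * ∫ x, ψ x * η x := fun b hb => by
    have i1 := h.memLp_mul hε hb
    have i2 := h'.memLp_mul hε hb
    have q := (h.add h').integral_sq hε hb
    have e1 : ∫ x, (b (ε⁻¹ • x) * (ψ + η : L2 d) x) ^ 2 =
        (∫ x, (b (ε⁻¹ • x) * ψ x) ^ 2) + (∫ x, (b (ε⁻¹ • x) * η x) ^ 2) +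
          2 * ∫ x, (b (ε⁻¹ • x) * ψ x) * (b (ε⁻¹ • x) * η x) := by
      have i3 : Integrable fun x => (b (ε⁻¹ • x) * ψ x) ^ 2 + (b (ε⁻¹ • x) * η x) ^ 2 :=
        i1.integrable_sq.add i2.integrable_sq
      rw [← integral_const_mul, ← integral_add i1.integrable_sq i2.integrable_sq,
        ← integral_add i3 ((integrable_L2_mul i1 i2).const_mul 2)]
      refine integral_congr_ae ?_
      filter_upwards [Lp.coeFn_add ψ η] with x hx
      rw [hx, Pi.add_apply]
      ring
    have e2 : ∫ x, ((ψ + η : L2 d) x) ^ 2 =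
        (∫ x, ψ x ^ 2) + (∫ x, η x ^ 2) + 2 * ∫ x, ψ x * η x := by
      have i3 := Lp.memLp ψ
      have i4 := Lp.memLp η
      have i5 : Integrable fun x => ψ x ^ 2 + η x ^ 2 := i3.integrable_sq.add i4.integrable_sq
      rw [← integral_const_mul, ← integral_add i3.integrable_sq i4.integrable_sq,
        ← integral_add i5 ((integrable_L2_mul i3 i4).const_mul 2)]
      refine integral_congr_ae ?_
      filter_upwards [Lp.coeFn_add ψ η] with x hx
      rw [hx, Pi.add_apply]
      ring
    rw [e1, e2, h.integral_sq hε hb, h'.integral_sq hε hb] at q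
    linarith
  have q := step _ (hb.add hc)
  have j1 := h.memLp_mul hε hb
  have j2 := h.memLp_mul hε hc
  have j3 := h'.memLp_mul hε hb
  have j4 := h'.memLp_mul hε hc
  have e1 : ∫ x, ((b (ε⁻¹ • x) + c (ε⁻¹ • x)) * ψ x) * ((b (ε⁻¹ • x) + c (ε⁻¹ • x)) * η x) =
      (∫ x, (b (ε⁻¹ • x) * ψ x) * (b (ε⁻¹ • x) * η x)) +
      (∫ x, (c (ε⁻¹ • x) * ψ x) * (c (ε⁻¹ • x) * η x)) +
      2 * ∫ x, (b (ε⁻¹ • x) * ψ x) * (c (ε⁻¹ • x) * η x) := by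
    have j5 : Integrable fun x => (b (ε⁻¹ • x) * ψ x) * (b (ε⁻¹ • x) * η x) +
        (c (ε⁻¹ • x) * ψ x) * (c (ε⁻¹ • x) * η x) :=
      (integrable_L2_mul j1 j3).add (integrable_L2_mul j2 j4)
    rw [← integral_const_mul, ← integral_add (integrable_L2_mul j1 j3) (integrable_L2_mul j2 j4),
      ← integral_add j5 ((integrable_L2_mul j1 j4).const_mul 2)]
    refine integral_congr_ae (Eventually.of_forall fun x => ?_)
    ring
  have e2 : ∫ y in cell d, (b y + c y) ^ 2 =
      (∫ y in cell d, b y ^ 2) + (∫ y in cell d, c y ^ 2) + 2 * ∫ y in cell d, b y * c y := by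
    have j5 : Integrable (fun y => b y ^ 2 + c y ^ 2) (volume.restrict (cell d)) :=
      hb.2.integrable_sq.add hc.2.integrable_sq
    rw [← integral_const_mul, ← integral_add hb.2.integrable_sq hc.2.integrable_sq,
      ← integral_add j5 ((hb.integrable_mul hc).const_mul 2)]
    refine integral_congr_ae (Eventually.of_forall fun x => ?_)
    ring
  rw [e1, e2, step b hb, step c hc] at q
  linarith

theorem exists_osc {ε : ℝ} (hε : 0 < ε) {b : E d → ℝ} (hb : IsL2Per b) :
    ∃ M : L2 d →L[ℝ] L2 d, ∀ g, M g =ᵐ[volume] fun x => b (ε⁻¹ • x) * lowPass ε g x := by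
  have hmem : ∀ g, MemLp (fun x => b (ε⁻¹ • x) * lowPass ε g x) 2 volume := fun g =>
    (bandLimited_lowPass ε g).memLp_mul hε hb
  let M₀ : L2 d →ₗ[ℝ] L2 d :=
    { toFun := fun g => (hmem g).toLp _
      map_add' := fun f g => by
        ext1
        filter_upwards [(hmem (f + g)).coeFn_toLp, (hmem f).coeFn_toLp, (hmem g).coeFn_toLp,
          Lp.coeFn_add ((hmem f).toLp _) ((hmem g).toLp _),
          Lp.coeFn_add (lowPass ε f) (lowPass ε g)] with x h1 h2 h3 h4 h5
        rw [h1, h4, Pi.add_apply, h2, h3, map_add, h5, Pi.add_apply, mul_add]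
      map_smul' := fun c f => by
        ext1
        filter_upwards [(hmem (c • f)).coeFn_toLp, (hmem f).coeFn_toLp,
          Lp.coeFn_smul c ((hmem f).toLp _), Lp.coeFn_smul c (lowPass ε f)] with x h1 h2 h3 h4
        rw [h1, RingHom.id_apply, h3, Pi.smul_apply, h2, map_smul, h4, Pi.smul_apply]
        simp only [smul_eq_mul]
        ring }
  have hM : ∀ g, M₀ g =ᵐ[volume] fun x => b (ε⁻¹ • x) * lowPass ε g x := fun g =>
    (hmem g).coeFn_toLp
  refine ⟨M₀.mkContinuous (Real.sqrt (∫ y in cell d, b y ^ 2)) fun g => ?_, hM⟩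
  refine (sq_le_sq₀ (norm_nonneg _) (by positivity)).1 ?_
  rw [mul_pow, Real.sq_sqrt (integral_nonneg fun y => sq_nonneg _), ← real_inner_self_eq_norm_sq,
    inner_eq_integral_mul]
  have e : ∫ x, M₀ g x * M₀ g x = ∫ x, (b (ε⁻¹ • x) * lowPass ε g x) ^ 2 := by
    refine integral_congr_ae ?_
    filter_upwards [hM g] with x hx
    rw [hx]
    ring
  rw [e, (bandLimited_lowPass ε g).integral_sq hε hb]
  gcongr
  · calc ∫ x, lowPass ε g x ^ 2 = ‖lowPass ε g‖ ^ 2 := by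
          rw [← real_inner_self_eq_norm_sq, inner_eq_integral_mul]
          simp only [pow_two]
      _ ≤ ‖g‖ ^ 2 := by
          gcongr
          exact norm_lowPass_le ε g

open Classical in
/-- The operator `g ↦ b(·/ε) Πg`, where `Π` is the cutoff `lowPass ε`; it is meaningful for `ε > 0`
and `b` periodic and square integrable over the cell. -/
noncomputable def osc (ε : ℝ) (b : E d → ℝ) : L2 d →L[ℝ] L2 d :=
  if h : ∃ M : L2 d →L[ℝ] L2 d, ∀ g, M g =ᵐ[volume] fun x => b (ε⁻¹ • x) * lowPass ε g x
    then h.choose else 0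

theorem osc_ae {ε : ℝ} (hε : 0 < ε) {b : E d → ℝ} (hb : IsL2Per b) (g : L2 d) :
    osc ε b g =ᵐ[volume] fun x => b (ε⁻¹ • x) * lowPass ε g x := by
  unfold osc
  rw [dif_pos (exists_osc hε hb)]
  exact (exists_osc hε hb).choose_spec g

variable {ε : ℝ}

/-- Products of oscillating functions factorize exactly, with no remainder in `ε`. -/
theorem inner_osc (hε : 0 < ε) {b c : E d → ℝ} (hb : IsL2Per b) (hc : IsL2Per c) (g h : L2 d) :
    ⟪osc ε b g, osc ε c h⟫ = (∫ y in cell d, b y * c y) * ⟪lowPass ε g, lowPass ε h⟫ := by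
  rw [inner_eq_integral_mul, inner_eq_integral_mul,
    ← (bandLimited_lowPass ε g).integral_mul hε (bandLimited_lowPass ε h) hb hc]
  refine integral_congr_ae ?_
  filter_upwards [osc_ae hε hb g, osc_ae hε hc h] with x h1 h2
  rw [h1, h2]

theorem osc_one (hε : 0 < ε) (g : L2 d) : osc ε (fun _ => 1) g = lowPass ε g := by
  ext1
  filter_upwards [osc_ae hε (isL2Per_const 1) g] with x hx
  rw [hx, one_mul]

theorem osc_add (hε : 0 < ε) {b c : E d → ℝ} (hb : IsL2Per b) (hc : IsL2Per c) (g : L2 d) :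
    osc ε (fun y => b y + c y) g = osc ε b g + osc ε c g := by
  ext1
  filter_upwards [osc_ae hε (hb.add hc) g, osc_ae hε hb g, osc_ae hε hc g,
    Lp.coeFn_add (osc ε b g) (osc ε c g)] with x h1 h2 h3 h4
  rw [h1, h4, Pi.add_apply, h2, h3, add_mul]

theorem osc_const_mul (hε : 0 < ε) {b : E d → ℝ} (hb : IsL2Per b) (c : ℝ) (g : L2 d) :
    osc ε (fun y => c * b y) g = c • osc ε b g := by
  ext1
  filter_upwards [osc_ae hε (hb.const_mul c) g, osc_ae hε hb g,
    Lp.coeFn_smul c (osc ε b g)] with x h1 h2 h3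
  rw [h1, h3, Pi.smul_apply, h2, smul_eq_mul, mul_assoc]

theorem osc_sum (hε : 0 < ε) {ι : Type*} (s : Finset ι) {b : ι → E d → ℝ}
    (hb : ∀ i, IsL2Per (b i)) (g : L2 d) :
    osc ε (fun y => ∑ i ∈ s, b i y) g = ∑ i ∈ s, osc ε (b i) g := by
  classical
  induction s using Finset.induction_on with
  | empty =>
    have := osc_const_mul hε (isL2Per_const (d := d) 1) 0 g
    simpa using this
  | insert a s ha ih =>
    simp only [Finset.sum_insert ha]
    rw [osc_add hε (hb a) (IsL2Per.sum fun i _ => hb i), ih]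

theorem inner_osc_lowPass (hε : 0 < ε) {b : E d → ℝ} (hb : IsL2Per b) (g h : L2 d) :
    ⟪osc ε b g, lowPass ε h⟫ = (∫ y in cell d, b y) * ⟪lowPass ε g, lowPass ε h⟫ := by
  rw [← osc_one hε h, inner_osc hε hb (isL2Per_const 1), osc_one hε h]
  simp

theorem norm_osc_sq_le (hε : 0 < ε) {b : E d → ℝ} (hb : IsL2Per b) (g : L2 d) :
    ‖osc ε b g‖ ^ 2 ≤ (∫ y in cell d, b y ^ 2) * ‖g‖ ^ 2 := by
  rw [← real_inner_self_eq_norm_sq, inner_osc hε hb hb, real_inner_self_eq_norm_sq]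
  simp only [← pow_two]
  gcongr
  exact norm_lowPass_le ε g

theorem norm_osc_le (hε : 0 < ε) {b : E d → ℝ} (hb : IsL2Per b) {B : ℝ} (hB : 0 ≤ B)
    (h : ∫ y in cell d, b y ^ 2 ≤ B ^ 2) (g : L2 d) : ‖osc ε b g‖ ≤ B * ‖g‖ := by
  refine (sq_le_sq₀ (norm_nonneg _) (by positivity)).1 ?_
  rw [mul_pow]
  refine (norm_osc_sq_le hε hb g).trans ?_
  gcongr

theorem osc_congr (hε : 0 < ε) {b c : E d → ℝ} (hb : IsL2Per b) (hc : IsL2Per c)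
    (h : b =ᵐ[volume] c) (g : L2 d) : osc ε b g = osc ε c g := by
  ext1
  filter_upwards [osc_ae hε hb g, osc_ae hε hc g, ae_rescale (P := fun y => b y = c y) hε h]
    with x h1 h2 h3
  rw [h1, h2, h3]

/-- The pairing `⟪b(·/ε)Πψ, z⟫` is an integral over the cell. -/
theorem exists_inner_osc_eq (hε : 0 < ε) (ψ z : L2 d) :
    ∃ P : E d → ℝ, IsL2Per P ∧ ∀ b, IsL2Per b → ⟪osc ε b ψ, z⟫ = ∫ y in cell d, b y * P y := by
  let rep : Lp ℝ 2 ((volume : Measure (E d)).restrict (cell d)) → E d → ℝ :=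
    fun f => periodicExt f
  have hrep_eq : ∀ f, rep f =ᵐ[volume.restrict (cell d)] f := fun f => periodicExt_ae _
  have hrep : ∀ f, IsL2Per (rep f) := fun f => isL2Per_periodicExt (Lp.memLp f)
  have hcell : ∀ {b c : E d → ℝ}, IsL2Per b → IsL2Per c → b =ᵐ[volume.restrict (cell d)] c →
      b =ᵐ[volume] c := fun hb hc h =>
    ae_of_ae_cell (P := fun y => _ = _) (hb.1.comp₂ hc.1 _) h
  let ℓ₀ : Lp ℝ 2 ((volume : Measure (E d)).restrict (cell d)) →ₗ[ℝ] ℝ :=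
    { toFun := fun f => ⟪osc ε (rep f) ψ, z⟫
      map_add' := fun f g => by
        rw [← inner_add_left, ← osc_add hε (hrep f) (hrep g)]
        rw [osc_congr hε (hrep _) ((hrep f).add (hrep g)) (hcell (hrep _) ((hrep f).add (hrep g)) ?_)]
        filter_upwards [hrep_eq (f + g), hrep_eq f, hrep_eq g, Lp.coeFn_add f g] with y h1 h2 h3 h4
        rw [h1, h4, Pi.add_apply, h2, h3]
      map_smul' := fun c f => by
        rw [RingHom.id_apply, smul_eq_mul, ← real_inner_smul_left, ← osc_const_mul hε (hrep f)]
        rw [osc_congr hε (hrep _) ((hrep f).const_mul c) (hcell (hrep _) ((hrep f).const_mul c) ?_)]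
        filter_upwards [hrep_eq (c • f), hrep_eq f, Lp.coeFn_smul c f] with y h1 h2 h3
        rw [h1, h3, Pi.smul_apply, h2, smul_eq_mul] }
  let ℓ := ℓ₀.mkContinuous (‖ψ‖ * ‖z‖) fun f => by
    have h1 : ∫ y in cell d, rep f y ^ 2 = ‖f‖ ^ 2 := by
      rw [← real_inner_self_eq_norm_sq, L2.inner_def]
      refine integral_congr_ae ?_
      filter_upwards [hrep_eq f] with y hy
      rw [hy, RCLike.inner_apply', pow_two]
      simp
    have h2 := norm_osc_le hε (hrep f) (norm_nonneg f) h1.le ψ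
    calc ‖⟪osc ε (rep f) ψ, z⟫‖ ≤ ‖osc ε (rep f) ψ‖ * ‖z‖ := norm_inner_le_norm _ _
      _ ≤ (‖f‖ * ‖ψ‖) * ‖z‖ := by gcongr
      _ = _ := by ring
  let p := (InnerProductSpace.toDual ℝ _).symm ℓ
  refine ⟨rep p, hrep p, fun b hb => ?_⟩
  have h3 : ⟪p, hb.2.toLp b⟫ = ⟪osc ε (rep (hb.2.toLp b)) ψ, z⟫ :=
    InnerProductSpace.toDual_symm_apply
  have h4 : rep (hb.2.toLp b) =ᵐ[volume.restrict (cell d)] b := (hrep_eq _).trans hb.2.coeFn_toLp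
  rw [osc_congr hε (hrep _) hb (hcell (hrep _) hb h4)] at h3
  rw [← h3, L2.inner_def]
  refine integral_congr_ae ?_
  filter_upwards [hrep_eq p, hb.2.coeFn_toLp] with y h5 h6
  rw [h6, h5, RCLike.inner_apply', mul_comm]
  simp

end Oscillating

end Homogenization

/-! ### Product rules for oscillating factors -/

namespace Homogenization

open scoped RealInnerProductSpace
open Filter

variable {d : ℕ}

section ProductRules

/-- Integration by parts in `H¹(ℝ^d)`. -/
theorem HasWeakGradient.inner_skew {u z : L2 d} {U Z : Fin d → L2 d} (hu : HasWeakGradient u U)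
    (hz : HasWeakGradient z Z) (i : Fin d) : ⟪U i, z⟫ + ⟪u, Z i⟫ = 0 := by
  classical
  have h := weak_identity_inner (U i) (Pi.single i u) (fun φ hφ => ?_) hz
  · rw [Finset.sum_eq_single i (fun j _ hj => by rw [Pi.single_eq_of_ne hj, inner_zero_left])
      (fun hi => absurd (Finset.mem_univ i) hi), Pi.single_eq_same] at h
    exact h
  · rw [Finset.sum_eq_single i (fun j _ hj => ?_) (fun hi => absurd (Finset.mem_univ i) hi),
      Pi.single_eq_same, hu i φ hφ, add_neg_cancel]
    rw [Pi.single_eq_of_ne hj]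
    refine (integral_congr_ae ?_).trans (integral_zero _ _)
    filter_upwards [Lp.coeFn_zero ℝ 2 (volume : Measure (E d))] with x hx
    rw [hx, Pi.zero_apply, zero_mul]

theorem IsTest.hasWeakGradient {φ : E d → ℝ} (h : IsTest φ) :
    HasWeakGradient (h.memLp.toLp φ) fun i => (h.pd i).memLp.toLp (Homogenization.pd i φ) := by
  intro i ψ hψ
  have e1 : ∫ x, (h.memLp.toLp φ) x * Homogenization.pd i ψ x = ∫ x, φ x * Homogenization.pd i ψ x := by
    refine integral_congr_ae ?_
    filter_upwards [h.memLp.coeFn_toLp] with x hx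
    rw [hx]
  have e2 : ∫ x, ((h.pd i).memLp.toLp (Homogenization.pd i φ)) x * ψ x = ∫ x, Homogenization.pd i φ x * ψ x := by
    refine integral_congr_ae ?_
    filter_upwards [(h.pd i).memLp.coeFn_toLp] with x hx
    rw [hx]
  rw [e1, e2]
  exact integral_mul_fderiv_eq_neg_fderiv_mul_of_integrable
    (integrable_L2_mul (h.pd i).memLp hψ.memLp) (integrable_L2_mul h.memLp (hψ.pd i).memLp)
    (integrable_L2_mul h.memLp hψ.memLp) (fun x _ => h.1.differentiable (by simp) x)
    (fun x _ => hψ.1.differentiable (by simp) x)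

theorem inner_toLp (f : L2 d) {φ : E d → ℝ} (h : MemLp φ 2 (volume : Measure (E d))) :
    ⟪f, h.toLp φ⟫ = ∫ x, f x * φ x := by
  rw [inner_eq_integral_mul]
  refine integral_congr_ae ?_
  filter_upwards [h.coeFn_toLp] with x hx
  rw [hx]

variable {ε : ℝ}

theorem IsPeriodicTest.hasWeakGradient_osc (hε : 0 < ε) {p : E d → ℝ} (hp : IsPeriodicTest p)
    {ψ : L2 d} {Ψ : Fin d → L2 d} (hψ : HasWeakGradient ψ Ψ) :
    HasWeakGradient (osc ε p ψ) fun i => ε⁻¹ • osc ε (Homogenization.pd i p) ψ + osc ε p (Ψ i) := by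
  intro i φ hφ
  have hpε : ContDiff ℝ ∞ fun x : E d => p (ε⁻¹ • x) := hp.1.comp (by fun_prop)
  have hq := hφ.mul_smooth hpε
  have key := hψ.lowPass ε i _ hq
  simp only [pd_mul i hpε hφ.1, pd_comp_smul i ε⁻¹ hp.1] at key
  have e1 : ∫ x, osc ε p ψ x * Homogenization.pd i φ x = ⟪osc ε p ψ, (hφ.pd i).memLp.toLp _⟫ :=
    (inner_toLp _ _).symm
  have e2 : ∫ x, (ε⁻¹ • osc ε (Homogenization.pd i p) ψ + osc ε p (Ψ i) : L2 d) x * φ x =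
      ⟪ε⁻¹ • osc ε (Homogenization.pd i p) ψ, hφ.memLp.toLp _⟫ + ⟪osc ε p (Ψ i), hφ.memLp.toLp _⟫ := by
    rw [← inner_add_left, inner_toLp]
  rw [e1, e2, real_inner_smul_left, inner_toLp, inner_toLp, inner_toLp, ← integral_const_mul]
  have i1 : Integrable fun x => osc ε p ψ x * Homogenization.pd i φ x :=
    integrable_L2_mul (Lp.memLp _) (hφ.pd i).memLp
  have i2 : Integrable fun x => ε⁻¹ * (osc ε (Homogenization.pd i p) ψ x * φ x) :=
    (integrable_L2_mul (Lp.memLp _) hφ.memLp).const_mul _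
  have e3 : ∫ x, lowPass ε ψ x * (p (ε⁻¹ • x) * Homogenization.pd i φ x + ε⁻¹ * Homogenization.pd i p (ε⁻¹ • x) * φ x) =
      (∫ x, osc ε p ψ x * Homogenization.pd i φ x) + ∫ x, ε⁻¹ * (osc ε (Homogenization.pd i p) ψ x * φ x) := by
    rw [← integral_add i1 i2]
    refine integral_congr_ae ?_
    filter_upwards [osc_ae hε hp.isL2Per ψ, osc_ae hε (hp.pd i).isL2Per ψ] with x h1 h2
    rw [h1, h2]
    ring
  have e4 : ∫ x, lowPass ε (Ψ i) x * (p (ε⁻¹ • x) * φ x) = ∫ x, osc ε p (Ψ i) x * φ x := by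
    refine integral_congr_ae ?_
    filter_upwards [osc_ae hε hp.isL2Per (Ψ i)] with x h1
    rw [h1]
    ring
  rw [e3, e4] at key
  linarith

/-- For `ψ, z ∈ H¹(ℝ^d)` the cell density of `b ↦ ⟪b(·/ε)Πψ, z⟫` belongs to `H¹_per`; the Leibniz
rule gives its gradient. -/
theorem exists_periodic_pairing (hε : 0 < ε) {ψ z : L2 d} {Ψ Z : Fin d → L2 d}
    (hψ : HasWeakGradient ψ Ψ) (hz : HasWeakGradient z Z) :
    ∃ (P : E d → ℝ) (Q : Fin d → E d → ℝ), HasPeriodicGradient P Q ∧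
      (∀ b, IsL2Per b → ⟪osc ε b ψ, z⟫ = ∫ y in cell d, b y * P y) ∧
      ∀ i b, IsL2Per b →
        ε * (⟪osc ε b (Ψ i), z⟫ + ⟪osc ε b ψ, Z i⟫) = ∫ y in cell d, b y * Q i y := by
  obtain ⟨P, hP, hPb⟩ := exists_inner_osc_eq hε ψ z
  choose Q₁ hQ₁ hQ₁b using fun i => exists_inner_osc_eq hε (Ψ i) z
  choose Q₂ hQ₂ hQ₂b using fun i => exists_inner_osc_eq hε ψ (Z i)
  have hQ : ∀ i, IsL2Per fun y => ε * (Q₁ i y + Q₂ i y) := fun i =>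
    ((hQ₁ i).add (hQ₂ i)).const_mul ε
  have hb : ∀ i b, IsL2Per b → ε * (⟪osc ε b (Ψ i), z⟫ + ⟪osc ε b ψ, Z i⟫) =
      ∫ y in cell d, b y * (ε * (Q₁ i y + Q₂ i y)) := fun i b hb => by
    rw [hQ₁b i b hb, hQ₂b i b hb, ← integral_add (hb.integrable_mul (hQ₁ i))
      (hb.integrable_mul (hQ₂ i)), ← integral_const_mul]
    refine integral_congr_ae (Eventually.of_forall fun y => ?_)
    ring
  refine ⟨P, fun i y => ε * (Q₁ i y + Q₂ i y), ⟨hP, hQ, fun i φ hφ => ?_⟩, hPb, hb⟩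
  have h1 := (hφ.hasWeakGradient_osc hε hψ).inner_skew hz i
  rw [inner_add_left, real_inner_smul_left, hPb _ (hφ.pd i).isL2Per] at h1
  have h2 := hb i φ hφ.isL2Per
  have e1 : ∫ y in cell d, P y * pd i φ y = ∫ y in cell d, pd i φ y * P y := by
    simp only [mul_comm]
  have e2 : ∫ y in cell d, ε * (Q₁ i y + Q₂ i y) * φ y =
      ∫ y in cell d, φ y * (ε * (Q₁ i y + Q₂ i y)) := by
    simp only [mul_comm]
  rw [e1, e2, ← h2]
  have h3 : ε * ε⁻¹ = 1 := mul_inv_cancel₀ hε.ne'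
  linear_combination ε * h1 - (∫ y in cell d, pd i φ y * P y) * h3

theorem HasPeriodicGradient.inner_osc_add (hε : 0 < ε) {N : E d → ℝ} {D : Fin d → E d → ℝ}
    (h : HasPeriodicGradient N D) {ψ z : L2 d} {Ψ Z : Fin d → L2 d}
    (hψ : HasWeakGradient ψ Ψ) (hz : HasWeakGradient z Z) (i : Fin d) :
    ε * (⟪osc ε N (Ψ i), z⟫ + ⟪osc ε N ψ, Z i⟫) + ⟪osc ε (D i) ψ, z⟫ = 0 := by
  obtain ⟨P, Q, hPQ, h1, h2⟩ := exists_periodic_pairing hε hψ hz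
  rw [h2 i _ h.memL2, h1 _ (h.grad_memL2 i)]
  exact h.integral_mul hPQ i

/-- The Leibniz rule for products of an oscillating and a band-limited function. -/
theorem HasPeriodicGradient.hasWeakGradient_osc (hε : 0 < ε) {N : E d → ℝ}
    {D : Fin d → E d → ℝ} (h : HasPeriodicGradient N D) {ψ : L2 d} {Ψ : Fin d → L2 d}
    (hψ : HasWeakGradient ψ Ψ) :
    HasWeakGradient (osc ε N ψ) fun i => ε⁻¹ • osc ε (D i) ψ + osc ε N (Ψ i) := by
  intro i φ hφ
  have key := h.inner_osc_add hε hψ hφ.hasWeakGradient i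
  rw [← inner_toLp _ (hφ.pd i).memLp, ← inner_toLp _ hφ.memLp, inner_add_left,
    real_inner_smul_left]
  have h3 : ε⁻¹ * ε = 1 := inv_mul_cancel₀ hε.ne'
  linear_combination ε⁻¹ * key - (⟪osc ε N (Ψ i), hφ.memLp.toLp φ⟫ +
    ⟪osc ε N ψ, (hφ.pd i).memLp.toLp _⟫) * h3

/-- A divergence-free periodic field stays divergence-free after rescaling, so that only the
derivatives of the band-limited factor survive an integration by parts. -/
theorem sum_inner_osc_divFree (hε : 0 < ε) {F : Fin d → E d → ℝ} (hF : ∀ i, IsL2Per (F i))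
    (hdiv : ∀ φ, IsPeriodicTest φ → ∫ y in cell d, ∑ i, F i y * pd i φ y = 0)
    {ψ z : L2 d} {Ψ Z : Fin d → L2 d} (hψ : HasWeakGradient ψ Ψ) (hz : HasWeakGradient z Z) :
    ∑ i, ⟪osc ε (F i) ψ, Z i⟫ = -∑ i, ⟪osc ε (F i) (Ψ i), z⟫ := by
  obtain ⟨P, Q, hPQ, -, h2⟩ := exists_periodic_pairing hε hψ hz
  have key := hPQ.integral_divFree hF hdiv
  simp only [← h2 _ _ (hF _)] at key
  rw [← Finset.mul_sum, Finset.sum_add_distrib] at key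
  have := (mul_eq_zero.1 key).resolve_left hε.ne'
  linarith

/-- An oscillating factor of mean zero is orthogonal to all low frequencies. -/
theorem inner_osc_eq_sub_lowPass (hε : 0 < ε) {g : E d → ℝ} (hg : IsL2Per g)
    (h0 : ∫ y in cell d, g y = 0) (ψ z : L2 d) :
    ⟪osc ε g ψ, z⟫ = ⟪osc ε g ψ, z - lowPass ε z⟫ := by
  rw [inner_sub_right, inner_osc_lowPass hε hg, h0, zero_mul, sub_zero]

end ProductRules

end Homogenization

/-! ### Elliptic forms and resolvents -/

namespace Homogenization

open scoped RealInnerProductSpace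
open Filter

section LaxMilgram

/-- The Lax–Milgram lemma on a closed subspace. -/
theorem exists_coercive_solution {H : Type*} [NormedAddCommGroup H] [InnerProductSpace ℝ H]
    [CompleteSpace H] (V : Submodule ℝ H) (hV : IsClosed (V : Set H)) (T : H →L[ℝ] H) {α : ℝ}
    (hα : 0 < α) (hT : ∀ v ∈ V, α * ‖v‖ ^ 2 ≤ ⟪T v, v⟫) (f : H) :
    ∃ v ∈ V, ∀ w ∈ V, ⟪T v, w⟫ = ⟪f, w⟫ := by
  have : CompleteSpace V := hV.completeSpace_coe
  let B : V →L[ℝ] V →L[ℝ] ℝ :=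
    ((innerSL ℝ).bilinearComp (T ∘L V.subtypeL) V.subtypeL)
  have hB : ∀ v w : V, B v w = ⟪T v, (w : H)⟫ := fun v w => rfl
  have hc : IsCoercive B := ⟨α, hα, fun v => by
    rw [hB, mul_assoc, ← pow_two]
    exact hT v v.2⟩
  let ℓ : V →L[ℝ] ℝ := (innerSL ℝ f) ∘L V.subtypeL
  let g : V := (InnerProductSpace.toDual ℝ V).symm ℓ
  let v := hc.continuousLinearEquivOfBilin.symm g
  refine ⟨v, v.2, fun w hw => ?_⟩
  have h1 := hc.continuousLinearEquivOfBilin_apply v ⟨w, hw⟩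
  rw [ContinuousLinearEquiv.apply_symm_apply] at h1
  have h2 : ⟪g, (⟨w, hw⟩ : V)⟫ = ℓ ⟨w, hw⟩ := InnerProductSpace.toDual_symm_apply
  rw [← hB v ⟨w, hw⟩, ← h1, h2]
  rfl

/-- The Lax–Milgram lemma for a block form `∑ ⟪A_{oo'} p_{o'}, q_o⟫` on a closed subspace of `X^ι`. -/
theorem exists_form_solution {ι X : Type*} [Fintype ι] [NormedAddCommGroup X]
    [InnerProductSpace ℝ X] [CompleteSpace X] (V : Submodule ℝ (PiLp 2 fun _ : ι => X))
    (hV : IsClosed (V : Set (PiLp 2 fun _ : ι => X))) (A : ι → ι → X →L[ℝ] X) {α : ℝ} (hα : 0 < α)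
    (hA : ∀ p ∈ V, α * ∑ o, ‖p o‖ ^ 2 ≤ ∑ o, ∑ o', ⟪A o o' (p o'), p o⟫) (f : ι → X) :
    ∃ p ∈ V, ∀ q ∈ V, ∑ o, ∑ o', ⟪A o o' (p o'), q o⟫ = ∑ o, ⟪f o, q o⟫ := by
  let T : (PiLp 2 fun _ : ι => X) →L[ℝ] (PiLp 2 fun _ : ι => X) :=
    ((PiLp.continuousLinearEquiv 2 ℝ fun _ : ι => X).symm : (ι → X) →L[ℝ] _) ∘L
      ContinuousLinearMap.pi fun o => ∑ o', A o o' ∘L PiLp.proj 2 (fun _ : ι => X) o'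
  have hT : ∀ p o, T p o = ∑ o', A o o' (p o') := fun p o => by
    simp [T]
  obtain ⟨p, hp, h⟩ := exists_coercive_solution V hV T hα (fun v hv => by
    rw [PiLp.norm_sq_eq_of_L2, PiLp.inner_apply]
    simp only [hT, sum_inner]
    exact hA v hv) (WithLp.toLp 2 f)
  refine ⟨p, hp, fun q hq => ?_⟩
  have := h q hq
  rw [PiLp.inner_apply, PiLp.inner_apply] at this
  simpa only [hT, sum_inner] using this

end LaxMilgram

section Forms

variable {d : ℕ} {μ : Measure (E d)}

open Classical in
/-- Multiplication by `m`, for essentially bounded `m`. -/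
noncomputable def mulOp (μ : Measure (E d)) (m : E d → ℝ) : Lp ℝ 2 μ →L[ℝ] Lp ℝ 2 μ :=
  if h : ∃ T : Lp ℝ 2 μ →L[ℝ] Lp ℝ 2 μ, ∀ f, T f =ᵐ[μ] fun x => m x * f x then h.choose else 0

theorem mulOp_ae {m : E d → ℝ} {C : ℝ} (hm : AEStronglyMeasurable m μ)
    (hb : ∀ᵐ x ∂μ, ‖m x‖ ≤ C) (f : Lp ℝ 2 μ) : mulOp μ m f =ᵐ[μ] fun x => m x * f x := by
  have h : ∃ T : Lp ℝ 2 μ →L[ℝ] Lp ℝ 2 μ, ∀ f, T f =ᵐ[μ] fun x => m x * f x := by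
    obtain ⟨T, hT, -⟩ := exists_mulCLM m hm (abs_nonneg C)
      (hb.mono fun x hx => hx.trans (le_abs_self C))
    exact ⟨T, hT⟩
  unfold mulOp
  rw [dif_pos h]
  exact h.choose_spec f

theorem norm_mulOp_apply_le {m : E d → ℝ} {C : ℝ} (hm : AEStronglyMeasurable m μ)
    (hb : ∀ᵐ x ∂μ, ‖m x‖ ≤ C) (f : Lp ℝ 2 μ) : ‖mulOp μ m f‖ ≤ C * ‖f‖ := by
  refine Lp.norm_le_mul_norm_of_ae_le_mul ?_
  filter_upwards [mulOp_ae hm hb f, hb] with x h1 h2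
  rw [h1, norm_mul]
  gcongr

theorem Lp_inner_eq (f g : Lp ℝ 2 μ) : ⟪f, g⟫ = ∫ x, f x * g x ∂μ := by
  rw [L2.inner_def]
  refine integral_congr_ae (Eventually.of_forall fun x => ?_)
  dsimp only
  rw [RCLike.inner_apply', RCLike.conj_to_real]

theorem Lp_integrable_mul (f g : Lp ℝ 2 μ) : Integrable (fun x => f x * g x) μ :=
  (Lp.memLp f).integrable_mul (Lp.memLp g)

/-- The matrix field `a` is measurable, elliptic with constant `lam`, and has entries bounded by
`Lam`, almost everywhere with respect to `μ`. -/
structure IsElliptic (μ : Measure (E d)) (lam Lam : ℝ) (a : MatrixField d) : Prop where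
  measurable : ∀ i k, AEStronglyMeasurable (fun y => a y i k) μ
  bounded : ∀ i k, ∀ᵐ y ∂μ, ‖a y i k‖ ≤ Lam
  lower : ∀ᵐ y ∂μ, ∀ ξ : E d, lam * ‖ξ‖ ^ 2 ≤ ∑ i, ∑ k, a y i k * ξ k * ξ i

/-- The bilinear form `∫ aU · Z dμ`. -/
noncomputable def energy (μ : Measure (E d)) (a : MatrixField d) (U Z : Fin d → Lp ℝ 2 μ) : ℝ :=
  ∑ i, ∑ k, ⟪mulOp μ (fun y => a y i k) (U k), Z i⟫

variable {lam Lam : ℝ} {a : MatrixField d}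

theorem energy_sub_left (U U' Z : Fin d → Lp ℝ 2 μ) :
    energy μ a (fun i => U i - U' i) Z = energy μ a U Z - energy μ a U' Z := by
  simp only [energy, map_sub, inner_sub_left, Finset.sum_sub_distrib]

theorem energy_sub_right (U Z Z' : Fin d → Lp ℝ 2 μ) :
    energy μ a U (fun i => Z i - Z' i) = energy μ a U Z - energy μ a U Z' := by
  simp only [energy, inner_sub_right, Finset.sum_sub_distrib]

theorem IsElliptic.lam_le_energy (h : IsElliptic μ lam Lam a) (U : Fin d → Lp ℝ 2 μ) :
    lam * ∑ i, ‖U i‖ ^ 2 ≤ energy μ a U U := by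
  have e : energy μ a U U = ∫ x, ∑ i, ∑ k, a x i k * U k x * U i x ∂μ := by
    have hi : ∀ i k, Integrable (fun x => a x i k * U k x * U i x) μ := fun i k => by
      refine (Lp_integrable_mul (mulOp μ (fun y => a y i k) (U k)) (U i)).congr ?_
      filter_upwards [mulOp_ae (h.measurable i k) (h.bounded i k) (U k)] with x hx
      rw [hx]
    rw [integral_finsetSum _ fun i _ => integrable_finsetSum _ fun k _ => hi i k]
    refine Finset.sum_congr rfl fun i _ => ?_
    rw [integral_finsetSum _ fun k _ => hi i k]
    refine Finset.sum_congr rfl fun k _ => ?_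
    rw [Lp_inner_eq]
    refine integral_congr_ae ?_
    filter_upwards [mulOp_ae (h.measurable i k) (h.bounded i k) (U k)] with x hx
    rw [hx]
  have hint : Integrable (fun x => ∑ i, ∑ k, a x i k * U k x * U i x) μ :=
    integrable_finsetSum _ fun i _ => integrable_finsetSum _ fun k _ => by
      refine (Lp_integrable_mul (mulOp μ (fun y => a y i k) (U k)) (U i)).congr ?_
      filter_upwards [mulOp_ae (h.measurable i k) (h.bounded i k) (U k)] with x hx
      rw [hx]
  have e2 : lam * ∑ i, ‖U i‖ ^ 2 = ∫ x, lam * ∑ i, U i x * U i x ∂μ := by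
    rw [integral_const_mul, integral_finsetSum _ fun i _ => Lp_integrable_mul (U i) (U i)]
    simp only [← Lp_inner_eq, real_inner_self_eq_norm_sq]
  rw [e, e2]
  refine integral_mono_ae ((integrable_finsetSum _ fun i _ =>
    Lp_integrable_mul (U i) (U i)).const_mul _) hint ?_
  filter_upwards [h.lower] with x hx
  have := hx (WithLp.toLp 2 fun i => U i x)
  rw [EuclideanSpace.norm_sq_eq] at this
  simp only [Real.norm_eq_abs, sq_abs] at this
  simpa only [← pow_two] using this

theorem IsElliptic.energy_le (h : IsElliptic μ lam Lam a) (U Z : Fin d → Lp ℝ 2 μ) :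
    |energy μ a U Z| ≤ Lam * (∑ k, ‖U k‖) * ∑ i, ‖Z i‖ := by
  calc |energy μ a U Z| ≤ ∑ i, ∑ k, (Lam * ‖U k‖) * ‖Z i‖ := by
        refine (Finset.abs_sum_le_sum_abs _ _).trans (Finset.sum_le_sum fun i _ => ?_)
        refine (Finset.abs_sum_le_sum_abs _ _).trans (Finset.sum_le_sum fun k _ => ?_)
        refine (abs_real_inner_le_norm _ _).trans ?_
        gcongr
        exact norm_mulOp_apply_le (h.measurable i k) (h.bounded i k) _
    _ = _ := by
        simp only [← Finset.sum_mul, ← Finset.mul_sum]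

/-- Lax–Milgram for the form `energy μ a` plus a multiple of the mass term. -/
theorem IsElliptic.exists_solution (h : IsElliptic μ lam Lam a)
    (V : Submodule ℝ (PiLp 2 fun _ : Option (Fin d) => Lp ℝ 2 μ))
    (hV : IsClosed (V : Set (PiLp 2 fun _ : Option (Fin d) => Lp ℝ 2 μ)))
    {α c : ℝ} (hα : 0 < α)
    (hco : ∀ p ∈ V, α * (‖p none‖ ^ 2 + ∑ i, ‖p (some i)‖ ^ 2) ≤
      c * ‖p none‖ ^ 2 + lam * ∑ i, ‖p (some i)‖ ^ 2) (f₀ : Lp ℝ 2 μ) (f : Fin d → Lp ℝ 2 μ) :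
    ∃ p ∈ V, ∀ q ∈ V, energy μ a (fun k => p (some k)) (fun i => q (some i)) +
      c * ⟪p none, q none⟫ = ⟪f₀, q none⟫ + ∑ i, ⟪f i, q (some i)⟫ := by
  let A : Option (Fin d) → Option (Fin d) → Lp ℝ 2 μ →L[ℝ] Lp ℝ 2 μ := fun o o' =>
    match o, o' with
    | none, none => c • ContinuousLinearMap.id ℝ _
    | some i, some k => mulOp μ fun y => a y i k
    | none, some _ => 0
    | some _, none => 0
  have hA : ∀ p q : PiLp 2 fun _ : Option (Fin d) => Lp ℝ 2 μ,
      ∑ o, ∑ o', ⟪A o o' (p o'), q o⟫ = energy μ a (fun k => p (some k)) (fun i => q (some i)) +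
        c * ⟪p none, q none⟫ := fun p q => by
    simp only [Fintype.sum_option, A, energy]
    simp [real_inner_smul_left, add_comm]
  obtain ⟨p, hp, hq⟩ := exists_form_solution V hV A hα (fun p hp => by
    rw [hA, Fintype.sum_option, real_inner_self_eq_norm_sq]
    have h1 := hco p hp
    have h2 := h.lam_le_energy fun k => p (some k)
    linarith) (fun o => o.elim f₀ f)
  refine ⟨p, hp, fun q hq' => ?_⟩
  rw [← hA, hq q hq', Fintype.sum_option]
  rfl

end Forms

section Resolvent

variable {d : ℕ} {lam Lam : ℝ} {a : MatrixField d}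

/-- Weak solutions with right-hand side `f - div g` may be tested with `H¹` functions. -/
theorem isWeakSolution_iff (h : IsElliptic volume lam Lam a) (u f : L2 d) (g : Fin d → L2 d) :
    IsWeakSolution a u (fun φ => (∫ x, f x * φ x) + ∑ i, ∫ x, g i x * pd i φ x) ↔
      ∃ U, HasWeakGradient u U ∧ ∀ z Z, HasWeakGradient z Z →
        energy volume a U Z + ⟪u, z⟫ = ⟪f, z⟫ + ∑ i, ⟪g i, Z i⟫ := by
  have hform : ∀ (U : Fin d → L2 d) (φ : E d → ℝ) (hφ : IsTest φ),
      ∫ x, ((∑ i, ∑ k, a x i k * U k x * pd i φ x) + u x * φ x) =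
        energy volume a U (fun i => (hφ.pd i).memLp.toLp _) + ⟪u, hφ.memLp.toLp _⟫ := by
    intro U φ hφ
    have hi : ∀ i k, Integrable (fun x => a x i k * U k x * pd i φ x) volume := fun i k => by
      refine (integrable_L2_mul (Lp.memLp (mulOp volume (fun y => a y i k) (U k)))
        (hφ.pd i).memLp).congr ?_
      filter_upwards [mulOp_ae (h.measurable i k) (h.bounded i k) (U k)] with x hx
      rw [hx]
    rw [integral_add (integrable_finsetSum _ fun i _ => integrable_finsetSum _ fun k _ => hi i k)
      (integrable_L2_mul (Lp.memLp u) hφ.memLp), inner_toLp,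
      integral_finsetSum _ fun i _ => integrable_finsetSum _ fun k _ => hi i k]
    congr 1
    refine Finset.sum_congr rfl fun i _ => ?_
    rw [integral_finsetSum _ fun k _ => hi i k]
    refine Finset.sum_congr rfl fun k _ => ?_
    rw [inner_toLp]
    refine integral_congr_ae ?_
    filter_upwards [mulOp_ae (h.measurable i k) (h.bounded i k) (U k)] with x hx
    rw [hx]
  constructor
  · rintro ⟨U, hU, hw⟩
    refine ⟨U, hU, fun z Z hz => ?_⟩
    have key := weak_identity_inner (u - f)
      (fun i => (∑ k, mulOp volume (fun y => a y i k) (U k)) - g i) (fun φ hφ => ?_) hz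
    · simp only [inner_sub_left, sum_inner, Finset.sum_sub_distrib] at key
      unfold energy
      linarith
    · have h1 := hw φ hφ
      rw [hform U φ hφ] at h1
      simp only [← inner_toLp _ hφ.memLp, ← inner_toLp _ (hφ.pd _).memLp, inner_sub_left,
        sum_inner, Finset.sum_sub_distrib] at h1 ⊢
      unfold energy at h1
      linarith
  · rintro ⟨U, hU, hw⟩
    refine ⟨U, hU, fun φ hφ => ?_⟩
    rw [hform U φ hφ, hw _ _ hφ.hasWeakGradient]
    simp only [inner_toLp]

theorem isClosed_hasWeakGradient : IsClosed {p : PiLp 2 fun _ : Option (Fin d) => L2 d |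
    HasWeakGradient (p none) fun i => p (some i)} := by
  have : {p : PiLp 2 fun _ : Option (Fin d) => L2 d | HasWeakGradient (p none) fun i => p (some i)} =
      ⋂ (i : Fin d) (φ : E d → ℝ) (hφ : IsTest φ), {p : PiLp 2 fun _ : Option (Fin d) => L2 d |
        ⟪p none, (hφ.pd i).memLp.toLp _⟫ = -⟪p (some i), hφ.memLp.toLp _⟫} := by
    ext p
    simp only [Set.mem_ofPred_eq, Set.mem_iInter, inner_toLp, HasWeakGradient]
  rw [this]
  have hc : ∀ o, Continuous fun p : PiLp 2 fun _ : Option (Fin d) => L2 d => p o := fun o =>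
    PiLp.continuous_apply 2 _ o
  exact isClosed_iInter fun i => isClosed_iInter fun φ => isClosed_iInter fun hφ =>
    isClosed_eq ((hc none).inner continuous_const) ((hc (some i)).inner continuous_const).neg

theorem HasWeakGradient.add {u v : L2 d} {U V : Fin d → L2 d} (hu : HasWeakGradient u U)
    (hv : HasWeakGradient v V) : HasWeakGradient (u + v) fun i => U i + V i := fun i φ hφ => by
  have h1 := hu i φ hφ
  have h2 := hv i φ hφ
  rw [← inner_toLp _ (hφ.pd i).memLp, ← inner_toLp _ hφ.memLp] at *
  rw [inner_add_left, inner_add_left, h1, h2, neg_add]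

theorem HasWeakGradient.smul {u : L2 d} {U : Fin d → L2 d} (hu : HasWeakGradient u U) (c : ℝ) :
    HasWeakGradient (c • u) fun i => c • U i := fun i φ hφ => by
  have h1 := hu i φ hφ
  rw [← inner_toLp _ (hφ.pd i).memLp, ← inner_toLp _ hφ.memLp] at *
  rw [real_inner_smul_left, real_inner_smul_left, h1, mul_neg]

theorem HasWeakGradient.sub {u v : L2 d} {U V : Fin d → L2 d} (hu : HasWeakGradient u U)
    (hv : HasWeakGradient v V) : HasWeakGradient (u - v) fun i => U i - V i := fun i φ hφ => by
  have h1 := hu i φ hφ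
  have h2 := hv i φ hφ
  rw [← inner_toLp _ (hφ.pd i).memLp, ← inner_toLp _ hφ.memLp] at *
  rw [inner_sub_left, inner_sub_left, h1, h2]
  ring

theorem hasWeakGradient_zero : HasWeakGradient (0 : L2 d) fun _ => 0 := fun i φ hφ => by
  rw [← inner_toLp _ (hφ.pd i).memLp, ← inner_toLp _ hφ.memLp, inner_zero_left, inner_zero_left,
    neg_zero]

theorem HasWeakGradient.sum {ι : Type*} (s : Finset ι) {u : ι → L2 d} {U : ι → Fin d → L2 d}
    (h : ∀ j ∈ s, HasWeakGradient (u j) (U j)) :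
    HasWeakGradient (∑ j ∈ s, u j) fun i => ∑ j ∈ s, U j i := by
  classical
  induction s using Finset.induction_on with
  | empty => simpa using hasWeakGradient_zero
  | insert j s hj ih =>
    simp only [Finset.sum_insert hj]
    exact (h j (Finset.mem_insert_self j s)).add
      (ih fun i hi => h i (Finset.mem_insert_of_mem hi))

theorem IsElliptic.energy_zero_unique (h : IsElliptic volume lam Lam a) (hlam : 0 < lam) {u : L2 d}
    {U : Fin d → L2 d} (h0 : energy volume a U U + ⟪u, u⟫ ≤ 0) : u = 0 := by
  have h1 := h.lam_le_energy U
  have h2 : 0 ≤ lam * ∑ i, ‖U i‖ ^ 2 := by positivity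
  rw [real_inner_self_eq_norm_sq] at h0
  have h3 : ‖u‖ ^ 2 = 0 := le_antisymm (by linarith) (sq_nonneg _)
  simpa using h3

theorem IsElliptic.exists_weak (h : IsElliptic volume lam Lam a) (hlam : 0 < lam) (f : L2 d) :
    ∃ u U, HasWeakGradient u U ∧ ∀ z Z, HasWeakGradient z Z →
      energy volume a U Z + ⟪u, z⟫ = ⟪f, z⟫ := by
  let V : Submodule ℝ (PiLp 2 fun _ : Option (Fin d) => L2 d) :=
    { carrier := {p | HasWeakGradient (p none) fun i => p (some i)}
      add_mem' := fun hp hq => HasWeakGradient.add hp hq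
      zero_mem' := hasWeakGradient_zero
      smul_mem' := fun c _ hp => HasWeakGradient.smul hp c }
  obtain ⟨p, hp, hq⟩ := h.exists_solution V isClosed_hasWeakGradient (lt_min hlam one_pos) (c := 1)
    (fun p _ => by
      rw [mul_add]
      refine (add_le_add (mul_le_mul_of_nonneg_right (min_le_right _ _) (sq_nonneg _))
        (mul_le_mul_of_nonneg_right (min_le_left _ _)
          (Finset.sum_nonneg fun i _ => sq_nonneg _)))) f 0
  refine ⟨p none, fun i => p (some i), hp, fun z Z hz => ?_⟩
  have := hq (WithLp.toLp 2 fun o => o.elim z Z) hz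
  simpa using this

/-- The resolvent exists, and its weak formulation extends to test functions in `H¹(ℝ^d)`. -/
theorem IsElliptic.exists_resolvent (h : IsElliptic volume lam Lam a) (hlam : 0 < lam) :
    ∃ R : L2 d →L[ℝ] L2 d, IsResolvent a R ∧ ∀ f, ∃ U, HasWeakGradient (R f) U ∧
      ∀ z Z, HasWeakGradient z Z → energy volume a U Z + ⟪R f, z⟫ = ⟪f, z⟫ := by
  choose u U hU hw using h.exists_weak hlam
  -- `A_ε + 1` is coercive, so the difference of two solutions tested with itself vanishes.
  have huniq : ∀ f v V, HasWeakGradient v V → (∀ z Z, HasWeakGradient z Z →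
      energy volume a V Z + ⟪v, z⟫ = ⟪f, z⟫) → v = u f := fun f v V hV hv => by
    rw [← sub_eq_zero]
    have h2 := hV.sub (hU f)
    refine h.energy_zero_unique hlam (U := fun i => V i - U f i) ?_
    rw [energy_sub_left, inner_sub_left]
    have h3 := hv _ _ h2
    have h4 := hw f _ _ h2
    linarith
  let R₀ : L2 d →ₗ[ℝ] L2 d :=
    { toFun := u
      map_add' := fun f g => by
        refine (huniq (f + g) _ _ ((hU f).add (hU g)) fun z Z hz => ?_).symm
        have h1 := hw f z Z hz
        have h2 := hw g z Z hz
        rw [inner_add_left, inner_add_left]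
        simp only [energy, map_add, inner_add_left, Finset.sum_add_distrib] at *
        linarith
      map_smul' := fun c f => by
        refine (huniq (c • f) _ _ ((hU f).smul c) fun z Z hz => ?_).symm
        have h1 := hw f z Z hz
        rw [real_inner_smul_left, real_inner_smul_left, ← h1]
        simp only [energy, map_smul, real_inner_smul_left, ← Finset.mul_sum]
        ring }
  let R : L2 d →L[ℝ] L2 d := R₀.mkContinuous 1 fun f => by
    change ‖u f‖ ≤ 1 * ‖f‖
    have h1 := hw f _ _ (hU f)
    have h2 := h.lam_le_energy (U f)
    have h3 : 0 ≤ lam * ∑ i, ‖U f i‖ ^ 2 := by positivity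
    rw [real_inner_self_eq_norm_sq] at h1
    have h4 := real_inner_le_norm f (u f)
    by_contra! hc
    nlinarith [norm_nonneg (u f), norm_nonneg f]
  refine ⟨R, fun f v => ?_, fun f => ⟨U f, hU f, hw f⟩⟩
  have e := isWeakSolution_iff h v f 0
  have e2 : (fun φ : E d → ℝ => (∫ x, f x * φ x) + ∑ i, ∫ x, (0 : Fin d → L2 d) i x * pd i φ x) =
      fun φ => ∫ x, f x * φ x := by
    funext φ
    rw [add_eq_left]
    refine Finset.sum_eq_zero fun i _ => (integral_congr_ae ?_).trans (integral_zero _ _)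
    filter_upwards [Lp.coeFn_zero ℝ 2 (volume : Measure (E d))] with x hx
    rw [Pi.zero_apply, hx, Pi.zero_apply, zero_mul]
  rw [e2] at e
  rw [e]
  simp only [Pi.zero_apply, inner_zero_left, Finset.sum_const_zero, add_zero]
  constructor
  · rintro ⟨V, hV, hv⟩
    exact huniq f v V hV hv
  · rintro rfl
    exact ⟨U f, hU f, hw f⟩

end Resolvent

end Homogenization

/-! ### A priori estimates for the cell problem -/

namespace Homogenization

open scoped RealInnerProductSpace
open Filter

variable {d : ℕ}

attribute [local instance] isProbabilityMeasure_cell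

section Coefficients

variable {lam : ℝ} {a : MatrixField d}

theorem IsAdmissible.transposed (h : IsAdmissible lam a) :
    IsAdmissible lam (Homogenization.transposed a) := by
  refine ⟨fun i j => h.measurable j i, h.periodic.comp _, ?_, ?_⟩
  · filter_upwards [h.lower] with y hy ξ
    refine (hy ξ).trans_eq ?_
    rw [Finset.sum_comm]
    refine Finset.sum_congr rfl fun i _ => Finset.sum_congr rfl fun k _ => ?_
    simp only [Homogenization.transposed, Matrix.transpose_apply]
    ring
  · filter_upwards [h.upper] with y hy ξ η
    calc _ = ∑ i, ∑ k, a y i k * η k * ξ i := by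
          rw [Finset.sum_comm]
          refine Finset.sum_congr rfl fun i _ => Finset.sum_congr rfl fun k _ => ?_
          simp only [Homogenization.transposed, Matrix.transpose_apply]
          ring
      _ ≤ lam⁻¹ * ‖η‖ * ‖ξ‖ := hy η ξ
      _ = _ := by ring

theorem entry_le_of_upper {M : Matrix (Fin d) (Fin d) ℝ} {C : ℝ}
    (h : ∀ ξ η : E d, ∑ i, ∑ k, M i k * ξ k * η i ≤ C * ‖ξ‖ * ‖η‖) (i k : Fin d) :
    ‖M i k‖ ≤ C := by
  classical
  have h1 := h (EuclideanSpace.single k 1) (EuclideanSpace.single i 1)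
  have h2 := h (EuclideanSpace.single k 1) (EuclideanSpace.single i (-1))
  simp at h1 h2
  rw [Real.norm_eq_abs, abs_le]
  constructor <;> linarith

theorem abs_apply_le_of_upper {M : Matrix (Fin d) (Fin d) ℝ} {C : ℝ}
    (h : ∀ ξ η : E d, ∑ i, ∑ k, M i k * ξ k * η i ≤ C * ‖ξ‖ * ‖η‖) (i : Fin d) (ξ : E d) :
    |∑ k, M i k * ξ k| ≤ C * ‖ξ‖ := by
  classical
  have h1 := h ξ (EuclideanSpace.single i 1)
  have h2 := h ξ (EuclideanSpace.single i (-1))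
  simp at h1 h2
  rw [abs_le]
  constructor <;> linarith

theorem IsAdmissible.isElliptic_cell (h : IsAdmissible lam a) :
    IsElliptic (volume.restrict (cell d)) lam lam⁻¹ a :=
  ⟨fun i k => (h.measurable i k).aestronglyMeasurable,
    fun i k => ae_restrict_of_ae (h.upper.mono fun _ hy => entry_le_of_upper hy i k),
    ae_restrict_of_ae h.lower⟩

theorem IsAdmissible.isElliptic_rescaled (h : IsAdmissible lam a) {ε : ℝ} (hε : 0 < ε) :
    IsElliptic volume lam lam⁻¹ (rescaled ε a) :=
  ⟨fun i k => ((h.measurable i k).comp (measurable_const_smul ε⁻¹)).aestronglyMeasurable,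
    fun i k => (ae_rescale hε h.upper).mono fun _ hy => entry_le_of_upper hy i k,
    ae_rescale (P := fun y => ∀ ξ : E d, lam * ‖ξ‖ ^ 2 ≤ ∑ i, ∑ k, a y i k * ξ k * ξ i) hε h.lower⟩

theorem IsAdmissible.isL2Per_mul (h : IsAdmissible lam a) {f : E d → ℝ} (hf : IsL2Per f)
    (i k : Fin d) : IsL2Per fun y => a y i k * f y :=
  hf.bdd_mul (h.periodic.comp fun M => M i k) (h.isElliptic_cell.measurable i k)
    (h.isElliptic_cell.bounded i k)

theorem IsAdmissible.isL2Per_apply (h : IsAdmissible lam a) {U : Fin d → E d → ℝ}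
    (hU : ∀ k, IsL2Per (U k)) (i : Fin d) : IsL2Per fun y => ∑ k, a y i k * U k y :=
  IsL2Per.sum fun k _ => h.isL2Per_mul (hU k) i k

theorem IsAdmissible.integral_lower (h : IsAdmissible lam a) {U : Fin d → E d → ℝ}
    (hU : ∀ k, IsL2Per (U k)) :
    lam * ∑ i, ∫ y in cell d, U i y ^ 2 ≤
      ∑ i, ∫ y in cell d, (∑ k, a y i k * U k y) * U i y := by
  rw [← integral_finsetSum _ fun i _ => (hU i).2.integrable_sq,
    ← integral_finsetSum _ fun i _ => (h.isL2Per_apply hU i).integrable_mul (hU i),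
    ← integral_const_mul]
  refine integral_mono_ae ((integrable_finsetSum _ fun i _ => (hU i).2.integrable_sq).const_mul _)
    (integrable_finsetSum _ fun i _ => (h.isL2Per_apply hU i).integrable_mul (hU i)) ?_
  filter_upwards [ae_restrict_of_ae h.lower] with y hy
  have := hy (WithLp.toLp 2 fun i => U i y)
  rw [EuclideanSpace.norm_sq_eq] at this
  simp only [Real.norm_eq_abs, sq_abs] at this
  simpa only [Finset.sum_mul] using this

theorem integral_add_const_sq {f : E d → ℝ} (hf : IsL2Per f) (c : ℝ) :
    ∫ y in cell d, (f y + c) ^ 2 =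
      (∫ y in cell d, f y ^ 2) + 2 * c * (∫ y in cell d, f y) + c ^ 2 := by
  have i1 : Integrable (fun y => f y ^ 2 + 2 * c * f y) (volume.restrict (cell d)) :=
    hf.2.integrable_sq.add (hf.integrable.const_mul _)
  have hc : c ^ 2 = ∫ y in cell d, c ^ 2 := by simp
  conv_rhs => rw [hc]
  rw [← integral_const_mul, ← integral_add hf.2.integrable_sq (hf.integrable.const_mul _),
    ← integral_add i1 (integrable_const _)]
  refine integral_congr_ae (Eventually.of_forall fun y => ?_)
  ring

theorem sq_integral_le {f : E d → ℝ} (hf : IsL2Per f) :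
    (∫ y in cell d, f y) ^ 2 ≤ ∫ y in cell d, f y ^ 2 := by
  have h : 0 ≤ ∫ y in cell d, (f y + -∫ y in cell d, f y) ^ 2 :=
    integral_nonneg fun y => sq_nonneg _
  rw [integral_add_const_sq hf] at h
  nlinarith

end Coefficients

section CellProblem

variable {lam : ℝ} {a : MatrixField d}

theorem HasPeriodicGradient.integral_grad {N : E d → ℝ} {D : Fin d → E d → ℝ}
    (h : HasPeriodicGradient N D) (i : Fin d) : ∫ y in cell d, D i y = 0 := by
  have h1 := h.weak i (fun _ => 1) ⟨contDiff_const, isPeriodic_const 1⟩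
  have h2 : ∀ y : E d, pd i (fun _ : E d => (1 : ℝ)) y = 0 := fun y => by simp [pd]
  simp only [h2, mul_zero, integral_zero, mul_one] at h1
  linarith

/-- `e^j + ∇N^j`. -/
def cellGrad (DN : Fin d → Fin d → E d → ℝ) (j i : Fin d) (y : E d) : ℝ :=
  (if i = j then 1 else 0) + DN j i y

variable {N Nt : Fin d → E d → ℝ} {DN DNt : Fin d → Fin d → E d → ℝ}

theorem cellFlux_eq (a : MatrixField d) (DN : Fin d → Fin d → E d → ℝ) (j i : Fin d) (y : E d) :
    cellFlux a DN j i y = ∑ k, a y i k * cellGrad DN j k y := rfl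

theorem IsCellSolution.isL2Per_cellGrad (h : IsCellSolution a N DN) (j i : Fin d) :
    IsL2Per (cellGrad DN j i) :=
  (isL2Per_const _).add (h.grad_memL2 j i)

theorem IsCellSolution.isL2Per_cellFlux (ha : IsAdmissible lam a) (h : IsCellSolution a N DN)
    (j i : Fin d) : IsL2Per (cellFlux a DN j i) :=
  ha.isL2Per_apply (fun k => h.isL2Per_cellGrad j k) i

theorem IsCellSolution.integral_cellGrad (h : IsCellSolution a N DN) (j i : Fin d) :
    ∫ y in cell d, cellGrad DN j i y = if i = j then 1 else 0 := by
  unfold cellGrad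
  rw [integral_add (integrable_const _) (h.grad_memL2 j i).integrable,
    (h.hasPeriodicGradient j).integral_grad]
  simp

theorem IsCellSolution.sum_integral_flux_mul (ha : IsAdmissible lam a) (h : IsCellSolution a N DN)
    {P : E d → ℝ} {Q : Fin d → E d → ℝ} (hP : HasPeriodicGradient P Q) (j : Fin d) :
    ∑ i, ∫ y in cell d, cellFlux a DN j i y * Q i y = 0 :=
  hP.integral_divFree (fun i => h.isL2Per_cellFlux ha j i) (h.equation j)

/-- The mean energy of two correctors gives the homogenized matrix. -/
theorem IsCellSolution.homMatrix_eq {b : MatrixField d} (ha : IsAdmissible lam a)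
    (h : IsCellSolution a N DN) (h' : IsCellSolution b Nt DNt) (i j : Fin d) :
    homMatrix a DN i j = ∑ m, ∫ y in cell d, cellFlux a DN j m y * cellGrad DNt i m y := by
  have h1 := h.sum_integral_flux_mul ha (h'.hasPeriodicGradient i) j
  have h2 : ∀ m, ∫ y in cell d, cellFlux a DN j m y * cellGrad DNt i m y =
      (if m = i then homMatrix a DN i j else 0) +
        ∫ y in cell d, cellFlux a DN j m y * DNt i m y := fun m => by
    have e : ∀ y, cellFlux a DN j m y * cellGrad DNt i m y =
        cellFlux a DN j m y * (if m = i then 1 else 0) + cellFlux a DN j m y * DNt i m y :=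
      fun y => by rw [cellGrad, mul_add]
    simp only [e]
    rw [integral_add ((h.isL2Per_cellFlux ha j m).integrable.mul_const _)
      ((h.isL2Per_cellFlux ha j m).integrable_mul (h'.grad_memL2 i m)), integral_mul_const]
    congr 1
    split_ifs with hm
    · rw [hm, mul_one]
      rfl
    · rw [mul_zero]
  simp only [h2, Finset.sum_add_distrib, h1]
  simp

/-- Homogenization commutes with transposition: both sides are the same mean energy. -/
theorem IsCellSolution.homMatrix_transposed (ha : IsAdmissible lam a) (h : IsCellSolution a N DN)
    (ht : IsCellSolution (transposed a) Nt DNt) :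
    homMatrix (transposed a) DNt = (homMatrix a DN).transpose := by
  ext j i
  rw [Matrix.transpose_apply, h.homMatrix_eq ha ht, ht.homMatrix_eq ha.transposed h,
    ← integral_finsetSum _ fun m _ =>
      (ht.isL2Per_cellFlux ha.transposed i m).integrable_mul (h.isL2Per_cellGrad j m),
    ← integral_finsetSum _ fun m _ =>
      (h.isL2Per_cellFlux ha j m).integrable_mul (ht.isL2Per_cellGrad i m)]
  refine integral_congr_ae (Eventually.of_forall fun y => ?_)
  simp only [cellFlux_eq, Finset.sum_mul]
  rw [Finset.sum_comm]
  refine Finset.sum_congr rfl fun m _ => Finset.sum_congr rfl fun k _ => ?_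
  simp only [transposed, Matrix.transpose_apply]
  ring

/-- The homogenized matrix keeps the ellipticity constant, by Jensen's inequality and
`⟨e^j + ∇N^j⟩ = e^j`. -/
theorem IsCellSolution.homMatrix_lower (hlam : 0 < lam) (ha : IsAdmissible lam a)
    (h : IsCellSolution a N DN) (ξ : E d) :
    lam * ‖ξ‖ ^ 2 ≤ ∑ i, ∑ k, homMatrix a DN i k * ξ k * ξ i := by
  have hG : ∀ m, IsL2Per fun y => ∑ k, ξ k * cellGrad DN k m y := fun m =>
    IsL2Per.sum fun k _ => (h.isL2Per_cellGrad k m).const_mul _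
  have h1 := ha.integral_lower hG
  have h2 : ∀ m, ξ m ^ 2 ≤ ∫ y in cell d, (∑ k, ξ k * cellGrad DN k m y) ^ 2 := fun m => by
    refine le_trans (le_of_eq ?_) (sq_integral_le (hG m))
    rw [integral_finsetSum _ fun k _ => ((h.isL2Per_cellGrad k m).const_mul _).integrable]
    simp [integral_const_mul, h.integral_cellGrad]
  have h3 : ∑ m, ∫ y in cell d, (∑ n, a y m n * ∑ k, ξ k * cellGrad DN k n y) *
      (∑ k, ξ k * cellGrad DN k m y) = ∑ i, ∑ k, homMatrix a DN i k * ξ k * ξ i := by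
    have e : ∀ m y, (∑ n, a y m n * ∑ k, ξ k * cellGrad DN k n y) *
        (∑ i, ξ i * cellGrad DN i m y) =
        ∑ i, ∑ k, ξ k * ξ i * (cellFlux a DN k m y * cellGrad DN i m y) := fun m y => by
      have : ∑ n, a y m n * ∑ k, ξ k * cellGrad DN k n y = ∑ k, ξ k * cellFlux a DN k m y := by
        simp only [cellFlux_eq, Finset.mul_sum]
        rw [Finset.sum_comm]
        exact Finset.sum_congr rfl fun _ _ => Finset.sum_congr rfl fun _ _ => by ring
      rw [this, mul_comm, Finset.sum_mul]
      refine Finset.sum_congr rfl fun i _ => ?_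
      rw [Finset.mul_sum]
      exact Finset.sum_congr rfl fun _ _ => by ring
    have hi : ∀ i k m, Integrable (fun y => ξ k * ξ i * (cellFlux a DN k m y * cellGrad DN i m y))
        (volume.restrict (cell d)) := fun i k m =>
      ((h.isL2Per_cellFlux ha k m).integrable_mul (h.isL2Per_cellGrad i m)).const_mul _
    simp only [e]
    simp only [integral_finsetSum _ fun i _ => integrable_finsetSum _ fun k _ => hi i k _,
      integral_finsetSum _ fun k _ => hi _ k _, integral_const_mul]
    rw [Finset.sum_comm]
    refine Finset.sum_congr rfl fun i _ => ?_
    rw [Finset.sum_comm]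
    refine Finset.sum_congr rfl fun k _ => ?_
    rw [h.homMatrix_eq ha h, ← Finset.mul_sum]
    ring
  rw [h3] at h1
  refine le_trans ?_ h1
  rw [EuclideanSpace.norm_sq_eq]
  simp only [Real.norm_eq_abs, sq_abs]
  gcongr with m
  exact h2 m

/-- The energy bound for the corrector, from testing its equation with `N^j`. -/
theorem IsCellSolution.integral_cellGrad_sq_le (hlam : 0 < lam) (ha : IsAdmissible lam a)
    (h : IsCellSolution a N DN) (j : Fin d) :
    ∑ i, ∫ y in cell d, cellGrad DN j i y ^ 2 ≤ lam⁻¹ ^ 4 := by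
  have h1 := ha.integral_lower fun k => h.isL2Per_cellGrad j k
  have h2 := h.homMatrix_eq ha h j j
  simp only [cellFlux_eq] at h2
  rw [← h2] at h1
  -- `a⁰_jj ≤ λ⁻¹ ⟨|e^j + ∇N^j|⟩`, which is absorbed by Young's inequality.
  have h3 : homMatrix a DN j j ≤
      lam / 2 * (∑ i, ∫ y in cell d, cellGrad DN j i y ^ 2) + lam⁻¹ ^ 3 / 2 := by
    have hi : ∀ i, Integrable (fun y => cellGrad DN j i y ^ 2) (volume.restrict (cell d)) :=
      fun i => (h.isL2Per_cellGrad j i).2.integrable_sq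
    have hc : lam⁻¹ ^ 3 / 2 = ∫ y in cell d, lam⁻¹ ^ 3 / 2 := by simp
    rw [← integral_finsetSum _ fun i _ => hi i, ← integral_const_mul]
    conv_rhs => rw [hc]
    rw [← integral_add ((integrable_finsetSum _ fun i _ => hi i).const_mul _) (integrable_const _)]
    refine integral_mono_ae (h.isL2Per_cellFlux ha j j).integrable
      (((integrable_finsetSum _ fun i _ => hi i).const_mul _).add (integrable_const _)) ?_
    filter_upwards [ae_restrict_of_ae ha.upper] with y hy
    have h4 := (le_abs_self _).trans
      (abs_apply_le_of_upper hy j (WithLp.toLp 2 fun k => cellGrad DN j k y))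
    set t := ‖(WithLp.toLp 2 fun k => cellGrad DN j k y : E d)‖ with ht
    have h5 : t ^ 2 = ∑ i, cellGrad DN j i y ^ 2 := by
      rw [ht, EuclideanSpace.norm_sq_eq]
      simp
    change cellFlux a DN j j y ≤ lam / 2 * (∑ i, cellGrad DN j i y ^ 2) + lam⁻¹ ^ 3 / 2
    rw [← h5]
    refine h4.trans ?_
    have h6 : lam / 2 * t ^ 2 + lam⁻¹ ^ 3 / 2 - lam⁻¹ * t = lam / 2 * (t - lam⁻¹ ^ 2) ^ 2 := by
      field_simp
      ring
    have h7 : 0 ≤ lam / 2 * (t - lam⁻¹ ^ 2) ^ 2 := by positivity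
    linarith
  have h8 : lam * ∑ i, ∫ y in cell d, cellGrad DN j i y ^ 2 ≤ lam⁻¹ ^ 3 := by linarith
  calc _ = lam⁻¹ * (lam * ∑ i, ∫ y in cell d, cellGrad DN j i y ^ 2) := by field_simp
    _ ≤ lam⁻¹ * lam⁻¹ ^ 3 := by gcongr
    _ = _ := by ring

/-- Poincaré's inequality bounds `N^j` by `∇N^j`, whose norm does not exceed that of
`e^j + ∇N^j` because `∇N^j` has mean zero. -/
theorem IsCellSolution.integral_corrector_sq_le (hlam : 0 < lam) (ha : IsAdmissible lam a)
    (h : IsCellSolution a N DN) (j : Fin d) :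
    ∫ y in cell d, N j y ^ 2 ≤ (lam⁻¹ ^ 2) ^ 2 := by
  refine ((h.hasPeriodicGradient j).poincare (h.mean_zero j)).trans ?_
  refine le_trans (Finset.sum_le_sum fun i _ => ?_)
    ((h.integral_cellGrad_sq_le hlam ha j).trans_eq (by ring))
  have e : ∀ y, cellGrad DN j i y = DN j i y + if i = j then 1 else 0 := fun y => add_comm _ _
  simp only [e]
  rw [integral_add_const_sq (h.grad_memL2 j i), (h.hasPeriodicGradient j).integral_grad, mul_zero,
    add_zero]
  exact le_add_of_nonneg_right (sq_nonneg _)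

theorem IsCellSolution.integral_cellFlux_sq_le (hlam : 0 < lam) (ha : IsAdmissible lam a)
    (h : IsCellSolution a N DN) (j i : Fin d) :
    ∫ y in cell d, cellFlux a DN j i y ^ 2 ≤ (lam⁻¹ ^ 3) ^ 2 := by
  have hi : ∀ i, Integrable (fun y => cellGrad DN j i y ^ 2) (volume.restrict (cell d)) :=
    fun i => (h.isL2Per_cellGrad j i).2.integrable_sq
  calc ∫ y in cell d, cellFlux a DN j i y ^ 2
      ≤ ∫ y in cell d, lam⁻¹ ^ 2 * ∑ i, cellGrad DN j i y ^ 2 := by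
        refine integral_mono_ae (h.isL2Per_cellFlux ha j i).2.integrable_sq
          ((integrable_finsetSum _ fun i _ => hi i).const_mul _) ?_
        filter_upwards [ae_restrict_of_ae ha.upper] with y hy
        have h4 := abs_apply_le_of_upper hy i (WithLp.toLp 2 fun k => cellGrad DN j k y)
        have h5 : ‖(WithLp.toLp 2 fun k => cellGrad DN j k y : E d)‖ ^ 2 =
            ∑ i, cellGrad DN j i y ^ 2 := by
          rw [EuclideanSpace.norm_sq_eq]
          simp
        rw [← h5, ← mul_pow, ← sq_abs]
        exact pow_le_pow_left₀ (abs_nonneg _) h4 2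
    _ = lam⁻¹ ^ 2 * ∑ i, ∫ y in cell d, cellGrad DN j i y ^ 2 := by
        rw [integral_const_mul, integral_finsetSum _ fun i _ => hi i]
    _ ≤ lam⁻¹ ^ 2 * lam⁻¹ ^ 4 := by
        gcongr
        exact h.integral_cellGrad_sq_le hlam ha j
    _ = _ := by ring

theorem IsCellSolution.abs_homMatrix_le (hlam : 0 < lam) (ha : IsAdmissible lam a)
    (h : IsCellSolution a N DN) (i j : Fin d) : |homMatrix a DN i j| ≤ lam⁻¹ ^ 3 := by
  refine abs_le_of_sq_le_sq ?_ (by positivity)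
  exact (sq_integral_le (h.isL2Per_cellFlux ha j i)).trans (h.integral_cellFlux_sq_le hlam ha j i)

theorem IsCellSolution.isElliptic_homMatrix (hlam : 0 < lam) (ha : IsAdmissible lam a)
    (h : IsCellSolution a N DN) :
    IsElliptic volume lam (lam⁻¹ ^ 3) fun _ : E d => homMatrix a DN :=
  ⟨fun _ _ => aestronglyMeasurable_const,
    fun i k => Eventually.of_forall fun _ => h.abs_homMatrix_le hlam ha i k,
    Eventually.of_forall fun _ => h.homMatrix_lower hlam ha⟩

theorem abs_integral_mul_le {f g : E d → ℝ} (hf : IsL2Per f) (hg : IsL2Per g) {A B : ℝ}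
    (hA : 0 ≤ A) (hB : 0 ≤ B) (h1 : ∫ y in cell d, f y ^ 2 ≤ A ^ 2)
    (h2 : ∫ y in cell d, g y ^ 2 ≤ B ^ 2) : |∫ y in cell d, f y * g y| ≤ A * B := by
  have e : ∀ {f : E d → ℝ} (hf : IsL2Per f) {A : ℝ}, 0 ≤ A → ∫ y in cell d, f y ^ 2 ≤ A ^ 2 →
      ‖hf.2.toLp f‖ ≤ A := fun {f} hf {A} hA h => by
    refine (sq_le_sq₀ (norm_nonneg _) hA).1 (le_trans (le_of_eq ?_) h)
    rw [← real_inner_self_eq_norm_sq, Lp_inner_eq]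
    refine integral_congr_ae ?_
    filter_upwards [hf.2.coeFn_toLp] with y hy
    rw [hy, pow_two]
  have e2 : ∫ y in cell d, f y * g y = ⟪hf.2.toLp f, hg.2.toLp g⟫ := by
    rw [Lp_inner_eq]
    refine integral_congr_ae ?_
    filter_upwards [hf.2.coeFn_toLp, hg.2.coeFn_toLp] with y h1 h2
    rw [h1, h2]
  rw [e2]
  refine (abs_real_inner_le_norm _ _).trans ?_
  gcongr
  exacts [e hf hA h1, e hg hB h2]

theorem IsCellSolution.abs_meanTensor_le {b : MatrixField d} (hlam : 0 < lam)
    (ha : IsAdmissible lam a) (hb : IsAdmissible lam b) (h : IsCellSolution a N DN)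
    (h' : IsCellSolution b Nt DNt) (i j k : Fin d) :
    |meanTensor Nt a DN i j k| ≤ lam⁻¹ ^ 2 * lam⁻¹ ^ 3 :=
  abs_integral_mul_le (h'.memL2 k) (h.isL2Per_cellFlux ha j i) (by positivity) (by positivity)
    (h'.integral_corrector_sq_le hlam hb k) (h.integral_cellFlux_sq_le hlam ha j i)

/-- The fluctuation `a(e^j + ∇N^j) - a⁰e^j` of the flux. -/
noncomputable def fluxDefect (a : MatrixField d) (DN : Fin d → Fin d → E d → ℝ) (j i : Fin d) (y : E d) : ℝ :=
  cellFlux a DN j i y - homMatrix a DN i j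

theorem IsCellSolution.isL2Per_fluxDefect (ha : IsAdmissible lam a) (h : IsCellSolution a N DN)
    (j i : Fin d) : IsL2Per (fluxDefect a DN j i) :=
  (h.isL2Per_cellFlux ha j i).sub (isL2Per_const _)

theorem IsCellSolution.integral_fluxDefect (ha : IsAdmissible lam a) (h : IsCellSolution a N DN)
    (j i : Fin d) : ∫ y in cell d, fluxDefect a DN j i y = 0 := by
  unfold fluxDefect
  rw [integral_sub (h.isL2Per_cellFlux ha j i).integrable (integrable_const _)]
  simp [homMatrix]

theorem IsCellSolution.fluxDefect_divFree (ha : IsAdmissible lam a) (h : IsCellSolution a N DN)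
    (j : Fin d) (φ : E d → ℝ) (hφ : IsPeriodicTest φ) :
    ∫ y in cell d, ∑ i, fluxDefect a DN j i y * pd i φ y = 0 := by
  have h1 := h.equation j φ hφ
  have hi : ∀ i, Integrable (fun y => cellFlux a DN j i y * pd i φ y) (volume.restrict (cell d)) :=
    fun i => (h.isL2Per_cellFlux ha j i).integrable_mul (hφ.pd i).isL2Per
  have hi' : ∀ i, Integrable (fun y => homMatrix a DN i j * pd i φ y) (volume.restrict (cell d)) :=
    fun i => (hφ.pd i).isL2Per.integrable.const_mul _
  rw [integral_finsetSum _ fun i _ => hi i] at h1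
  have e : ∀ i, ∫ y in cell d, fluxDefect a DN j i y * pd i φ y =
      ∫ y in cell d, cellFlux a DN j i y * pd i φ y := fun i => by
    simp only [fluxDefect, sub_mul]
    rw [integral_sub (hi i) (hi' i), integral_const_mul, integral_cell_pd hφ, mul_zero, sub_zero]
  rw [integral_finsetSum _ fun i _ =>
    (h.isL2Per_fluxDefect ha j i).integrable_mul (hφ.pd i).isL2Per]
  simp only [e, h1]

theorem IsCellSolution.integral_fluxDefect_sq_le (hlam : 0 < lam) (ha : IsAdmissible lam a)
    (h : IsCellSolution a N DN) (j i : Fin d) :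
    ∫ y in cell d, fluxDefect a DN j i y ^ 2 ≤ (lam⁻¹ ^ 3) ^ 2 := by
  refine le_trans ?_ (h.integral_cellFlux_sq_le hlam ha j i)
  have e : ∀ y, cellFlux a DN j i y = fluxDefect a DN j i y + homMatrix a DN i j := fun y =>
    (sub_add_cancel _ _).symm
  simp only [e]
  rw [integral_add_const_sq (h.isL2Per_fluxDefect ha j i), h.integral_fluxDefect ha, mul_zero,
    add_zero]
  exact le_add_of_nonneg_right (sq_nonneg _)

/-- The cell problem has at most one solution. -/
theorem IsCellSolution.unique (hlam : 0 < lam) (ha : IsAdmissible lam a)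
    (h : IsCellSolution a N DN) {M : Fin d → E d → ℝ} {DM : Fin d → Fin d → E d → ℝ}
    (h' : IsCellSolution a M DM) (j : Fin d) :
    N j =ᵐ[volume] M j ∧ ∀ i, DN j i =ᵐ[volume] DM j i := by
  have hD : HasPeriodicGradient (fun y => N j y - M j y) fun i y => DN j i y - DM j i y := by
    refine ⟨(h.memL2 j).sub (h'.memL2 j), fun i => (h.grad_memL2 j i).sub (h'.grad_memL2 j i),
      fun i φ hφ => ?_⟩
    have h1 := h.weakDeriv j i φ hφ
    have h2 := h'.weakDeriv j i φ hφ
    have hp := (hφ.pd i).isL2Per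
    simp only [sub_mul]
    rw [integral_sub ((h.memL2 j).integrable_mul hp) ((h'.memL2 j).integrable_mul hp),
      integral_sub ((h.grad_memL2 j i).integrable_mul hφ.isL2Per)
        ((h'.grad_memL2 j i).integrable_mul hφ.isL2Per), h1, h2]
    ring
  have h1 := h.sum_integral_flux_mul ha hD j
  have h2 := h'.sum_integral_flux_mul ha hD j
  have h3 := ha.integral_lower fun i => hD.grad_memL2 i
  have h4 : ∑ i, ∫ y in cell d, (∑ k, a y i k * (DN j k y - DM j k y)) * (DN j i y - DM j i y) =
      0 := by
    rw [← sub_eq_zero.2 (h1.trans h2.symm), ← Finset.sum_sub_distrib]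
    refine Finset.sum_congr rfl fun i _ => ?_
    rw [← integral_sub ((h.isL2Per_cellFlux ha j i).integrable_mul (hD.grad_memL2 i))
      ((h'.isL2Per_cellFlux ha j i).integrable_mul (hD.grad_memL2 i))]
    refine integral_congr_ae (Eventually.of_forall fun y => ?_)
    simp only [cellFlux, ← sub_mul, ← Finset.sum_sub_distrib]
    congr 1
    refine Finset.sum_congr rfl fun k _ => ?_
    ring
  rw [h4] at h3
  have h5 : ∑ i, ∫ y in cell d, (DN j i y - DM j i y) ^ 2 ≤ 0 := by
    by_contra! hc
    have := mul_pos hlam hc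
    linarith
  have hnn : ∀ i, 0 ≤ ∫ y in cell d, (DN j i y - DM j i y) ^ 2 := fun i =>
    integral_nonneg fun y => sq_nonneg _
  have h6 : ∀ {f g : E d → ℝ}, IsL2Per f → IsL2Per g → ∫ y in cell d, (f y - g y) ^ 2 ≤ 0 →
      f =ᵐ[volume] g := fun {f g} hf hg h0 => by
    have h7 := (integral_eq_zero_iff_of_nonneg (fun y => sq_nonneg _)
      (hf.sub hg).2.integrable_sq).1 (le_antisymm h0 (integral_nonneg fun y => sq_nonneg _))
    refine ae_of_ae_cell (P := fun y => f y = g y) (hf.1.comp₂ hg.1 _) ?_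
    filter_upwards [h7] with y hy
    exact sub_eq_zero.1 (by simpa using hy)
  refine ⟨h6 (h.memL2 j) (h'.memL2 j) ((hD.poincare ?_).trans h5), fun i =>
    h6 (h.grad_memL2 j i) (h'.grad_memL2 j i)
      ((Finset.single_le_sum (fun i _ => hnn i) (Finset.mem_univ i)).trans h5)⟩
  rw [integral_sub (h.memL2 j).integrable (h'.memL2 j).integrable, h.mean_zero, h'.mean_zero,
    sub_zero]

theorem IsCellSolution.congr {b : MatrixField d} (h : IsCellSolution a N DN)
    (hab : a =ᵐ[volume] b) : IsCellSolution b N DN := by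
  refine ⟨h.memL2, h.grad_memL2, h.weakDeriv, fun j φ hφ => ?_, h.mean_zero⟩
  rw [← h.equation j φ hφ]
  refine integral_congr_ae ?_
  filter_upwards [ae_restrict_of_ae hab] with y hy
  simp only [cellFlux, hy]

end CellProblem

end Homogenization

/-! ### Solvability of the cell problem -/

namespace Homogenization

open scoped RealInnerProductSpace
open Filter

variable {d : ℕ}

attribute [local instance] isProbabilityMeasure_cell

section CellExistence

variable {lam : ℝ} {a : MatrixField d}

/-- The real Hilbert space `L²(□)`. -/
abbrev L2Cell (d : ℕ) : Type := Lp ℝ 2 ((volume : Measure (E d)).restrict (cell d))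

theorem inner_toLp_cell (f : L2Cell d) {φ : E d → ℝ} (h : MemLp φ 2 (volume.restrict (cell d))) :
    ⟪f, h.toLp φ⟫ = ∫ y in cell d, f y * φ y := by
  rw [Lp_inner_eq]
  refine integral_congr_ae ?_
  filter_upwards [h.coeFn_toLp] with y hy
  rw [hy]

/-- The pairs `(N, ∇N)` with `N ∈ H¹_per` of mean zero. -/
def meanZeroPairs (d : ℕ) : Submodule ℝ (PiLp 2 fun _ : Option (Fin d) => L2Cell d) where
  carrier := {p | (∀ (i : Fin d) (φ : E d → ℝ) (hφ : IsPeriodicTest φ),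
    ⟪p none, (hφ.pd i).isL2Per.2.toLp _⟫ = -⟪p (some i), hφ.isL2Per.2.toLp _⟫) ∧
    ⟪p none, (isL2Per_const 1).2.toLp _⟫ = 0}
  add_mem' := fun {p q} hp hq => ⟨fun i φ hφ => by
    simp only [PiLp.add_apply, inner_add_left, hp.1 i φ hφ, hq.1 i φ hφ]
    ring, by simp only [PiLp.add_apply, inner_add_left, hp.2, hq.2, add_zero]⟩
  zero_mem' := ⟨fun i φ hφ => by simp, by simp⟩
  smul_mem' := fun c p hp => ⟨fun i φ hφ => by
    simp only [PiLp.smul_apply, real_inner_smul_left, hp.1 i φ hφ]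
    ring, by simp only [PiLp.smul_apply, real_inner_smul_left, hp.2, mul_zero]⟩

theorem isClosed_meanZeroPairs :
    IsClosed (meanZeroPairs d : Set (PiLp 2 fun _ : Option (Fin d) => L2Cell d)) := by
  have hc : ∀ o, Continuous fun p : PiLp 2 fun _ : Option (Fin d) => L2Cell d => p o := fun o =>
    PiLp.continuous_apply 2 _ o
  have : (meanZeroPairs d : Set (PiLp 2 fun _ : Option (Fin d) => L2Cell d)) =
      (⋂ (i : Fin d) (φ : E d → ℝ) (hφ : IsPeriodicTest φ),
        {p : PiLp 2 fun _ : Option (Fin d) => L2Cell d |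
          ⟪p none, (hφ.pd i).isL2Per.2.toLp _⟫ = -⟪p (some i), hφ.isL2Per.2.toLp _⟫}) ∩
      {p | ⟪p none, (isL2Per_const 1).2.toLp _⟫ = 0} := by
    ext p
    simp only [meanZeroPairs, Submodule.coe_set_mk, AddSubmonoid.coe_set_mk,
      AddSubsemigroup.coe_set_mk, Set.mem_ofPred_eq, Set.mem_inter_iff, Set.mem_iInter]
  rw [this]
  exact (isClosed_iInter fun i => isClosed_iInter fun φ => isClosed_iInter fun hφ =>
    isClosed_eq ((hc none).inner continuous_const) ((hc (some i)).inner continuous_const).neg).inter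
    (isClosed_eq ((hc none).inner continuous_const) continuous_const)

theorem integral_periodicExt_mul (f : L2Cell d) (g : E d → ℝ) :
    ∫ y in cell d, periodicExt f y * g y = ∫ y in cell d, f y * g y := by
  refine integral_congr_ae ?_
  filter_upwards [periodicExt_ae f] with y hy
  rw [hy]

theorem hasPeriodicGradient_of_mem {p : PiLp 2 fun _ : Option (Fin d) => L2Cell d}
    (hp : p ∈ meanZeroPairs d) :
    HasPeriodicGradient (periodicExt (p none)) (fun i => periodicExt (p (some i))) ∧
      ∫ y in cell d, periodicExt (p none) y = 0 := by
  refine ⟨⟨isL2Per_periodicExt (Lp.memLp _), fun i => isL2Per_periodicExt (Lp.memLp _),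
    fun i φ hφ => ?_⟩, ?_⟩
  · rw [integral_periodicExt_mul, integral_periodicExt_mul, ← inner_toLp_cell _ hφ.isL2Per.2,
      ← inner_toLp_cell _ (hφ.pd i).isL2Per.2]
    exact hp.1 i φ hφ
  · have h := hp.2
    rw [inner_toLp_cell, ← integral_periodicExt_mul] at h
    simpa using h

theorem norm_sq_eq_integral_periodicExt (f : L2Cell d) :
    ‖f‖ ^ 2 = ∫ y in cell d, periodicExt f y ^ 2 := by
  rw [← real_inner_self_eq_norm_sq, Lp_inner_eq]
  refine integral_congr_ae ?_
  filter_upwards [periodicExt_ae f] with y hy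
  rw [hy, pow_two]

/-- The cell problems are solvable. -/
theorem IsAdmissible.exists_isCellSolution (hlam : 0 < lam) (ha : IsAdmissible lam a) :
    ∃ N DN, IsCellSolution a N DN := by
  have hell := ha.isElliptic_cell
  have hcol : ∀ i j, IsL2Per fun y => -1 * (a y i j * 1) := fun i j =>
    (ha.isL2Per_mul (isL2Per_const 1) i j).const_mul _
  have hsol : ∀ j, ∃ p ∈ meanZeroPairs d, ∀ q ∈ meanZeroPairs d,
      energy (volume.restrict (cell d)) a (fun k => p (some k)) (fun i => q (some i)) +
        0 * ⟪p none, q none⟫ = ⟪(0 : L2Cell d), q none⟫ +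
          ∑ i, ⟪(hcol i j).2.toLp _, q (some i)⟫ := fun j =>
    -- The form does not control `N` itself; half of the gradient term does, by Poincaré.
    hell.exists_solution (meanZeroPairs d) isClosed_meanZeroPairs (half_pos hlam) (fun p hp => by
      obtain ⟨h1, h2⟩ := hasPeriodicGradient_of_mem hp
      have h3 := h1.poincare h2
      simp only [← norm_sq_eq_integral_periodicExt] at h3
      have h4 : lam / 2 * ‖p none‖ ^ 2 ≤ lam / 2 * ∑ i, ‖p (some i)‖ ^ 2 := by gcongr
      linarith) 0 fun i => (hcol i j).2.toLp _
  choose p hp hsol using hsol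
  refine ⟨fun j => periodicExt (p j none), fun j i => periodicExt (p j (some i)),
    fun j => (hasPeriodicGradient_of_mem (hp j)).1.memL2,
    fun j => (hasPeriodicGradient_of_mem (hp j)).1.grad_memL2,
    fun j => (hasPeriodicGradient_of_mem (hp j)).1.weak, fun j φ hφ => ?_,
    fun j => (hasPeriodicGradient_of_mem (hp j)).2⟩
  -- Subtracting the mean makes `φ` an admissible test function of the variational problem.
  set c := ∫ y in cell d, φ y with hc
  have hφc : IsL2Per fun y => φ y - c := hφ.isL2Per.sub (isL2Per_const c)
  let q : PiLp 2 fun _ : Option (Fin d) => L2Cell d :=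
    WithLp.toLp 2 fun o => o.elim (hφc.2.toLp _) fun i => (hφ.pd i).isL2Per.2.toLp _
  have hq0 : q none = hφc.2.toLp _ := rfl
  have hqi : ∀ i, q (some i) = (hφ.pd i).isL2Per.2.toLp _ := fun i => rfl
  have hq : q ∈ meanZeroPairs d := by
    refine ⟨fun i η hη => ?_, ?_⟩
    · rw [inner_toLp_cell, inner_toLp_cell, hq0, hqi]
      have h1 := hφ.hasPeriodicGradient.weak i η hη
      have e1 : ∫ y in cell d, (hφc.2.toLp _) y * pd i η y =
          (∫ y in cell d, φ y * pd i η y) - ∫ y in cell d, c * pd i η y := by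
        rw [← integral_sub (hφ.isL2Per.integrable_mul (hη.pd i).isL2Per)
          ((hη.pd i).isL2Per.integrable.const_mul _)]
        refine integral_congr_ae ?_
        filter_upwards [hφc.2.coeFn_toLp] with y hy
        rw [hy, sub_mul]
      have e2 : ∫ y in cell d, ((hφ.pd i).isL2Per.2.toLp _) y * η y =
          ∫ y in cell d, pd i φ y * η y := by
        refine integral_congr_ae ?_
        filter_upwards [(hφ.pd i).isL2Per.2.coeFn_toLp] with y hy
        rw [hy]
      rw [e1, e2, h1, integral_const_mul, integral_cell_pd hη, mul_zero, sub_zero]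
    · rw [inner_toLp_cell, hq0]
      have e1 : ∫ y in cell d, (hφc.2.toLp _) y * 1 = ∫ y in cell d, (φ y - c) := by
        refine integral_congr_ae ?_
        filter_upwards [hφc.2.coeFn_toLp] with y hy
        rw [hy, mul_one]
      rw [e1, integral_sub hφ.isL2Per.integrable (integrable_const _)]
      simp [hc]
  have key := hsol j q hq
  rw [inner_zero_left, zero_mul, zero_add, add_zero] at key
  have hD : ∀ i, IsL2Per (periodicExt (p j (some i))) := fun i =>
    isL2Per_periodicExt (Lp.memLp _)
  have i1 : ∀ i k, Integrable (fun y => a y i k * periodicExt (p j (some k)) y * pd i φ y)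
      (volume.restrict (cell d)) := fun i k =>
    (ha.isL2Per_mul (hD k) i k).integrable_mul (hφ.pd i).isL2Per
  have i2 : ∀ i, Integrable (fun y => a y i j * pd i φ y) (volume.restrict (cell d)) := fun i => by
    simpa using (ha.isL2Per_mul (isL2Per_const 1) i j).integrable_mul (hφ.pd i).isL2Per
  have e1 : ∀ i k, ⟪mulOp (volume.restrict (cell d)) (fun y => a y i k) (p j (some k)), q (some i)⟫ =
      ∫ y in cell d, a y i k * periodicExt (p j (some k)) y * pd i φ y := fun i k => by
    rw [hqi, inner_toLp_cell]
    refine integral_congr_ae ?_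
    filter_upwards [mulOp_ae (hell.measurable i k) (hell.bounded i k) (p j (some k)),
      periodicExt_ae (p j (some k))] with y h1 h2
    rw [h1, h2]
  have e2 : ∀ i, ⟪(hcol i j).2.toLp _, q (some i)⟫ = -∫ y in cell d, a y i j * pd i φ y :=
    fun i => by
      rw [hqi, inner_toLp_cell, ← integral_neg]
      refine integral_congr_ae ?_
      filter_upwards [(hcol i j).2.coeFn_toLp] with y h1
      rw [h1]
      ring
  simp only [energy, e1, e2] at key
  have e3 : ∀ y, ∑ i, cellFlux a (fun j i => periodicExt (p j (some i))) j i y * pd i φ y =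
      ∑ i, (a y i j * pd i φ y + ∑ k, a y i k * periodicExt (p j (some k)) y * pd i φ y) :=
    fun y => by
      refine Finset.sum_congr rfl fun i _ => ?_
      rw [cellFlux, Finset.sum_mul]
      simp only [mul_add, add_mul, Finset.sum_add_distrib]
      simp
  simp only [e3]
  have i3 : ∀ i, Integrable (fun y => a y i j * pd i φ y +
      ∑ k, a y i k * periodicExt (p j (some k)) y * pd i φ y) (volume.restrict (cell d)) :=
    fun i => (i2 i).add (integrable_finsetSum _ fun k _ => i1 i k)
  rw [integral_finsetSum _ fun i _ => i3 i]
  have e4 : ∀ i, ∫ y in cell d, (a y i j * pd i φ y +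
      ∑ k, a y i k * periodicExt (p j (some k)) y * pd i φ y) =
      (∫ y in cell d, a y i j * pd i φ y) +
        ∑ k, ∫ y in cell d, a y i k * periodicExt (p j (some k)) y * pd i φ y := fun i => by
    rw [integral_add (i2 i) (integrable_finsetSum _ fun k _ => i1 i k),
      integral_finsetSum _ fun k _ => i1 i k]
  simp only [e4, Finset.sum_add_distrib, key, Finset.sum_neg_distrib, add_neg_cancel]

end CellExistence

end Homogenization

/-! ### Constant coefficients -/

namespace Homogenization

open scoped Real ComplexConjugate RealInnerProductSpace
open Filter

variable {d : ℕ}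

section Symbols

open Classical in
/-- The Fourier multiplier with symbol `m`, for bounded `m` with `m(-ξ) = conj (m ξ)`. -/
noncomputable def multOp (m : E d → ℂ) : L2 d →L[ℝ] L2 d :=
  if h : ∃ T : L2 d →L[ℝ] L2 d, IsMultiplier m T then h.choose else 0

theorem isMultiplier_multOp {m : E d → ℂ} (hm : Measurable m) {C : ℝ} (hb : ∀ ξ, ‖m ξ‖ ≤ C)
    (hs : ∀ ξ, m (-ξ) = conj (m ξ)) : IsMultiplier m (multOp m) := by
  have h := exists_multiplier m hm hb hs
  unfold multOp
  rw [dif_pos h]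
  exact h.choose_spec

/-- `Mξ · ξ`. -/
def quadForm (M : Matrix (Fin d) (Fin d) ℝ) (ξ : E d) : ℝ := ∑ i, ∑ k, M i k * ξ k * ξ i

/-- The symbol `(1 + 4π² Mξ · ξ)⁻¹` of the resolvent `(-div M∇ + 1)⁻¹`. -/
noncomputable def resSymbol (M : Matrix (Fin d) (Fin d) ℝ) (ξ : E d) : ℂ :=
  ((1 + 4 * π ^ 2 * quadForm M ξ)⁻¹ : ℝ)

theorem conj_dsym (i : Fin d) (ξ : E d) : conj (dsym i ξ) = -dsym i ξ := by
  simp only [dsym, map_mul, Complex.conj_ofReal, Complex.conj_I, map_ofNat]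
  ring

theorem dsym_neg (i : Fin d) (ξ : E d) : dsym i (-ξ) = conj (dsym i ξ) := by
  rw [conj_dsym]
  simp [dsym]

theorem continuous_quadForm (M : Matrix (Fin d) (Fin d) ℝ) : Continuous (quadForm M) := by
  unfold quadForm
  fun_prop

theorem measurable_resSymbol (M : Matrix (Fin d) (Fin d) ℝ) : Measurable (resSymbol M) := by
  have := (continuous_quadForm M).measurable
  unfold resSymbol
  fun_prop

theorem resSymbol_neg (M : Matrix (Fin d) (Fin d) ℝ) (ξ : E d) :
    resSymbol M (-ξ) = conj (resSymbol M ξ) := by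
  simp only [resSymbol, quadForm, PiLp.neg_apply, mul_neg, neg_mul, neg_neg, Complex.conj_ofReal]

theorem conj_resSymbol (M : Matrix (Fin d) (Fin d) ℝ) (ξ : E d) :
    conj (resSymbol M ξ) = resSymbol M ξ := Complex.conj_ofReal _

theorem quadForm_transpose (M : Matrix (Fin d) (Fin d) ℝ) (ξ : E d) :
    quadForm M.transpose ξ = quadForm M ξ := by
  simp only [quadForm, Matrix.transpose_apply]
  rw [Finset.sum_comm]
  exact Finset.sum_congr rfl fun i _ => Finset.sum_congr rfl fun k _ => by ring

theorem resSymbol_transpose (M : Matrix (Fin d) (Fin d) ℝ) :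
    resSymbol M.transpose = resSymbol M := by
  funext ξ
  rw [resSymbol, resSymbol, quadForm_transpose]

theorem sum_norm_dsym_sq (ξ : E d) : ∑ i, ‖dsym i ξ‖ ^ 2 = 4 * π ^ 2 * ‖ξ‖ ^ 2 := by
  rw [EuclideanSpace.norm_sq_eq, Finset.mul_sum]
  refine Finset.sum_congr rfl fun i _ => ?_
  rw [norm_dsym, Real.norm_eq_abs]
  ring

variable {lam : ℝ} {M : Matrix (Fin d) (Fin d) ℝ}

theorem one_add_quadForm_pos (hlam : 0 < lam) (hM : ∀ ξ : E d, lam * ‖ξ‖ ^ 2 ≤ quadForm M ξ)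
    (ξ : E d) : 0 < 1 + 4 * π ^ 2 * quadForm M ξ := by
  have h1 := hM ξ
  have h2 : 0 ≤ lam * ‖ξ‖ ^ 2 := by positivity
  have h3 : 0 ≤ 4 * π ^ 2 * quadForm M ξ := mul_nonneg (by positivity) (h2.trans h1)
  linarith

theorem norm_resSymbol_le (hlam : 0 < lam) (hM : ∀ ξ : E d, lam * ‖ξ‖ ^ 2 ≤ quadForm M ξ)
    (ξ : E d) : ‖resSymbol M ξ‖ ≤ 1 := by
  have h0 := one_add_quadForm_pos hlam hM ξ
  have h1 := hM ξ
  have h2 : 0 ≤ lam * ‖ξ‖ ^ 2 := by positivity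
  have h3 : 0 ≤ 4 * π ^ 2 * quadForm M ξ := mul_nonneg (by positivity) (h2.trans h1)
  rw [resSymbol, Complex.norm_real, Real.norm_eq_abs, abs_of_pos (inv_pos.2 h0)]
  exact inv_le_one_of_one_le₀ (by linarith)

/-- The resolvent gains two derivatives. -/
theorem sum_dsym_sq_mul_resSymbol_le (hlam : 0 < lam)
    (hM : ∀ ξ : E d, lam * ‖ξ‖ ^ 2 ≤ quadForm M ξ) (ξ : E d) :
    (∑ i, ‖dsym i ξ‖ ^ 2) * ‖resSymbol M ξ‖ ≤ lam⁻¹ := by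
  have h0 := one_add_quadForm_pos hlam hM ξ
  rw [sum_norm_dsym_sq, resSymbol, Complex.norm_real, Real.norm_eq_abs, abs_of_pos (inv_pos.2 h0),
    mul_inv_le_iff₀ h0, inv_mul_eq_div, le_div_iff₀ hlam]
  have h1 : 4 * π ^ 2 * (lam * ‖ξ‖ ^ 2) ≤ 4 * π ^ 2 * quadForm M ξ :=
    mul_le_mul_of_nonneg_left (hM ξ) (by positivity)
  linarith

theorem norm_dsym_le_sqrt (i : Fin d) (ξ : E d) : ‖dsym i ξ‖ ≤ √(∑ i, ‖dsym i ξ‖ ^ 2) :=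
  Real.le_sqrt_of_sq_le (Finset.single_le_sum (f := fun i => ‖dsym i ξ‖ ^ 2)
    (fun _ _ => sq_nonneg _) (Finset.mem_univ i))

theorem norm_dsym_mul_resSymbol_le (hlam : 0 < lam)
    (hM : ∀ ξ : E d, lam * ‖ξ‖ ^ 2 ≤ quadForm M ξ) (i : Fin d) (ξ : E d) :
    ‖dsym i ξ * resSymbol M ξ‖ ≤ 1 + lam⁻¹ := by
  rw [norm_mul]
  have h1 := norm_dsym_le_sqrt i ξ
  have h2 := sum_dsym_sq_mul_resSymbol_le hlam hM ξ
  have h3 := norm_resSymbol_le hlam hM ξ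
  have h4 := Real.sq_sqrt (Finset.sum_nonneg fun (i : Fin d) (_ : i ∈ Finset.univ) =>
    sq_nonneg ‖dsym i ξ‖)
  set t := √(∑ i, ‖dsym i ξ‖ ^ 2)
  rw [← h4] at h2
  calc ‖dsym i ξ‖ * ‖resSymbol M ξ‖ ≤ (1 + t ^ 2) * ‖resSymbol M ξ‖ := by
        gcongr
        nlinarith [sq_nonneg (t - 1)]
    _ ≤ _ := by linarith

theorem norm_dsym_mul_dsym_mul_resSymbol_le (hlam : 0 < lam)
    (hM : ∀ ξ : E d, lam * ‖ξ‖ ^ 2 ≤ quadForm M ξ) (i k : Fin d) (ξ : E d) :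
    ‖dsym i ξ * (dsym k ξ * resSymbol M ξ)‖ ≤ lam⁻¹ := by
  rw [norm_mul, norm_mul, ← mul_assoc]
  refine le_trans ?_ (sum_dsym_sq_mul_resSymbol_le hlam hM ξ)
  gcongr
  rw [← Real.mul_self_sqrt (Finset.sum_nonneg fun (i : Fin d) (_ : i ∈ Finset.univ) =>
    sq_nonneg ‖dsym i ξ‖)]
  gcongr <;> exact norm_dsym_le_sqrt _ ξ

/-- `(-div M∇ + 1)⁻¹` for a constant matrix `M`. -/
noncomputable def constRes (M : Matrix (Fin d) (Fin d) ℝ) : L2 d →L[ℝ] L2 d :=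
  multOp (resSymbol M)

/-- `∂_k (-div M∇ + 1)⁻¹`. -/
noncomputable def constResGrad (M : Matrix (Fin d) (Fin d) ℝ) (k : Fin d) : L2 d →L[ℝ] L2 d :=
  multOp fun ξ => dsym k ξ * resSymbol M ξ

/-- `∂_i ∂_k (-div M∇ + 1)⁻¹`. -/
noncomputable def constResHess (M : Matrix (Fin d) (Fin d) ℝ) (i k : Fin d) : L2 d →L[ℝ] L2 d :=
  multOp fun ξ => dsym i ξ * (dsym k ξ * resSymbol M ξ)

theorem isMultiplier_constRes (hlam : 0 < lam) (hM : ∀ ξ : E d, lam * ‖ξ‖ ^ 2 ≤ quadForm M ξ) :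
    IsMultiplier (resSymbol M) (constRes M) :=
  isMultiplier_multOp (measurable_resSymbol M) (norm_resSymbol_le hlam hM) (resSymbol_neg M)

theorem isMultiplier_constResGrad (hlam : 0 < lam)
    (hM : ∀ ξ : E d, lam * ‖ξ‖ ^ 2 ≤ quadForm M ξ) (k : Fin d) :
    IsMultiplier (fun ξ => dsym k ξ * resSymbol M ξ) (constResGrad M k) :=
  isMultiplier_multOp ((continuous_dsym k).measurable.mul (measurable_resSymbol M))
    (norm_dsym_mul_resSymbol_le hlam hM k) fun ξ => by
      rw [map_mul, dsym_neg, resSymbol_neg]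

theorem isMultiplier_constResHess (hlam : 0 < lam)
    (hM : ∀ ξ : E d, lam * ‖ξ‖ ^ 2 ≤ quadForm M ξ) (i k : Fin d) :
    IsMultiplier (fun ξ => dsym i ξ * (dsym k ξ * resSymbol M ξ)) (constResHess M i k) :=
  isMultiplier_multOp ((continuous_dsym i).measurable.mul
    ((continuous_dsym k).measurable.mul (measurable_resSymbol M)))
    (norm_dsym_mul_dsym_mul_resSymbol_le hlam hM i k) fun ξ => by
      rw [map_mul, map_mul, dsym_neg, dsym_neg, resSymbol_neg]

theorem constRes_transpose (M : Matrix (Fin d) (Fin d) ℝ) : constRes M.transpose = constRes M := by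
  rw [constRes, constRes, resSymbol_transpose]

theorem constResGrad_transpose (M : Matrix (Fin d) (Fin d) ℝ) (k : Fin d) :
    constResGrad M.transpose k = constResGrad M k := by
  rw [constResGrad, constResGrad, resSymbol_transpose]

theorem constResHess_transpose (M : Matrix (Fin d) (Fin d) ℝ) (i k : Fin d) :
    constResHess M.transpose i k = constResHess M i k := by
  rw [constResHess, constResHess, resSymbol_transpose]

section Regularity

variable (hlam : 0 < lam) (hM : ∀ ξ : E d, lam * ‖ξ‖ ^ 2 ≤ quadForm M ξ)

include hlam hM

theorem hasWeakGradient_constRes (f : L2 d) :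
    HasWeakGradient (constRes M f) fun k => constResGrad M k f := by
  rw [hasWeakGradient_iff]
  intro k
  filter_upwards [isMultiplier_constRes hlam hM f, isMultiplier_constResGrad hlam hM k f]
    with ξ h1 h2
  rw [h1, h2, mul_assoc]

theorem hasWeakGradient_constResGrad (k : Fin d) (f : L2 d) :
    HasWeakGradient (constResGrad M k f) fun i => constResHess M i k f := by
  rw [hasWeakGradient_iff]
  intro i
  filter_upwards [isMultiplier_constResGrad hlam hM k f, isMultiplier_constResHess hlam hM i k f]
    with ξ h1 h2
  rw [h1, h2, mul_assoc]

theorem norm_constResGrad_le (k : Fin d) (f : L2 d) :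
    ‖constResGrad M k f‖ ≤ (1 + lam⁻¹) * ‖f‖ :=
  (isMultiplier_constResGrad hlam hM k).norm_apply_le (norm_dsym_mul_resSymbol_le hlam hM k) f

theorem norm_constResHess_le (i k : Fin d) (f : L2 d) :
    ‖constResHess M i k f‖ ≤ lam⁻¹ * ‖f‖ :=
  (isMultiplier_constResHess hlam hM i k).norm_apply_le
    (norm_dsym_mul_dsym_mul_resSymbol_le hlam hM i k) f

theorem inner_constRes (f g : L2 d) : ⟪constRes M f, g⟫ = ⟪f, constRes M g⟫ :=
  (isMultiplier_constRes hlam hM).adjoint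
    ((isMultiplier_constRes hlam hM).congr fun ξ => (conj_resSymbol M ξ).symm) f g

theorem lowPass_constRes (ε : ℝ) (f : L2 d) :
    lowPass ε (constRes M f) = constRes M (lowPass ε f) :=
  (isMultiplier_lowPass ε).comm (isMultiplier_constRes hlam hM) f

theorem lowPass_constResGrad (ε : ℝ) (k : Fin d) (f : L2 d) :
    lowPass ε (constResGrad M k f) = constResGrad M k (lowPass ε f) :=
  (isMultiplier_lowPass ε).comm (isMultiplier_constResGrad hlam hM k) f

theorem lowPass_constResHess (ε : ℝ) (i k : Fin d) (f : L2 d) :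
    lowPass ε (constResHess M i k f) = constResHess M i k (lowPass ε f) :=
  (isMultiplier_lowPass ε).comm (isMultiplier_constResHess hlam hM i k) f

theorem constResHess_comm (i k : Fin d) : constResHess M i k = constResHess M k i :=
  ((isMultiplier_constResHess hlam hM i k).congr fun _ => mul_left_comm _ _ _).unique
    (isMultiplier_constResHess hlam hM k i)

theorem inner_constResGrad (k : Fin d) (f g : L2 d) :
    ⟪constResGrad M k f, g⟫ = -⟪f, constResGrad M k g⟫ := by
  have h := (isMultiplier_constResGrad hlam hM k).adjoint
    (S := (-1 : ℝ) • constResGrad M k)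
    (((isMultiplier_constResGrad hlam hM k).smul (-1)).congr fun ξ => by
      rw [map_mul, conj_dsym, conj_resSymbol]
      push_cast
      ring) f g
  rw [h]
  simp

/-- Third-order pairings: all derivatives may be moved freely. -/
theorem inner_constResHess_constResGrad (i j k : Fin d) (f g : L2 d) :
    ⟪constResHess M i k f, constResGrad M j g⟫ = -⟪constResGrad M k f, constResHess M i j g⟫ :=
  eq_neg_of_add_eq_zero_left ((hasWeakGradient_constResGrad hlam hM k f).inner_skew
    (hasWeakGradient_constResGrad hlam hM j g) i)

theorem inner_constResGrad_constResHess_swap (i j k : Fin d) (f g : L2 d) :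
    ⟪constResGrad M k f, constResHess M i j g⟫ = ⟪constResGrad M i f, constResHess M k j g⟫ := by
  have h1 := inner_constResHess_constResGrad hlam hM i j k f g
  have h2 := inner_constResHess_constResGrad hlam hM k j i f g
  rw [constResHess_comm hlam hM i k, h2] at h1
  linarith

/-- The resolvent is small on high frequencies. -/
theorem norm_constRes_sub_lowPass_le {ε : ℝ} (hε : 0 < ε) (f : L2 d) :
    ‖constRes M (f - lowPass ε f)‖ ≤ ε ^ 2 * lam⁻¹ * ‖f‖ := by
  have h := (isMultiplier_constRes hlam hM).comp (isMultiplier_one.sub (isMultiplier_lowPass ε))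
  refine h.norm_apply_le (fun ξ => ?_) f
  have h1 := norm_one_sub_lowPassSymbol_le hε ξ
  have h2 := sum_dsym_sq_mul_resSymbol_le hlam hM ξ
  -- The symbol takes the values `0` and `1` only, so a second power of `ε` comes for free.
  have h3 : ‖1 - lowPassSymbol ε ξ‖ = ‖1 - lowPassSymbol ε ξ‖ ^ 2 := by
    unfold lowPassSymbol
    split_ifs <;> simp
  rw [norm_mul, h3, mul_comm]
  calc _ ≤ (ε ^ 2 * ∑ i, ‖dsym i ξ‖ ^ 2) * ‖resSymbol M ξ‖ := by gcongr
    _ = ε ^ 2 * ((∑ i, ‖dsym i ξ‖ ^ 2) * ‖resSymbol M ξ‖) := by ring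
    _ ≤ _ := by gcongr

theorem norm_constResGrad_sub_lowPass_le {ε : ℝ} (hε : 0 < ε) (k : Fin d) (f : L2 d) :
    ‖constResGrad M k (f - lowPass ε f)‖ ≤ ε * lam⁻¹ * ‖f‖ := by
  have h := (isMultiplier_constResGrad hlam hM k).comp
    (isMultiplier_one.sub (isMultiplier_lowPass ε))
  refine h.norm_apply_le (fun ξ => ?_) f
  have h0 : 0 ≤ ∑ i, ‖dsym i ξ‖ ^ 2 := Finset.sum_nonneg fun i _ => sq_nonneg _
  have h1 : ‖1 - lowPassSymbol ε ξ‖ ≤ ε * √(∑ i, ‖dsym i ξ‖ ^ 2) := by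
    refine (sq_le_sq₀ (norm_nonneg _) (by positivity)).1 ?_
    rw [mul_pow, Real.sq_sqrt h0]
    exact norm_one_sub_lowPassSymbol_le hε ξ
  have h2 := sum_dsym_sq_mul_resSymbol_le hlam hM ξ
  rw [norm_mul, norm_mul]
  calc ‖dsym k ξ‖ * ‖resSymbol M ξ‖ * ‖1 - lowPassSymbol ε ξ‖
      ≤ √(∑ i, ‖dsym i ξ‖ ^ 2) * ‖resSymbol M ξ‖ * (ε * √(∑ i, ‖dsym i ξ‖ ^ 2)) := by
        gcongr
        exact norm_dsym_le_sqrt k ξ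
    _ = ε * ((√(∑ i, ‖dsym i ξ‖ ^ 2) * √(∑ i, ‖dsym i ξ‖ ^ 2)) * ‖resSymbol M ξ‖) := by ring
    _ ≤ _ := by
        rw [Real.mul_self_sqrt h0]
        gcongr

end Regularity

end Symbols

section ConstantCoefficients

variable {lam Lam : ℝ} {M : Matrix (Fin d) (Fin d) ℝ}

theorem mulOp_const {μ : Measure (E d)} (c : ℝ) (f : Lp ℝ 2 μ) :
    mulOp μ (fun _ => c) f = c • f := by
  ext1
  filter_upwards [mulOp_ae (m := fun _ => c) (C := ‖c‖) aestronglyMeasurable_const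
    (Eventually.of_forall fun _ => le_rfl) f, Lp.coeFn_smul c f] with x h1 h2
  rw [h1, h2, Pi.smul_apply, smul_eq_mul]

theorem energy_const {μ : Measure (E d)} (M : Matrix (Fin d) (Fin d) ℝ)
    (U Z : Fin d → Lp ℝ 2 μ) :
    energy μ (fun _ => M) U Z = ∑ i, ∑ k, M i k * ⟪U k, Z i⟫ := by
  simp only [energy, mulOp_const, real_inner_smul_left]

theorem IsElliptic.quadForm_lower {μ : Measure (E d)} [NeZero μ]
    (h : IsElliptic μ lam Lam fun _ => M) (ξ : E d) : lam * ‖ξ‖ ^ 2 ≤ quadForm M ξ := by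
  obtain ⟨_, hy⟩ := h.lower.exists
  exact hy ξ

/-- The solution operator for right-hand sides `f - div g` in the case of constant coefficients. -/
theorem isWeakSolution_const_iff (hlam : 0 < lam) (h : IsElliptic volume lam Lam fun _ : E d => M)
    (f w : L2 d) (g : Fin d → L2 d) :
    IsWeakSolution (fun _ => M) w (fun φ => (∫ x, f x * φ x) + ∑ i, ∫ x, g i x * pd i φ x) ↔
      w = constRes M f - ∑ j, constResGrad M j (g j) := by
  have hM := h.quadForm_lower
  rw [isWeakSolution_iff h]
  set w₀ := constRes M f - ∑ j, constResGrad M j (g j) with hw₀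
  set W₀ : Fin d → L2 d := fun i => constResGrad M i f - ∑ j, constResHess M i j (g j) with hW₀
  have hg : HasWeakGradient w₀ W₀ := (hasWeakGradient_constRes hlam hM f).sub
    (HasWeakGradient.sum _ fun j _ => hasWeakGradient_constResGrad hlam hM j (g j))
  have hsol : ∀ z Z, HasWeakGradient z Z →
      energy volume (fun _ => M) W₀ Z + ⟪w₀, z⟫ = ⟪f, z⟫ + ∑ i, ⟪g i, Z i⟫ := by
    intro z Z hz
    have key := weak_identity_inner (w₀ - f) (fun i => (∑ k, M i k • W₀ k) - g i)
      ((weak_identity_iff _ _).2 ?_) hz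
    · simp only [inner_sub_left, sum_inner, real_inner_smul_left, Finset.sum_sub_distrib] at key
      rw [energy_const]
      linarith
    · have e1 := ae_all_iff.2 ((hasWeakGradient_iff _ _).1 hg)
      have e2 := ae_all_iff.2 fun i => hat_sub_ae (∑ k, M i k • W₀ k) (g i)
      have e3 := ae_all_iff.2 fun i => hat_sum_ae Finset.univ fun k => M i k • W₀ k
      have e4 := ae_all_iff.2 fun i => ae_all_iff.2 fun k => hat_smul_ae (M i k) (W₀ k)
      have e5 := ae_all_iff.2 fun j => isMultiplier_constResGrad hlam hM j (g j)
      filter_upwards [e1, e2, e3, e4, e5, hat_sub_ae w₀ f, isMultiplier_constRes hlam hM f,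
        hat_sub_ae (constRes M f) (∑ j, constResGrad M j (g j)),
        hat_sum_ae Finset.univ fun j => constResGrad M j (g j)] with ξ e1 e2 e3 e4 e5 e6 e7 e8 e9
      rw [e6]
      simp only [e2, e3, e4, e1]
      have hr : (1 + 4 * π ^ 2 * (quadForm M ξ : ℂ)) * resSymbol M ξ = 1 := by
        rw [resSymbol]
        have := (one_add_quadForm_pos hlam hM ξ).ne'
        exact_mod_cast mul_inv_cancel₀ this
      have hq : ∑ i, dsym i ξ * ∑ k, (M i k : ℂ) * (dsym k ξ * hat w₀ ξ) =
          -(4 * π ^ 2 * (quadForm M ξ : ℂ)) * hat w₀ ξ := by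
        simp only [quadForm, Complex.ofReal_sum, Complex.ofReal_mul, Finset.mul_sum, neg_mul,
          Finset.sum_mul, ← Finset.sum_neg_distrib]
        refine Finset.sum_congr rfl fun i _ => Finset.sum_congr rfl fun k _ => ?_
        simp only [dsym]
        linear_combination (4 * π ^ 2 * (ξ i) * (ξ k) * (M i k) * hat w₀ ξ : ℂ) * Complex.I_mul_I
      simp only [mul_sub, Finset.sum_sub_distrib]
      rw [hq]
      have hw : hat w₀ ξ = resSymbol M ξ * (hat f ξ - ∑ i, dsym i ξ * hat (g i) ξ) := by
        rw [hw₀, e8, e9, e7, mul_sub, Finset.mul_sum]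
        congr 1
        refine Finset.sum_congr rfl fun j _ => ?_
        rw [e5 j]
        ring
      linear_combination (1 + 4 * π ^ 2 * (quadForm M ξ : ℂ)) * hw +
        (hat f ξ - ∑ i, dsym i ξ * hat (g i) ξ) * hr
  constructor
  · rintro ⟨U, hU, hw⟩
    rw [← sub_eq_zero]
    have hd := hU.sub hg
    refine h.energy_zero_unique hlam (U := fun i => U i - W₀ i) ?_
    rw [energy_sub_left, inner_sub_left]
    have h1 := hw _ _ hd
    have h2 := hsol _ _ hd
    linarith
  · rintro rfl
    exact ⟨W₀, hg, hsol⟩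

theorem sum_integral_zero_mul (φ : E d → ℝ) :
    ∑ i, ∫ x, (0 : L2 d) x * pd i φ x = 0 := by
  refine Finset.sum_eq_zero fun i _ => (integral_congr_ae ?_).trans (integral_zero _ _)
  filter_upwards [Lp.coeFn_zero ℝ 2 (volume : Measure (E d))] with x hx
  rw [hx, Pi.zero_apply, zero_mul]

theorem isResolvent_constRes (hlam : 0 < lam) (h : IsElliptic volume lam Lam fun _ : E d => M) :
    IsResolvent (fun _ => M) (constRes M) := fun f u => by
  have e := isWeakSolution_const_iff hlam h f u 0
  simpa only [sum_integral_zero_mul, Pi.zero_apply, map_zero, Finset.sum_const_zero, add_zero,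
    sub_zero] using e

theorem energy_constResGrad (hlam : 0 < lam) (h : IsElliptic volume lam Lam fun _ : E d => M)
    (f : L2 d) {z : L2 d} {Z : Fin d → L2 d} (hz : HasWeakGradient z Z) :
    (∑ i, ∑ k, M i k * ⟪constResGrad M k f, Z i⟫) + ⟪constRes M f, z⟫ = ⟪f, z⟫ := by
  obtain ⟨U, hU, hw⟩ := (isWeakSolution_iff h (constRes M f) f 0).1
    ((isWeakSolution_const_iff hlam h f _ 0).2 (by simp))
  have hUe : U = fun k => constResGrad M k f := by
    funext k
    refine hat_injective (Lp.ext ?_)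
    filter_upwards [(hasWeakGradient_iff _ _).1 hU k,
      (hasWeakGradient_iff _ _).1 (hasWeakGradient_constRes hlam h.quadForm_lower f) k] with ξ h1 h2
    rw [h1, h2]
  have := hw z Z hz
  rw [energy_const, hUe] at this
  simpa using this

/-- `(-div M∇ + 1)⁻¹ ∑ T_i^{jk} ∂³/∂x_j∂x_i∂x_k (-div M∇ + 1)⁻¹`. -/
noncomputable def thirdOrderOp (M : Matrix (Fin d) (Fin d) ℝ) (T : Fin d → Fin d → Fin d → ℝ) :
    L2 d →L[ℝ] L2 d :=
  ∑ k, constResGrad M k ∘L ∑ i, ∑ j, T i j k • constResHess M i j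

theorem thirdOrderOp_apply (T : Fin d → Fin d → Fin d → ℝ) (f : L2 d) :
    thirdOrderOp M T f = ∑ k, constResGrad M k (∑ i, ∑ j, T i j k • constResHess M i j f) := by
  simp [thirdOrderOp]

theorem isThirdOrderCorrector_thirdOrderOp (hlam : 0 < lam)
    (h : IsElliptic volume lam Lam fun _ : E d => M) (T : Fin d → Fin d → Fin d → ℝ) :
    IsThirdOrderCorrector M T (constRes M) (thirdOrderOp M T) := fun f w => by
  have hM := h.quadForm_lower
  have e := isWeakSolution_const_iff hlam h 0 w
    fun k => -∑ i, ∑ j, T i j k • constResHess M i j f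
  simp only [map_zero, map_neg, Finset.sum_neg_distrib, zero_sub, neg_neg] at e
  rw [thirdOrderOp_apply, ← e]
  -- Two integrations by parts put two of the three derivatives on `(A₀ + 1)⁻¹f`.
  have hF : ∀ φ, IsTest φ → thirdOrder T (constRes M f) φ = (∫ x, (0 : L2 d) x * φ x) +
      ∑ k, ∫ x, (-∑ i, ∑ j, T i j k • constResHess M i j f : L2 d) x * pd k φ x := by
    intro φ hφ
    have e0 : ∫ x, (0 : L2 d) x * φ x = 0 := by
      rw [← inner_toLp _ hφ.memLp, inner_zero_left]
    have e1 : ∀ i j k, ∫ x, constRes M f x * (T i j k * pd j (pd i (pd k φ)) x) =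
        T i j k * ∫ x, constResHess M i j f x * pd k φ x := fun i j k => by
      have h1 := hasWeakGradient_constRes hlam hM f j _ ((hφ.pd k).pd i)
      have h2 := hasWeakGradient_constResGrad hlam hM j f i _ (hφ.pd k)
      rw [h2, neg_neg] at h1
      rw [← h1, ← integral_const_mul]
      refine integral_congr_ae (Eventually.of_forall fun x => ?_)
      ring
    have e2 : ∀ k, ∫ x, (-∑ i, ∑ j, T i j k • constResHess M i j f : L2 d) x * pd k φ x =
        -∑ i, ∑ j, T i j k * ∫ x, constResHess M i j f x * pd k φ x := fun k => by
      rw [← inner_toLp _ (hφ.pd k).memLp]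
      simp only [inner_neg_left, sum_inner, real_inner_smul_left, inner_toLp]
    rw [e0, zero_add]
    simp only [e2]
    have hi : ∀ i j k, Integrable (fun x => constRes M f x * (T i j k * pd j (pd i (pd k φ)) x)) :=
      fun i j k => integrable_L2_mul (Lp.memLp _) ((((hφ.pd k).pd i).pd j).memLp.const_mul _)
    have e3 : thirdOrder T (constRes M f) φ =
        -∑ i, ∑ j, ∑ k, ∫ x, constRes M f x * (T i j k * pd j (pd i (pd k φ)) x) := by
      simp only [thirdOrder, Finset.mul_sum]
      rw [integral_finsetSum _ fun i _ => integrable_finsetSum _ fun j _ =>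
        integrable_finsetSum _ fun k _ => hi i j k]
      congr 1
      refine Finset.sum_congr rfl fun i _ => ?_
      rw [integral_finsetSum _ fun j _ => integrable_finsetSum _ fun k _ => hi i j k]
      refine Finset.sum_congr rfl fun j _ => ?_
      rw [integral_finsetSum _ fun k _ => hi i j k]
    rw [e3, Finset.sum_neg_distrib]
    simp only [e1]
    congr 1
    conv_rhs => rw [Finset.sum_comm]
    refine Finset.sum_congr rfl fun i _ => ?_
    rw [Finset.sum_comm]
  constructor
  · rintro ⟨U, hU, hw⟩
    exact ⟨U, hU, fun φ hφ => by rw [hw φ hφ, hF φ hφ]⟩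
  · rintro ⟨U, hU, hw⟩
    exact ⟨U, hU, fun φ hφ => by rw [hw φ hφ, hF φ hφ]⟩

theorem inner_thirdOrderOp (hlam : 0 < lam) (hM : ∀ ξ : E d, lam * ‖ξ‖ ^ 2 ≤ quadForm M ξ)
    (T : Fin d → Fin d → Fin d → ℝ) (f g : L2 d) :
    ⟪thirdOrderOp M T f, g⟫ =
      ∑ i, ∑ j, ∑ k, T i j k * ⟪constResGrad M k f, constResHess M i j g⟫ := by
  simp only [thirdOrderOp_apply, sum_inner, inner_constResGrad hlam hM, real_inner_smul_left]
  simp only [inner_constResHess_constResGrad hlam hM, ← Finset.sum_neg_distrib]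
  rw [Finset.sum_comm]
  refine Finset.sum_congr rfl fun i _ => ?_
  rw [Finset.sum_comm]
  refine Finset.sum_congr rfl fun j _ => Finset.sum_congr rfl fun k _ => ?_
  rw [inner_constResGrad_constResHess_swap hlam hM i k j, constResHess_comm hlam hM j k,
    inner_constResGrad_constResHess_swap hlam hM k j i, mul_neg, neg_neg,
    inner_constResGrad hlam hM k f]

theorem norm_thirdOrderOp_sub_lowPass_le (hlam : 0 < lam)
    (hM : ∀ ξ : E d, lam * ‖ξ‖ ^ 2 ≤ quadForm M ξ) {T : Fin d → Fin d → Fin d → ℝ} {B : ℝ}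
    (hT : ∀ i j k, |T i j k| ≤ B) {ε : ℝ} (hε : 0 < ε) (f : L2 d) :
    ‖thirdOrderOp M T (f - lowPass ε f)‖ ≤ d ^ 3 * B * lam⁻¹ ^ 2 * ε * ‖f‖ := by
  have h0 : thirdOrderOp M T (f - lowPass ε f) = ∑ k, ∑ i, ∑ j,
      T i j k • constResHess M i j (constResGrad M k (f - lowPass ε f)) := by
    rw [thirdOrderOp_apply]
    simp only [map_sum, map_smul]
    refine Finset.sum_congr rfl fun k _ => Finset.sum_congr rfl fun i _ =>
      Finset.sum_congr rfl fun j _ => ?_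
    rw [(isMultiplier_constResGrad hlam hM k).comm (isMultiplier_constResHess hlam hM i j)]
  rw [h0]
  have h1 : ∀ i j k, ‖T i j k • constResHess M i j (constResGrad M k (f - lowPass ε f))‖ ≤
      B * (lam⁻¹ * (ε * lam⁻¹ * ‖f‖)) := fun i j k => by
    rw [norm_smul, Real.norm_eq_abs]
    have hB : 0 ≤ B := (abs_nonneg _).trans (hT i j k)
    gcongr
    · exact hT i j k
    · refine (norm_constResHess_le hlam hM i j _).trans ?_
      gcongr
      exact norm_constResGrad_sub_lowPass_le hlam hM hε k f
  refine (norm_sum_le_of_le _ fun k _ => norm_sum_le_of_le _ fun i _ => norm_sum_le_of_le _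
    fun j _ => h1 i j k).trans (le_of_eq ?_)
  simp only [Finset.sum_const, Finset.card_univ, Fintype.card_fin, nsmul_eq_mul]
  ring

end ConstantCoefficients

end Homogenization

/-! ### Steklov averages -/

namespace Homogenization

open scoped Real RealInnerProductSpace ENNReal
open Filter

variable {d : ℕ}

attribute [local instance] isProbabilityMeasure_cell

section Jensen

theorem enorm_sq_integral_le {α : Type*} [MeasurableSpace α] {μ : Measure α}
    [IsProbabilityMeasure μ] {g : α → ℝ} (hg : AEStronglyMeasurable g μ) :
    ‖∫ z, g z ∂μ‖ₑ ^ 2 ≤ ∫⁻ z, ‖g z‖ₑ ^ 2 ∂μ := by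
  have h1 : ‖∫ z, g z ∂μ‖ₑ ≤ eLpNorm g 2 μ := by
    refine (enorm_integral_le_lintegral_enorm g).trans ?_
    rw [← eLpNorm_one_eq_lintegral_enorm]
    exact eLpNorm_le_eLpNorm_of_exponent_le (by norm_num) hg
  calc ‖∫ z, g z ∂μ‖ₑ ^ 2 ≤ eLpNorm g 2 μ ^ 2 := by gcongr
    _ = _ := by
      rw [eLpNorm_eq_lintegral_rpow_enorm_toReal (by norm_num) (by norm_num), ENNReal.toReal_ofNat,
        ← ENNReal.rpow_natCast, ← ENNReal.rpow_mul]
      norm_num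

theorem lintegral_enorm_sq_integral_le {F : E d → E d → ℝ} (hF : Measurable (Function.uncurry F))
    {w : E d → ℝ≥0∞} (hw : Measurable w) :
    ∫⁻ x, w x * ‖∫ z in cell d, F x z‖ₑ ^ 2 ≤
      ∫⁻ z in cell d, ∫⁻ x, w x * ‖F x z‖ₑ ^ 2 := by
  have hm : Measurable (Function.uncurry fun x z => w x * ‖F x z‖ₑ ^ 2) :=
    (hw.comp measurable_fst).mul (hF.enorm.pow_const 2)
  rw [← lintegral_lintegral_swap hm.aemeasurable]
  refine lintegral_mono fun x => ?_
  have hFx : Measurable fun z => F x z := hF.comp measurable_prodMk_left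
  rw [lintegral_const_mul _ (hFx.enorm.pow_const 2)]
  gcongr
  exact enorm_sq_integral_le hFx.aestronglyMeasurable

end Jensen

section Averages

variable {ε : ℝ}

/-- Averaging over translations decouples a periodic weight from a function on `ℝ^d`. -/
theorem lintegral_shift_mul (hε : 0 < ε) {w g : E d → ℝ≥0∞} (hwp : IsPeriodic w)
    (hw : Measurable w) (hg : Measurable g) :
    ∫⁻ z in cell d, ∫⁻ x, w (ε⁻¹ • x) * g (x - ε • z) = (∫⁻ y in cell d, w y) * ∫⁻ x, g x := by
  have h1 : ∀ z : E d, ∫⁻ x, w (ε⁻¹ • x) * g (x - ε • z) =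
      ∫⁻ x, w (z + ε⁻¹ • x) * g x := fun z => by
    rw [← lintegral_add_right_eq_self _ (ε • z)]
    refine lintegral_congr fun x => ?_
    rw [add_sub_cancel_right, smul_add, inv_smul_smul₀ hε.ne', add_comm z]
  simp only [h1]
  have hm : Measurable (Function.uncurry fun z x : E d => w (z + ε⁻¹ • x) * g x) := by
    have : Measurable fun p : E d × E d => p.1 + ε⁻¹ • p.2 := by fun_prop
    exact (hw.comp this).mul (hg.comp measurable_snd)
  rw [lintegral_lintegral_swap hm.aemeasurable, ← lintegral_const_mul _ hg]
  refine lintegral_congr fun x => ?_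
  rw [lintegral_mul_const _ (by fun_prop), lintegral_cell_shift hwp hw]

/-- The Steklov average does not depend on the representative of a class in `L²`. -/
theorem ae_ae_shift (hε : 0 < ε) {φ ψ : E d → ℝ} (hφ : Measurable φ) (hψ : Measurable ψ)
    (h : φ =ᵐ[volume] ψ) :
    ∀ᵐ x : E d, ∀ᵐ z ∂volume.restrict (cell d), φ (x - ε • z) = ψ (x - ε • z) := by
  have hg : Measurable fun x => ‖φ x - ψ x‖ₑ := (hφ.sub hψ).enorm
  have h1 := lintegral_shift_mul hε (w := fun _ => 1) (isPeriodic_const 1) measurable_const hg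
  have h2 : ∫⁻ x, ‖φ x - ψ x‖ₑ = 0 := by
    rw [lintegral_eq_zero_iff hg]
    filter_upwards [h] with x hx
    simp [hx]
  have hsub : Measurable fun p : E d × E d => p.2 - ε • p.1 := by fun_prop
  have hm : Measurable (Function.uncurry fun z x : E d => ‖φ (x - ε • z) - ψ (x - ε • z)‖ₑ) :=
    hg.comp hsub
  have hm2 : Measurable fun x : E d => ∫⁻ z in cell d, ‖φ (x - ε • z) - ψ (x - ε • z)‖ₑ :=
    (hm.comp measurable_swap).lintegral_prod_right'
  simp only [one_mul] at h1
  rw [h2, mul_zero, lintegral_lintegral_swap hm.aemeasurable, lintegral_eq_zero_iff hm2] at h1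
  filter_upwards [h1] with x hx
  have hmx : Measurable fun z : E d => ‖φ (x - ε • z) - ψ (x - ε • z)‖ₑ :=
    hm.comp measurable_prodMk_right
  filter_upwards [(lintegral_eq_zero_iff hmx).1 hx] with z hz
  simpa [sub_eq_zero] using hz

theorem measurable_coe (f : L2 d) : Measurable f := (Lp.stronglyMeasurable f).measurable

theorem ae_integrable_shift (hε : 0 < ε) (f : L2 d) :
    ∀ᵐ x : E d, Integrable (fun z => f (x - ε • z)) (volume.restrict (cell d)) := by
  have hg : Measurable fun x => ‖f x‖ₑ ^ 2 := (measurable_coe f).enorm.pow_const 2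
  have h1 := lintegral_shift_mul hε (w := fun _ => 1) (isPeriodic_const 1) measurable_const hg
  have h2 : ∫⁻ x, ‖f x‖ₑ ^ 2 < ⊤ := by
    have := (Lp.memLp f).2
    rw [eLpNorm_lt_top_iff_lintegral_rpow_enorm_lt_top (by norm_num) (by norm_num)] at this
    simpa using this
  have hsub : Measurable fun p : E d × E d => p.2 - ε • p.1 := by fun_prop
  have hm : Measurable (Function.uncurry fun z x : E d => (1 : ℝ≥0∞) * ‖f (x - ε • z)‖ₑ ^ 2) :=
    measurable_const.mul (hg.comp hsub)
  rw [lintegral_lintegral_swap hm.aemeasurable] at h1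
  have h3 : ∫⁻ x, ∫⁻ z in cell d, (1 : ℝ≥0∞) * ‖f (x - ε • z)‖ₑ ^ 2 ≠ ⊤ := by
    rw [h1]
    simpa using h2.ne
  filter_upwards [ae_lt_top (hm.comp measurable_swap).lintegral_prod_right' h3] with x hx
  have hmx : Measurable fun z => f (x - ε • z) := (measurable_coe f).comp (by fun_prop)
  have : MemLp (fun z => f (x - ε • z)) 2 (volume.restrict (cell d)) := by
    refine ⟨hmx.aestronglyMeasurable, ?_⟩
    rw [eLpNorm_lt_top_iff_lintegral_rpow_enorm_lt_top (by norm_num) (by norm_num)]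
    simpa using hx
  exact this.integrable (by norm_num)

theorem steklov_add_ae (hε : 0 < ε) (f g : L2 d) :
    steklov ε (f + g : L2 d) =ᵐ[volume] fun x => steklov ε f x + steklov ε g x := by
  filter_upwards [ae_ae_shift hε (measurable_coe (f + g))
    ((measurable_coe f).add (measurable_coe g)) (Lp.coeFn_add f g), ae_integrable_shift hε f,
    ae_integrable_shift hε g] with x h1 h2 h3
  unfold steklov
  rw [integral_congr_ae h1, ← integral_add h2 h3]
  rfl

theorem steklov_smul_ae (hε : 0 < ε) (c : ℝ) (f : L2 d) :
    steklov ε (c • f : L2 d) =ᵐ[volume] fun x => c * steklov ε f x := by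
  filter_upwards [ae_ae_shift hε (measurable_coe (c • f))
    ((measurable_coe f).const_mul c) (Lp.coeFn_smul c f)] with x h1
  unfold steklov
  rw [integral_congr_ae h1, ← integral_const_mul]

theorem measurable_steklov (f : L2 d) : Measurable (steklov ε f) := by
  have hsub : Measurable fun p : E d × E d => p.1 - ε • p.2 := by fun_prop
  have : StronglyMeasurable (Function.uncurry fun x z : E d => f (x - ε • z)) :=
    ((measurable_coe f).comp hsub).stronglyMeasurable
  exact (this.integral_prod_right (ν := volume.restrict (cell d))).measurable

theorem lintegral_enorm_sq (f : L2 d) : ∫⁻ x, ‖f x‖ₑ ^ 2 = ENNReal.ofReal (‖f‖ ^ 2) := by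
  rw [Lp.norm_def, ENNReal.ofReal_pow ENNReal.toReal_nonneg,
    ENNReal.ofReal_toReal (Lp.memLp f).2.ne, eLpNorm_eq_lintegral_rpow_enorm_toReal (by norm_num)
      (by norm_num), ENNReal.toReal_ofNat, ← ENNReal.rpow_natCast, ← ENNReal.rpow_mul]
  norm_num

theorem lintegral_cell_enorm_sq {b : E d → ℝ} (hb : IsL2Per b) :
    ∫⁻ y in cell d, ‖b y‖ₑ ^ 2 = ENNReal.ofReal (∫ y in cell d, b y ^ 2) := by
  rw [ofReal_integral_eq_lintegral_ofReal hb.2.integrable_sq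
    (Eventually.of_forall fun y => sq_nonneg _)]
  refine lintegral_congr fun y => ?_
  rw [← sq_abs, ENNReal.ofReal_pow (abs_nonneg _), Real.enorm_eq_ofReal_abs]

theorem memLp_two_of_lintegral_le {g : E d → ℝ} (hg : AEStronglyMeasurable g volume) {C : ℝ}
    (h : ∫⁻ x, ‖g x‖ₑ ^ 2 ≤ ENNReal.ofReal C) : MemLp g 2 (volume : Measure (E d)) := by
  refine ⟨hg, ?_⟩
  rw [eLpNorm_lt_top_iff_lintegral_rpow_enorm_lt_top (by norm_num) (by norm_num)]
  simpa using h.trans_lt ENNReal.ofReal_lt_top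

theorem norm_le_of_lintegral_le (f : L2 d) {C : ℝ} (hC : 0 ≤ C)
    (h : ∫⁻ x, ‖f x‖ₑ ^ 2 ≤ ENNReal.ofReal (C ^ 2)) : ‖f‖ ≤ C := by
  rw [lintegral_enorm_sq, ENNReal.ofReal_le_ofReal_iff (sq_nonneg _)] at h
  exact (sq_le_sq₀ (norm_nonneg _) hC).1 h

theorem IsL2Per.congr_measurable {b b' : E d → ℝ} (hb : IsL2Per b) (hp : IsPeriodic b')
    (h : b =ᵐ[volume.restrict (cell d)] b') : IsL2Per b' :=
  ⟨hp, (memLp_congr_ae h).1 hb.2⟩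

theorem lintegral_mul_steklov_le (hε : 0 < ε) {b : E d → ℝ} (hb : IsL2Per b) (hm : Measurable b)
    (f : L2 d) :
    ∫⁻ x, ‖b (ε⁻¹ • x) * steklov ε f x‖ₑ ^ 2 ≤
      ENNReal.ofReal ((∫ y in cell d, b y ^ 2) * ‖f‖ ^ 2) := by
  have hsub : Measurable fun p : E d × E d => p.1 - ε • p.2 := by fun_prop
  have hw : Measurable fun y => ‖b y‖ₑ ^ 2 := hm.enorm.pow_const 2
  simp only [enorm_mul, mul_pow]
  refine (lintegral_enorm_sq_integral_le (F := fun x z => f (x - ε • z))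
    ((measurable_coe f).comp hsub) (w := fun x => ‖b (ε⁻¹ • x)‖ₑ ^ 2)
    (hw.comp (measurable_const_smul _))).trans_eq ?_
  rw [lintegral_shift_mul hε (w := fun y => ‖b y‖ₑ ^ 2) (g := fun x => ‖f x‖ₑ ^ 2)
    (hb.1.comp fun t => ‖t‖ₑ ^ 2) hw ((measurable_coe f).enorm.pow_const 2),
    lintegral_cell_enorm_sq hb, lintegral_enorm_sq,
    ← ENNReal.ofReal_mul (integral_nonneg fun y => sq_nonneg _)]

/-- `φ ↦ b(·/ε) S^εφ` is bounded in `L²(ℝ^d)`. -/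
theorem exists_mul_steklov (hε : 0 < ε) {b : E d → ℝ} (hb : IsL2Per b) {B : ℝ} (hB : 0 ≤ B)
    (h : ∫ y in cell d, b y ^ 2 ≤ B ^ 2) : ∃ K : L2 d →L[ℝ] L2 d,
      (∀ f, K f =ᵐ[volume] fun x => b (ε⁻¹ • x) * steklov ε f x) ∧ ∀ f, ‖K f‖ ≤ B * ‖f‖ := by
  obtain ⟨b', hp, hm, hae, hcell⟩ := exists_measurable_periodic hb.1 hb.2.1
  have hb' := hb.congr_measurable hp hcell
  have h' : ∫ y in cell d, b' y ^ 2 ≤ B ^ 2 := by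
    refine le_of_eq_of_le (integral_congr_ae ?_) h
    filter_upwards [hcell] with y hy
    rw [hy]
  have hle : ∀ f : L2 d, ∫⁻ x, ‖b' (ε⁻¹ • x) * steklov ε f x‖ₑ ^ 2 ≤
      ENNReal.ofReal ((B * ‖f‖) ^ 2) := fun f =>
    (lintegral_mul_steklov_le hε hb' hm f).trans (ENNReal.ofReal_le_ofReal (by
      rw [mul_pow]
      gcongr))
  have hmem : ∀ f : L2 d, MemLp (fun x => b' (ε⁻¹ • x) * steklov ε f x) 2 volume := fun f =>
    memLp_two_of_lintegral_le ((hm.comp (measurable_const_smul _)).mul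
      (measurable_steklov f)).aestronglyMeasurable (hle f)
  let K₀ : L2 d →ₗ[ℝ] L2 d :=
    { toFun := fun f => (hmem f).toLp _
      map_add' := fun f g => by
        ext1
        filter_upwards [(hmem (f + g)).coeFn_toLp, (hmem f).coeFn_toLp, (hmem g).coeFn_toLp,
          Lp.coeFn_add ((hmem f).toLp _) ((hmem g).toLp _), steklov_add_ae hε f g]
          with x h1 h2 h3 h4 h5
        rw [h1, h4, Pi.add_apply, h2, h3, h5, mul_add]
      map_smul' := fun c f => by
        ext1
        filter_upwards [(hmem (c • f)).coeFn_toLp, (hmem f).coeFn_toLp,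
          Lp.coeFn_smul c ((hmem f).toLp _), steklov_smul_ae hε c f] with x h1 h2 h3 h4
        rw [h1, RingHom.id_apply, h3, Pi.smul_apply, h2, h4, smul_eq_mul]
        ring }
  have hK : ∀ f, ‖K₀ f‖ ≤ B * ‖f‖ := fun f => by
    refine norm_le_of_lintegral_le _ (by positivity) (le_of_eq_of_le ?_ (hle f))
    refine lintegral_congr_ae ?_
    filter_upwards [(hmem f).coeFn_toLp] with x hx
    change ‖((hmem f).toLp _ : L2 d) x‖ₑ ^ 2 = _
    rw [hx]
  refine ⟨K₀.mkContinuous B hK, fun f => ?_, hK⟩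
  filter_upwards [(hmem f).coeFn_toLp, ae_rescale (P := fun y => b y = b' y) hε hae] with x h1 h2
  change ((hmem f).toLp _ : L2 d) x = _
  rw [h1, h2]

end Averages

section Translations

theorem exists_translation (v : E d) (f : L2 d) : ∃ g : L2 d, g =ᵐ[volume] (fun x => f (x - v)) ∧
    ∀ᵐ ξ, hat g ξ = expi (-⟪v, ξ⟫) * hat f ξ := by
  have hτ : MeasurePreserving (fun x : E d => x - v) volume volume :=
    measurePreserving_sub_right _ v
  let g : L2 d := Lp.compMeasurePreserving _ hτ f
  have hg : g =ᵐ[volume] fun x => f (x - v) := Lp.coeFn_compMeasurePreserving f hτ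
  refine ⟨g, hg, ?_⟩
  rw [hat_apply, hat_apply]
  refine fourier_translation v (complexify d f) (complexify d g) ?_
  filter_upwards [complexify_ae g, hg,
    hτ.quasiMeasurePreserving.ae (complexify_ae f)] with x h1 h2 h3
  rw [h1, h2, h3]

theorem norm_expi_sub_one_le (t : ℝ) : ‖expi t - 1‖ ≤ 2 * π * |t| := by
  have h := Real.norm_exp_I_mul_ofReal_sub_one_le (x := 2 * π * t)
  rw [mul_comm Complex.I] at h
  refine h.trans_eq ?_
  rw [Real.norm_eq_abs, abs_mul, abs_of_pos (by positivity)]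

/-- A translation by `v` moves a band-limited `H¹` function by at most `|v| ‖∇ψ‖`, and the
difference is again band-limited. -/
theorem exists_translation_sub {ε : ℝ} {ψ : L2 d} {Ψ : Fin d → L2 d} (hψ : HasWeakGradient ψ Ψ)
    (hb : BandLimited ε ψ) (v : E d) : ∃ η : L2 d, η =ᵐ[volume] (fun x => ψ (x - v) - ψ x) ∧
      BandLimited ε η ∧ ‖η‖ ^ 2 ≤ ‖v‖ ^ 2 * ∑ i, ‖Ψ i‖ ^ 2 := by
  obtain ⟨g, hg, hgh⟩ := exists_translation v ψ
  have hη : ∀ᵐ ξ, hat (g - ψ) ξ = (expi (-⟪v, ξ⟫) - 1) * hat ψ ξ := by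
    filter_upwards [hat_sub_ae g ψ, hgh] with ξ h1 h2
    rw [h1, h2]
    ring
  refine ⟨g - ψ, ?_, ?_, ?_⟩
  · filter_upwards [Lp.coeFn_sub g ψ, hg] with x h1 h2
    rw [h1, Pi.sub_apply, h2]
  · refine hat_injective (Lp.ext ?_)
    filter_upwards [isMultiplier_lowPass ε (g - ψ), hη, hb.hat_eq] with ξ h1 h2 h3
    rw [h1, h2, mul_left_comm, ← h3]
  · simp only [norm_sq_eq_integral_hat]
    rw [← integral_finsetSum _ fun i _ => integrable_norm_hat_sq _, ← integral_const_mul]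
    refine integral_mono_ae (integrable_norm_hat_sq _)
      ((integrable_finsetSum _ fun i _ => integrable_norm_hat_sq _).const_mul _) ?_
    filter_upwards [hη, ae_all_iff.2 ((hasWeakGradient_iff ψ Ψ).1 hψ)] with ξ h1 h2
    simp only [h1, h2, norm_mul, mul_pow]
    rw [← Finset.sum_mul, ← mul_assoc, sum_norm_dsym_sq]
    gcongr
    calc ‖expi (-⟪v, ξ⟫) - 1‖ ^ 2 ≤ (2 * π * (‖v‖ * ‖ξ‖)) ^ 2 := by
          gcongr
          refine (norm_expi_sub_one_le _).trans ?_
          rw [abs_neg]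
          gcongr
          exact abs_real_inner_le_norm v ξ
      _ = _ := by ring

end Translations

section Comparison

variable {ε : ℝ}

theorem lintegral_mul_translation_sub_le (hε : 0 < ε) {b : E d → ℝ} (hb : IsL2Per b) {ψ : L2 d}
    {Ψ : Fin d → L2 d} (hψ : HasWeakGradient ψ Ψ) (hbl : BandLimited ε ψ) (v : E d) :
    ∫⁻ x, ‖b (ε⁻¹ • x)‖ₑ ^ 2 * ‖ψ (x - v) - ψ x‖ₑ ^ 2 ≤
      ENNReal.ofReal ((∫ y in cell d, b y ^ 2) * (‖v‖ ^ 2 * ∑ i, ‖Ψ i‖ ^ 2)) := by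
  obtain ⟨η, hη1, hη2, hη3⟩ := exists_translation_sub hψ hbl v
  have e2 : ∫⁻ x, ‖b (ε⁻¹ • x)‖ₑ ^ 2 * ‖ψ (x - v) - ψ x‖ₑ ^ 2 =
      ∫⁻ x, ENNReal.ofReal ((b (ε⁻¹ • x) * η x) ^ 2) := by
    refine lintegral_congr_ae ?_
    filter_upwards [hη1] with x hx
    rw [← hx, ← mul_pow, ← enorm_mul, Real.enorm_eq_ofReal_abs,
      ← ENNReal.ofReal_pow (abs_nonneg _), sq_abs]
  have h0 : 0 ≤ ∫ y in cell d, b y ^ 2 := integral_nonneg fun y => sq_nonneg _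
  rw [e2, hη2.lintegral hε hb, ← ENNReal.ofReal_mul h0]
  refine ENNReal.ofReal_le_ofReal ?_
  have e3 : ∫ x, η x ^ 2 = ‖η‖ ^ 2 := by
    rw [← real_inner_self_eq_norm_sq, inner_eq_integral_mul]
    simp only [pow_two]
  rw [e3]
  gcongr

theorem lintegral_mul_steklov_sub_le (hε : 0 < ε) {b : E d → ℝ} (hb : IsL2Per b)
    (hm : Measurable b) {ψ : L2 d} {Ψ : Fin d → L2 d} (hψ : HasWeakGradient ψ Ψ)
    (hbl : BandLimited ε ψ) :
    ∫⁻ x, ‖b (ε⁻¹ • x) * (steklov ε ψ x - ψ x)‖ₑ ^ 2 ≤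
      ENNReal.ofReal ((∫ y in cell d, b y ^ 2) * ((ε * √d) ^ 2 * ∑ i, ‖Ψ i‖ ^ 2)) := by
  have h0 : 0 ≤ ∫ y in cell d, b y ^ 2 := integral_nonneg fun y => sq_nonneg _
  have hsub : Measurable fun p : E d × E d => p.1 - ε • p.2 := by fun_prop
  have hF : Measurable (Function.uncurry fun x z : E d => ψ (x - ε • z) - ψ x) :=
    ((measurable_coe ψ).comp hsub).sub ((measurable_coe ψ).comp measurable_fst)
  have e1 : ∫⁻ x, ‖b (ε⁻¹ • x) * (steklov ε ψ x - ψ x)‖ₑ ^ 2 =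
      ∫⁻ x, ‖b (ε⁻¹ • x)‖ₑ ^ 2 * ‖∫ z in cell d, (ψ (x - ε • z) - ψ x)‖ₑ ^ 2 := by
    refine lintegral_congr_ae ?_
    filter_upwards [ae_integrable_shift hε ψ] with x h6
    have e2 : ∫ z in cell d, (ψ (x - ε • z) - ψ x) = steklov ε ψ x - ψ x := by
      rw [integral_sub h6 (integrable_const _), integral_const, steklov]
      simp
    rw [← mul_pow, ← enorm_mul, e2]
  rw [e1]
  refine (lintegral_enorm_sq_integral_le hF (w := fun x => ‖b (ε⁻¹ • x)‖ₑ ^ 2)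
    ((hm.comp (measurable_const_smul _)).enorm.pow_const 2)).trans ?_
  refine (setLIntegral_mono' measurableSet_cell (g := fun _ => ENNReal.ofReal
    ((∫ y in cell d, b y ^ 2) * ((ε * √d) ^ 2 * ∑ i, ‖Ψ i‖ ^ 2))) fun z hz => ?_).trans_eq ?_
  · refine (lintegral_mul_translation_sub_le hε hb hψ hbl (ε • z)).trans
      (ENNReal.ofReal_le_ofReal ?_)
    have hzn : ‖z‖ ≤ √d := mem_closedBall_zero_iff.1 (cell_subset_closedBall hz)
    rw [norm_smul, Real.norm_of_nonneg hε.le]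
    gcongr
  · rw [lintegral_const, measure_univ, mul_one]

/-- In the corrector, Steklov averaging may be replaced by the cutoff `lowPass ε`, up to an error
of order `ε`. -/
theorem norm_mul_steklov_sub_osc_le (hε : 0 < ε) {b : E d → ℝ} (hb : IsL2Per b) {B : ℝ}
    (hB : 0 ≤ B) (h : ∫ y in cell d, b y ^ 2 ≤ B ^ 2) {K : L2 d →L[ℝ] L2 d}
    (hK : ∀ f, K f =ᵐ[volume] fun x => b (ε⁻¹ • x) * steklov ε f x)
    (hKB : ∀ f, ‖K f‖ ≤ B * ‖f‖) {φ : L2 d} {Φ : Fin d → L2 d} (hφ : HasWeakGradient φ Φ) :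
    ‖K φ - osc ε b φ‖ ≤ B * (1 + √d) * ε * √(∑ i, ‖Φ i‖ ^ 2) := by
  have hG0 : 0 ≤ ∑ i, ‖Φ i‖ ^ 2 := Finset.sum_nonneg fun i _ => sq_nonneg _
  obtain ⟨b', hp, hm, hae, hcell⟩ := exists_measurable_periodic hb.1 hb.2.1
  have hb' := hb.congr_measurable hp hcell
  have h' : ∫ y in cell d, b' y ^ 2 ≤ B ^ 2 := by
    refine le_of_eq_of_le (integral_congr_ae ?_) h
    filter_upwards [hcell] with y hy
    rw [hy]
  have h1 : ‖K (φ - lowPass ε φ)‖ ≤ B * (ε * √(∑ i, ‖Φ i‖ ^ 2)) := by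
    refine (hKB _).trans ?_
    gcongr
    refine (sq_le_sq₀ (norm_nonneg _) (by positivity)).1 ?_
    rw [mul_pow, Real.sq_sqrt hG0]
    exact norm_sub_lowPass_sq_le hε hφ
  have h2 : ‖K (lowPass ε φ) - osc ε b φ‖ ≤ B * (ε * √d * √(∑ i, ‖Φ i‖ ^ 2)) := by
    refine norm_le_of_lintegral_le _ (by positivity) ?_
    have e1 : ∫⁻ x, ‖(K (lowPass ε φ) - osc ε b φ : L2 d) x‖ₑ ^ 2 =
        ∫⁻ x, ‖b' (ε⁻¹ • x) * (steklov ε (lowPass ε φ) x - lowPass ε φ x)‖ₑ ^ 2 := by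
      refine lintegral_congr_ae ?_
      filter_upwards [hK (lowPass ε φ), osc_ae hε hb φ,
        Lp.coeFn_sub (K (lowPass ε φ)) (osc ε b φ),
        ae_rescale (P := fun y => b y = b' y) hε hae] with x h3 h4 h5 h7
      rw [h5, Pi.sub_apply, h3, h4, h7, mul_sub]
    rw [e1]
    refine (lintegral_mul_steklov_sub_le hε hb' hm (hφ.lowPass ε) (bandLimited_lowPass ε φ)).trans
      (ENNReal.ofReal_le_ofReal ?_)
    rw [mul_pow B, mul_pow (ε * √d) (√(∑ i, ‖Φ i‖ ^ 2)), Real.sq_sqrt hG0]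
    gcongr with i
    exact norm_lowPass_le ε (Φ i)
  calc ‖K φ - osc ε b φ‖ = ‖K (φ - lowPass ε φ) + (K (lowPass ε φ) - osc ε b φ)‖ := by
        rw [map_sub]
        congr 1
        abel
    _ ≤ B * (ε * √(∑ i, ‖Φ i‖ ^ 2)) + B * (ε * √d * √(∑ i, ‖Φ i‖ ^ 2)) :=
        (norm_add_le _ _).trans (add_le_add h1 h2)
    _ = _ := by ring

end Comparison

end Homogenization

/-! ### First-order approximation -/

namespace Homogenization

open scoped RealInnerProductSpace
open Filter

variable {d : ℕ}

attribute [local instance] isProbabilityMeasure_cell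

section Approximation

/-- The first corrector with the cutoff `lowPass ε` in place of Steklov averaging. -/
noncomputable def cutCorrector (ε : ℝ) (M : Matrix (Fin d) (Fin d) ℝ) (N : Fin d → E d → ℝ) :
    L2 d →L[ℝ] L2 d :=
  ∑ k, osc ε (N k) ∘L constResGrad M k

/-- The leading part `(e^k + ∇N^k)(·/ε) Π∂_k u` of the gradient of the first approximation. -/
noncomputable def leadGrad (ε : ℝ) (M : Matrix (Fin d) (Fin d) ℝ)
    (DN : Fin d → Fin d → E d → ℝ) (f : L2 d) (i : Fin d) : L2 d :=
  ∑ k, osc ε (cellGrad DN k i) (constResGrad M k f)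

/-- The part `N^k(·/ε) Π∂_i∂_k u` of the gradient of the first approximation. -/
noncomputable def restGrad (ε : ℝ) (M : Matrix (Fin d) (Fin d) ℝ) (N : Fin d → E d → ℝ)
    (f : L2 d) (i : Fin d) : L2 d :=
  ∑ k, osc ε (N k) (constResHess M i k f)

/-- The first approximation `Πu + εN(·/ε) · Π∇u` to `(A_ε + 1)⁻¹f`, where `u` is the homogenized
solution. -/
noncomputable def firstApprox (ε : ℝ) (M : Matrix (Fin d) (Fin d) ℝ) (N : Fin d → E d → ℝ)
    (f : L2 d) : L2 d :=
  lowPass ε (constRes M f) + ε • cutCorrector ε M N f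

variable {lam ε : ℝ} {a : MatrixField d} {N Nt : Fin d → E d → ℝ}
  {DN DNt : Fin d → Fin d → E d → ℝ} {M : Matrix (Fin d) (Fin d) ℝ}

theorem cutCorrector_apply (f : L2 d) :
    cutCorrector ε M N f = ∑ k, osc ε (N k) (constResGrad M k f) := by
  simp [cutCorrector]

/-- In the gradient of the first approximation the factors `ε` and `ε⁻¹` cancel in the leading part. -/
theorem IsCellSolution.hasWeakGradient_firstApprox (hlam : 0 < lam) (hε : 0 < ε)
    (h : IsCellSolution a N DN) (hM : ∀ ξ : E d, lam * ‖ξ‖ ^ 2 ≤ quadForm M ξ) (f : L2 d) :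
    HasWeakGradient (firstApprox ε M N f)
      fun i => leadGrad ε M DN f i + ε • restGrad ε M N f i := by
  have h1 := (hasWeakGradient_constRes hlam hM f).lowPass ε
  have h2 := HasWeakGradient.sum Finset.univ fun k _ =>
    (h.hasPeriodicGradient k).hasWeakGradient_osc hε (hasWeakGradient_constResGrad hlam hM k f)
  have h3 := h1.add (h2.smul ε)
  rw [← cutCorrector_apply] at h3
  refine (congrArg (HasWeakGradient _) (funext fun i => ?_)).mp h3
  have e1 : ∀ k, osc ε (cellGrad DN k i) (constResGrad M k f) =
      (if i = k then (1 : ℝ) else 0) • lowPass ε (constResGrad M k f) +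
        osc ε (DN k i) (constResGrad M k f) := fun k => by
    have := osc_add hε (isL2Per_const (if i = k then (1 : ℝ) else 0)) (h.grad_memL2 k i)
      (constResGrad M k f)
    have e2 := osc_const_mul hε (isL2Per_const (d := d) 1) (if i = k then (1 : ℝ) else 0)
      (constResGrad M k f)
    simp only [mul_one] at e2
    rw [e2, osc_one hε] at this
    exact this
  simp only [leadGrad, restGrad, e1, Finset.sum_add_distrib, smul_add, Finset.smul_sum,
    smul_inv_smul₀ hε.ne', ite_smul, one_smul, zero_smul, Finset.sum_ite_eq, Finset.mem_univ,
    if_true, add_assoc]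

theorem mulOp_rescaled_osc (ha : IsAdmissible lam a) (hε : 0 < ε) {b : E d → ℝ} (hb : IsL2Per b)
    (i k : Fin d) (ψ : L2 d) :
    mulOp volume (fun x => rescaled ε a x i k) (osc ε b ψ) =
      osc ε (fun y => a y i k * b y) ψ := by
  have hell := ha.isElliptic_rescaled hε
  ext1
  filter_upwards [mulOp_ae (hell.measurable i k) (hell.bounded i k) (osc ε b ψ),
    osc_ae hε hb ψ, osc_ae hε (ha.isL2Per_mul hb i k) ψ] with x h1 h2 h3
  rw [h1, h2, h3, rescaled, mul_assoc]

theorem energy_add_smul_left {μ : Measure (E d)} (b : MatrixField d) (c : ℝ)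
    (U V Z : Fin d → Lp ℝ 2 μ) :
    energy μ b (fun i => U i + c • V i) Z = energy μ b U Z + c * energy μ b V Z := by
  simp only [energy, map_add, map_smul, inner_add_left, real_inner_smul_left,
    Finset.sum_add_distrib, Finset.mul_sum]

theorem energy_add_smul_right {μ : Measure (E d)} (b : MatrixField d) (c : ℝ)
    (Z U V : Fin d → Lp ℝ 2 μ) :
    energy μ b Z (fun i => U i + c • V i) = energy μ b Z U + c * energy μ b Z V := by
  simp only [energy, inner_add_right, real_inner_smul_right, Finset.sum_add_distrib,
    Finset.mul_sum]

theorem energy_transposed {Lam : ℝ} {b : MatrixField d} (hb : IsElliptic volume lam Lam b)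
    (U Z : Fin d → L2 d) : energy volume (transposed b) U Z = energy volume b Z U := by
  unfold energy
  rw [Finset.sum_comm]
  refine Finset.sum_congr rfl fun k _ => Finset.sum_congr rfl fun i _ => ?_
  change ⟪mulOp volume (fun y => b y k i) (U k), Z i⟫ = _
  rw [inner_eq_integral_mul, inner_eq_integral_mul]
  refine integral_congr_ae ?_
  filter_upwards [mulOp_ae (hb.measurable k i) (hb.bounded k i) (U k),
    mulOp_ae (hb.measurable k i) (hb.bounded k i) (Z i)] with x h1 h2
  rw [h1, h2]
  ring

theorem IsCellSolution.energy_leadGrad (ha : IsAdmissible lam a) (h : IsCellSolution a N DN)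
    (hε : 0 < ε) (f : L2 d) (Z : Fin d → L2 d) :
    energy volume (rescaled ε a) (leadGrad ε M DN f) Z =
      ∑ i, ∑ k, ⟪osc ε (cellFlux a DN k i) (constResGrad M k f), Z i⟫ := by
  unfold energy
  refine Finset.sum_congr rfl fun i _ => ?_
  rw [← sum_inner, ← sum_inner]
  congr 1
  have e : ∀ k, osc ε (cellFlux a DN k i) (constResGrad M k f) =
      ∑ l, osc ε (fun y => a y i l * cellGrad DN k l y) (constResGrad M k f) := fun k =>
    osc_sum hε Finset.univ (fun l => ha.isL2Per_mul (h.isL2Per_cellGrad k l) i l) _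
  simp only [e, leadGrad, map_sum]
  rw [Finset.sum_comm]
  refine Finset.sum_congr rfl fun k _ => Finset.sum_congr rfl fun l _ => ?_
  exact mulOp_rescaled_osc ha hε (h.isL2Per_cellGrad k l) i l _

section Bounds

variable (hlam : 0 < lam) (ha : IsAdmissible lam a) (h : IsCellSolution a N DN)
  (hM : ∀ ξ : E d, lam * ‖ξ‖ ^ 2 ≤ quadForm M ξ) (hε : 0 < ε)

include hlam ha h hM hε

theorem IsCellSolution.norm_cutCorrector_le (f : L2 d) :
    ‖cutCorrector ε M N f‖ ≤ d * lam⁻¹ ^ 2 * (1 + lam⁻¹) * ‖f‖ := by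
  rw [cutCorrector_apply]
  have h1 : ∀ k, ‖osc ε (N k) (constResGrad M k f)‖ ≤ lam⁻¹ ^ 2 * ((1 + lam⁻¹) * ‖f‖) := fun k => by
    refine (norm_osc_le hε (h.memL2 k) (by positivity)
      (h.integral_corrector_sq_le hlam ha k) _).trans ?_
    gcongr
    exact norm_constResGrad_le hlam hM k f
  refine (norm_sum_le_of_le _ fun k _ => h1 k).trans (le_of_eq ?_)
  simp only [Finset.sum_const, Finset.card_univ, Fintype.card_fin, nsmul_eq_mul]
  ring

theorem IsCellSolution.norm_restGrad_le (f : L2 d) (i : Fin d) :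
    ‖restGrad ε M N f i‖ ≤ d * lam⁻¹ ^ 3 * ‖f‖ := by
  have h1 : ∀ k, ‖osc ε (N k) (constResHess M i k f)‖ ≤ lam⁻¹ ^ 2 * (lam⁻¹ * ‖f‖) := fun k => by
    refine (norm_osc_le hε (h.memL2 k) (by positivity)
      (h.integral_corrector_sq_le hlam ha k) _).trans ?_
    gcongr
    exact norm_constResHess_le hlam hM i k f
  refine (norm_sum_le_of_le _ fun k _ => h1 k).trans (le_of_eq ?_)
  simp only [Finset.sum_const, Finset.card_univ, Fintype.card_fin, nsmul_eq_mul]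
  ring

theorem IsCellSolution.sum_norm_restGrad_le (f : L2 d) :
    ∑ i, ‖restGrad ε M N f i‖ ≤ d ^ 2 * lam⁻¹ ^ 3 * ‖f‖ := by
  refine (Finset.sum_le_sum fun i _ => h.norm_restGrad_le hlam ha hM hε f i).trans (le_of_eq ?_)
  simp only [Finset.sum_const, Finset.card_univ, Fintype.card_fin, nsmul_eq_mul]
  ring

end Bounds

theorem norm_sub_lowPass_le (hε : 0 < ε) {z : L2 d} {Z : Fin d → L2 d}
    (hz : HasWeakGradient z Z) : ‖z - lowPass ε z‖ ≤ ε * ∑ i, ‖Z i‖ := by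
  have h0 : 0 ≤ ∑ i, ‖Z i‖ := Finset.sum_nonneg fun i _ => norm_nonneg _
  refine (sq_le_sq₀ (norm_nonneg _) (by positivity)).1 ((norm_sub_lowPass_sq_le hε hz).trans ?_)
  rw [mul_pow]
  gcongr
  exact Finset.sum_sq_le_sq_sum_of_nonneg fun i _ => norm_nonneg _

/-- The fluctuations of the flux contribute at order `ε` only: being divergence-free they hit the
band-limited factor, and being of mean zero they do not see low frequencies. -/
theorem IsCellSolution.abs_sum_inner_fluxDefect_le (hlam : 0 < lam) (ha : IsAdmissible lam a)
    (h : IsCellSolution a N DN) (hM : ∀ ξ : E d, lam * ‖ξ‖ ^ 2 ≤ quadForm M ξ) (hε : 0 < ε)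
    (f : L2 d) {z : L2 d} {Z : Fin d → L2 d} (hz : HasWeakGradient z Z) :
    |∑ i, ∑ k, ⟪osc ε (fluxDefect a DN k i) (constResGrad M k f), Z i⟫| ≤
      d ^ 2 * lam⁻¹ ^ 4 * ε * ‖f‖ * ∑ i, ‖Z i‖ := by
  have e : ∑ i, ∑ k, ⟪osc ε (fluxDefect a DN k i) (constResGrad M k f), Z i⟫ =
      -∑ k, ∑ i, ⟪osc ε (fluxDefect a DN k i) (constResHess M i k f), z - lowPass ε z⟫ := by
    rw [Finset.sum_comm, ← Finset.sum_neg_distrib]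
    refine Finset.sum_congr rfl fun k _ => ?_
    rw [sum_inner_osc_divFree hε (h.isL2Per_fluxDefect ha k) (h.fluxDefect_divFree ha k)
      (hasWeakGradient_constResGrad hlam hM k f) hz]
    congr 1
    refine Finset.sum_congr rfl fun i _ => ?_
    rw [← inner_osc_eq_sub_lowPass hε (h.isL2Per_fluxDefect ha k i) (h.integral_fluxDefect ha k i)]
  have h1 : ∀ k i, |⟪osc ε (fluxDefect a DN k i) (constResHess M i k f), z - lowPass ε z⟫| ≤
      lam⁻¹ ^ 3 * (lam⁻¹ * ‖f‖) * (ε * ∑ i, ‖Z i‖) := fun k i => by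
    refine (abs_real_inner_le_norm _ _).trans ?_
    gcongr
    · refine (norm_osc_le hε (h.isL2Per_fluxDefect ha k i) (by positivity)
        (h.integral_fluxDefect_sq_le hlam ha k i) _).trans ?_
      gcongr
      exact norm_constResHess_le hlam hM i k f
    · exact norm_sub_lowPass_le hε hz
  rw [e, abs_neg]
  refine ((Finset.abs_sum_le_sum_abs _ _).trans (Finset.sum_le_sum fun k _ =>
    (Finset.abs_sum_le_sum_abs _ _).trans (Finset.sum_le_sum fun i _ => h1 k i))).trans
    (le_of_eq ?_)
  simp only [Finset.sum_const, Finset.card_univ, Fintype.card_fin, nsmul_eq_mul]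
  ring

/-- The constant in the residual estimate for the first approximation. -/
noncomputable def residualConst (d : ℕ) (lam : ℝ) : ℝ :=
  1 + 2 * d ^ 2 * lam⁻¹ ^ 4 + d * lam⁻¹ ^ 2 * (1 + lam⁻¹)

theorem residualConst_nonneg (d : ℕ) (hlam : 0 < lam) : 0 ≤ residualConst d lam := by
  unfold residualConst
  positivity

/-- The first approximation solves the equation for `A_ε + 1` up to a residual of order `ε` in
`H⁻¹(ℝ^d)`: its leading flux is `a⁰∇u` plus the oscillating fluctuations `fluxDefect`. -/
theorem IsCellSolution.abs_residual_le (hlam : 0 < lam) (ha : IsAdmissible lam a)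
    (h : IsCellSolution a N DN) (hε : 0 < ε) (f : L2 d) {z : L2 d} {Z : Fin d → L2 d}
    (hz : HasWeakGradient z Z) :
    |energy volume (rescaled ε a) (fun i => leadGrad ε (homMatrix a DN) DN f i +
        ε • restGrad ε (homMatrix a DN) N f i) Z +
      ⟪firstApprox ε (homMatrix a DN) N f, z⟫ - ⟪f, z⟫| ≤
      residualConst d lam * ε * ‖f‖ * (‖z‖ + ∑ i, ‖Z i‖) := by
  set M := homMatrix a DN with hMdef
  have hMe := h.isElliptic_homMatrix hlam ha
  have hM := hMe.quadForm_lower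
  have hell := ha.isElliptic_rescaled hε
  have hS : 0 ≤ ∑ i, ‖Z i‖ := Finset.sum_nonneg fun i _ => norm_nonneg _
  have e1 : ∀ i k, ⟪osc ε (cellFlux a DN k i) (constResGrad M k f), Z i⟫ =
      M i k * ⟪constResGrad M k (lowPass ε f), Z i⟫ +
        ⟪osc ε (fluxDefect a DN k i) (constResGrad M k f), Z i⟫ := fun i k => by
    have h1 := osc_add hε ((isL2Per_const (d := d) 1).const_mul (M i k))
      (h.isL2Per_fluxDefect ha k i) (constResGrad M k f)
    rw [osc_const_mul hε (isL2Per_const 1), osc_one hε, lowPass_constResGrad hlam hM] at h1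
    have h2 : (fun y => M i k * 1 + fluxDefect a DN k i y) = cellFlux a DN k i := by
      funext y
      rw [fluxDefect, mul_one, add_sub_cancel]
    rw [h2] at h1
    rw [h1, inner_add_left, real_inner_smul_left]
  -- The constant part of the flux is balanced by the homogenized equation.
  have e2 := energy_constResGrad hlam hMe (lowPass ε f) hz
  have e3 : ⟪lowPass ε f, z⟫ = ⟪f, z⟫ - ⟪f, z - lowPass ε z⟫ := by
    rw [inner_sub_right, inner_lowPass]
    ring
  rw [energy_add_smul_left, h.energy_leadGrad ha hε]
  simp only [e1, Finset.sum_add_distrib]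
  rw [firstApprox, inner_add_left, real_inner_smul_left, lowPass_constRes hlam hM]
  have b1 := h.abs_sum_inner_fluxDefect_le hlam ha hM hε f hz
  have b2 : |⟪f, z - lowPass ε z⟫| ≤ ‖f‖ * (ε * ∑ i, ‖Z i‖) :=
    (abs_real_inner_le_norm _ _).trans (by
      gcongr
      exact norm_sub_lowPass_le hε hz)
  have b3 : |energy volume (rescaled ε a) (restGrad ε M N f) Z| ≤
      lam⁻¹ * (d ^ 2 * lam⁻¹ ^ 3 * ‖f‖) * ∑ i, ‖Z i‖ :=
    (hell.energy_le _ _).trans (by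
      gcongr
      exact h.sum_norm_restGrad_le hlam ha hM hε f)
  have b4 : |⟪cutCorrector ε M N f, z⟫| ≤ d * lam⁻¹ ^ 2 * (1 + lam⁻¹) * ‖f‖ * ‖z‖ :=
    (abs_real_inner_le_norm _ _).trans (by
      gcongr
      exact h.norm_cutCorrector_le hlam ha hM hε f)
  have b3' := mul_le_mul_of_nonneg_left b3 hε.le
  have b4' := mul_le_mul_of_nonneg_left b4 hε.le
  rw [← abs_of_pos hε, ← abs_mul, abs_of_pos hε] at b3' b4'
  have b5 : 0 ≤ (1 + 2 * d ^ 2 * lam⁻¹ ^ 4) * ε * ‖f‖ * ‖z‖ := by positivity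
  have b6 : 0 ≤ (d * lam⁻¹ ^ 2 * (1 + lam⁻¹)) * ε * ‖f‖ * ∑ i, ‖Z i‖ := by positivity
  unfold residualConst
  rw [abs_le] at *
  constructor <;> nlinarith

/-- The constant in the `H¹` estimate for the first approximation. -/
noncomputable def firstOrderConst (d : ℕ) (lam : ℝ) : ℝ :=
  (d + 1) * (1 + lam⁻¹) * residualConst d lam

theorem firstOrderConst_nonneg (d : ℕ) (hlam : 0 < lam) : 0 ≤ firstOrderConst d lam := by
  have := residualConst_nonneg d hlam
  unfold firstOrderConst
  positivity

/-- A coercive energy inequality bounds the sum of the norms. `Q` is a sum of squares and `S` the sum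
of the `D` corresponding norms. -/
theorem add_le_of_coercive {D t S Q A : ℝ} (hD : 0 ≤ D) (hlam : 0 < lam) (ht : 0 ≤ t) (hS : 0 ≤ S)
    (hQ : 0 ≤ Q) (hA : 0 ≤ A) (h1 : S ^ 2 ≤ D * Q) (h2 : lam * Q + t ^ 2 ≤ A * (t + S)) :
    t + S ≤ (D + 1) * (1 + lam⁻¹) * A := by
  have h3 : 2 * t * S ≤ D * t ^ 2 + Q := by
    refine (sq_le_sq₀ (by positivity) (by positivity)).1 ?_
    have := mul_le_mul_of_nonneg_left h1 (sq_nonneg t)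
    nlinarith [sq_nonneg (D * t ^ 2 - Q)]
  have h4 : (t + S) ^ 2 ≤ (D + 1) * (t ^ 2 + Q) := by linarith
  have h5 : t ^ 2 + Q ≤ (1 + lam⁻¹) * (lam * Q + t ^ 2) := by
    have e : (1 + lam⁻¹) * (lam * Q + t ^ 2) = lam * Q + t ^ 2 + Q + lam⁻¹ * t ^ 2 := by
      field_simp
      ring
    have : 0 ≤ lam * Q + lam⁻¹ * t ^ 2 := by positivity
    linarith
  have h6 : (t + S) ^ 2 ≤ (D + 1) * (1 + lam⁻¹) * A * (t + S) := by
    calc (t + S) ^ 2 ≤ (D + 1) * ((1 + lam⁻¹) * (A * (t + S))) := h4.trans (by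
          gcongr
          refine h5.trans ?_
          gcongr)
      _ = _ := by ring
  rcases (add_nonneg ht hS).eq_or_lt with h0 | h0
  · rw [← h0]
    positivity
  · rw [pow_two] at h6
    exact le_of_mul_le_mul_right h6 h0

/-- The first approximation is accurate to order `ε` in `H¹(ℝ^d)`. -/
theorem IsCellSolution.first_order (hlam : 0 < lam) (ha : IsAdmissible lam a)
    (h : IsCellSolution a N DN) (hε : 0 < ε) (f : L2 d) {u : L2 d} {U : Fin d → L2 d}
    (hu : HasWeakGradient u U) (hw : ∀ z Z, HasWeakGradient z Z →
      energy volume (rescaled ε a) U Z + ⟪u, z⟫ = ⟪f, z⟫) :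
    ‖u - firstApprox ε (homMatrix a DN) N f‖ +
      ∑ i, ‖U i - (leadGrad ε (homMatrix a DN) DN f i + ε • restGrad ε (homMatrix a DN) N f i)‖ ≤
      firstOrderConst d lam * ε * ‖f‖ := by
  set W : Fin d → L2 d := fun i => leadGrad ε (homMatrix a DN) DN f i +
    ε • restGrad ε (homMatrix a DN) N f i with hW
  set w := firstApprox ε (homMatrix a DN) N f with hwdef
  have hM := (h.isElliptic_homMatrix hlam ha).quadForm_lower
  have hell := ha.isElliptic_rescaled hε
  have hz : HasWeakGradient (u - w) fun i => U i - W i :=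
    hu.sub (h.hasWeakGradient_firstApprox hlam hε hM f)
  have h1 := hw _ _ hz
  have h2 := h.abs_residual_le hlam ha hε f hz
  have h3 := hell.lam_le_energy fun i => U i - W i
  have h4 : energy volume (rescaled ε a) (fun i => U i - W i) (fun i => U i - W i) +
      ⟪u - w, u - w⟫ ≤ residualConst d lam * ε * ‖f‖ * (‖u - w‖ + ∑ i, ‖U i - W i‖) := by
    rw [energy_sub_left, inner_sub_left]
    have := (neg_le_abs _).trans h2
    linarith
  rw [real_inner_self_eq_norm_sq] at h4
  have h5 : (∑ i, ‖U i - W i‖) ^ 2 ≤ d * ∑ i, ‖U i - W i‖ ^ 2 := by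
    have := sq_sum_le_card_mul_sum_sq (s := Finset.univ) (f := fun i => ‖U i - W i‖)
    simpa using this
  have h6 := residualConst_nonneg d hlam
  refine (add_le_of_coercive d.cast_nonneg hlam (norm_nonneg _) (Finset.sum_nonneg fun i _ =>
    norm_nonneg _) (Finset.sum_nonneg fun i _ => sq_nonneg _) (by positivity) h5
    ((add_le_add_left h3 _).trans h4)).trans_eq ?_
  unfold firstOrderConst
  ring

end Approximation

end Homogenization

/-! ### Second-order approximation by duality -/

namespace Homogenization

open scoped RealInnerProductSpace
open Filter

variable {d : ℕ}

attribute [local instance] isProbabilityMeasure_cell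

section SecondOrder

variable {lam ε : ℝ} {a : MatrixField d} {N Nt : Fin d → E d → ℝ}
  {DN DNt : Fin d → Fin d → E d → ℝ} {M : Matrix (Fin d) (Fin d) ℝ}

theorem inner_lowPass_lowPass (f g : L2 d) : ⟪lowPass ε f, lowPass ε g⟫ = ⟪lowPass ε f, g⟫ := by
  rw [← inner_lowPass, lowPass_lowPass]

/-- The energy of the two leading parts is that of the homogenized solutions. -/
theorem IsCellSolution.energy_leadGrad_leadGrad (hlam : 0 < lam) (ha : IsAdmissible lam a)
    (h : IsCellSolution a N DN) (ht : IsCellSolution (transposed a) Nt DNt) (hε : 0 < ε)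
    (f g : L2 d) :
    energy volume (rescaled ε a) (leadGrad ε (homMatrix a DN) DN f)
        (leadGrad ε (homMatrix a DN) DNt g) +
      ⟪lowPass ε (constRes (homMatrix a DN) f), lowPass ε (constRes (homMatrix a DN) g)⟫ =
      ⟪constRes (homMatrix a DN) (lowPass ε f), g⟫ := by
  have hMe := h.isElliptic_homMatrix hlam ha
  have hM := hMe.quadForm_lower
  rw [h.energy_leadGrad ha hε]
  have e1 : ∑ i, ∑ k, ⟪osc ε (cellFlux a DN k i) (constResGrad (homMatrix a DN) k f),
      leadGrad ε (homMatrix a DN) DNt g i⟫ = ∑ j, ∑ k, homMatrix a DN j k *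
        ⟪constResGrad (homMatrix a DN) k (lowPass ε f), constResGrad (homMatrix a DN) j g⟫ := by
    have e2 : ∀ i j k, ⟪osc ε (cellFlux a DN k i) (constResGrad (homMatrix a DN) k f),
        osc ε (cellGrad DNt j i) (constResGrad (homMatrix a DN) j g)⟫ =
        (∫ y in cell d, cellFlux a DN k i y * cellGrad DNt j i y) *
          ⟪constResGrad (homMatrix a DN) k (lowPass ε f), constResGrad (homMatrix a DN) j g⟫ :=
      fun i j k => by
        rw [inner_osc hε (h.isL2Per_cellFlux ha k i) (ht.isL2Per_cellGrad j i),
          inner_lowPass_lowPass, lowPass_constResGrad hlam hM]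
    have e3 : ∀ j k, homMatrix a DN j k =
        ∑ i, ∫ y in cell d, cellFlux a DN k i y * cellGrad DNt j i y := fun j k =>
      h.homMatrix_eq ha ht j k
    simp only [leadGrad, inner_sum, e2]
    simp_rw [e3, Finset.sum_mul]
    rw [Finset.sum_comm]
    refine (Finset.sum_congr rfl fun k _ => Finset.sum_comm).trans ?_
    rw [Finset.sum_comm]
  rw [e1, inner_lowPass_lowPass, lowPass_constRes hlam hM,
    energy_constResGrad hlam hMe (lowPass ε f) (hasWeakGradient_constRes hlam hM g),
    inner_constRes hlam hM]

theorem IsCellSolution.energy_leadGrad_restGrad (hlam : 0 < lam) (ha : IsAdmissible lam a)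
    (h : IsCellSolution a N DN) (hNt : ∀ j, IsL2Per (Nt j)) (hε : 0 < ε)
    (hM : ∀ ξ : E d, lam * ‖ξ‖ ^ 2 ≤ quadForm M ξ) (f g : L2 d) :
    energy volume (rescaled ε a) (leadGrad ε M DN f) (restGrad ε M Nt g) =
      ∑ i, ∑ j, ∑ k, meanTensor Nt a DN i j k *
        ⟪constResGrad M j (lowPass ε f), constResHess M i k g⟫ := by
  rw [h.energy_leadGrad ha hε]
  refine Finset.sum_congr rfl fun i _ => Finset.sum_congr rfl fun j _ => ?_
  rw [restGrad, inner_sum]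
  refine Finset.sum_congr rfl fun k _ => ?_
  rw [inner_osc hε (h.isL2Per_cellFlux ha j i) (hNt k), inner_lowPass_lowPass,
    lowPass_constResGrad hlam hM, meanTensor]
  simp only [mul_comm]

/-- The mixed terms produce the third-order corrector. -/
theorem IsCellSolution.energy_mixed (hlam : 0 < lam) (ha : IsAdmissible lam a)
    (h : IsCellSolution a N DN) (ht : IsCellSolution (transposed a) Nt DNt) (hε : 0 < ε)
    (hM : ∀ ξ : E d, lam * ‖ξ‖ ^ 2 ≤ quadForm M ξ) (f g : L2 d) :
    energy volume (rescaled ε a) (leadGrad ε M DN f) (restGrad ε M Nt g) +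
      energy volume (rescaled ε a) (restGrad ε M N f) (leadGrad ε M DNt g) =
      -⟪thirdOrderOp M (fun i j k => meanTensor N (transposed a) DNt i j k -
        meanTensor Nt a DN i j k) (lowPass ε f), g⟫ := by
  have e1 : energy volume (rescaled ε a) (restGrad ε M N f) (leadGrad ε M DNt g) =
      energy volume (rescaled ε (transposed a)) (leadGrad ε M DNt g) (restGrad ε M N f) :=
    (energy_transposed (ha.isElliptic_rescaled hε) _ _).symm
  rw [e1, h.energy_leadGrad_restGrad hlam ha ht.memL2 hε hM,
    ht.energy_leadGrad_restGrad hlam ha.transposed h.memL2 hε hM, inner_thirdOrderOp hlam hM,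
    ← Finset.sum_add_distrib, ← Finset.sum_neg_distrib]
  refine Finset.sum_congr rfl fun i _ => ?_
  rw [← Finset.sum_add_distrib, ← Finset.sum_neg_distrib]
  refine Finset.sum_congr rfl fun j _ => ?_
  rw [← Finset.sum_add_distrib, ← Finset.sum_neg_distrib]
  refine Finset.sum_congr rfl fun k _ => ?_
  have e2 : ⟪constResGrad M j (lowPass ε f), constResHess M i k g⟫ =
      ⟪constResGrad M k (lowPass ε f), constResHess M i j g⟫ := by
    rw [constResHess_comm hlam hM i k, inner_constResGrad_constResHess_swap hlam hM k i j,
      constResHess_comm hlam hM j i]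
  have e3 : ⟪constResGrad M j (lowPass ε g), constResHess M i k f⟫ =
      -⟪constResGrad M k (lowPass ε f), constResHess M i j g⟫ := by
    rw [← lowPass_constResGrad hlam hM, inner_lowPass, lowPass_constResHess hlam hM,
      real_inner_comm, inner_constResHess_constResGrad hlam hM]
  rw [e2, e3]
  ring

/-- The cross terms vanish: the correctors have mean zero, and `Πu` has low frequencies only. -/
theorem IsCellSolution.inner_firstApprox (h : IsCellSolution a N DN)
    (ht : IsCellSolution (transposed a) Nt DNt) (hε : 0 < ε) (f g : L2 d) :
    ⟪firstApprox ε M N f, firstApprox ε M Nt g⟫ =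
      ⟪lowPass ε (constRes M f), lowPass ε (constRes M g)⟫ +
        ε ^ 2 * ⟪cutCorrector ε M N f, cutCorrector ε M Nt g⟫ := by
  have e1 : ∀ {b : MatrixField d} {N : Fin d → E d → ℝ} {DN : Fin d → Fin d → E d → ℝ},
      IsCellSolution b N DN → ∀ f z : L2 d, ⟪cutCorrector ε M N f, lowPass ε z⟫ = 0 :=
    fun h f z => by
      rw [cutCorrector_apply, sum_inner]
      refine Finset.sum_eq_zero fun k _ => ?_
      rw [inner_osc_lowPass hε (h.memL2 k), h.mean_zero, zero_mul]
  simp only [firstApprox, inner_add_left, inner_add_right, real_inner_smul_left,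
    real_inner_smul_right]
  have e2 : ⟪lowPass ε (constRes M f), cutCorrector ε M Nt g⟫ = 0 := by
    rw [real_inner_comm]
    exact e1 ht g _
  rw [e1 h, e2]
  ring

/-- The constant in the second-order estimate with the cutoff correctors. -/
noncomputable def secondOrderConst (d : ℕ) (lam : ℝ) : ℝ :=
  (1 + lam⁻¹) * firstOrderConst d lam ^ 2 +
    (lam⁻¹ * (d ^ 2 * lam⁻¹ ^ 3) ^ 2 + (d * lam⁻¹ ^ 2 * (1 + lam⁻¹)) ^ 2) +
    lam⁻¹ + d ^ 3 * (2 * (lam⁻¹ ^ 2 * lam⁻¹ ^ 3)) * lam⁻¹ ^ 2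

/-- Duality: the product of the two first-order errors, tested in the energy, gives the resolvent
difference up to order `ε²`. -/
theorem IsCellSolution.second_order (hlam : 0 < lam) (ha : IsAdmissible lam a)
    (h : IsCellSolution a N DN) (ht : IsCellSolution (transposed a) Nt DNt) (hε : 0 < ε)
    (f g : L2 d) {u v : L2 d} {U V : Fin d → L2 d}
    (hu : HasWeakGradient u U) (huw : ∀ z Z, HasWeakGradient z Z →
      energy volume (rescaled ε a) U Z + ⟪u, z⟫ = ⟪f, z⟫)
    (hv : HasWeakGradient v V) (hvw : ∀ z Z, HasWeakGradient z Z →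
      energy volume (rescaled ε (transposed a)) V Z + ⟪v, z⟫ = ⟪g, z⟫) :
    |⟪u, g⟫ - ⟪constRes (homMatrix a DN) f, g⟫ -
      ε * ⟪cutCorrector ε (homMatrix a DN) N f, g⟫ -
      ε * ⟪f, cutCorrector ε (homMatrix a DN) Nt g⟫ -
      ε * ⟪thirdOrderOp (homMatrix a DN) (fun i j k => meanTensor N (transposed a) DNt i j k -
        meanTensor Nt a DN i j k) f, g⟫| ≤ secondOrderConst d lam * ε ^ 2 * ‖f‖ * ‖g‖ := by
  have b1 := h.first_order hlam ha hε f hu huw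
  have b2 := ht.first_order hlam ha.transposed hε g hv hvw
  have hMe := h.isElliptic_homMatrix hlam ha
  have hM := hMe.quadForm_lower
  have hell := ha.isElliptic_rescaled hε
  have hMt : ∀ (N : Fin d → E d → ℝ), cutCorrector ε (homMatrix a DN).transpose N =
      cutCorrector ε (homMatrix a DN) N := fun N => by
    simp only [cutCorrector, constResGrad_transpose]
  have hMf : firstApprox ε (homMatrix a DN).transpose Nt g =
      firstApprox ε (homMatrix a DN) Nt g := by
    rw [firstApprox, hMt, constRes_transpose]
    rfl
  have hMl : leadGrad ε (homMatrix a DN).transpose DNt g = leadGrad ε (homMatrix a DN) DNt g := by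
    funext i
    simp only [leadGrad, constResGrad_transpose]
  have hMr : restGrad ε (homMatrix a DN).transpose Nt g = restGrad ε (homMatrix a DN) Nt g := by
    funext i
    simp only [restGrad, constResHess_transpose]
  rw [h.homMatrix_transposed ha ht, hMf, hMl, hMr] at b2
  have c1 := h.energy_leadGrad_leadGrad hlam ha ht hε f g
  have c2 := h.energy_mixed hlam ha ht hε hM f g
  have c3 := h.inner_firstApprox (M := homMatrix a DN) ht hε f g
  have c4 := h.sum_norm_restGrad_le hlam ha hM hε f
  have c5 := ht.sum_norm_restGrad_le hlam ha.transposed hM hε g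
  have c6 := h.norm_cutCorrector_le hlam ha hM hε f
  have c7 := ht.norm_cutCorrector_le hlam ha.transposed hM hε g
  have c8 := norm_constRes_sub_lowPass_le hlam hM hε f
  have c9 := norm_thirdOrderOp_sub_lowPass_le hlam hM (T := fun i j k =>
    meanTensor N (transposed a) DNt i j k - meanTensor Nt a DN i j k)
    (B := 2 * (lam⁻¹ ^ 2 * lam⁻¹ ^ 3)) (fun i j k => by
      have h1 := ht.abs_meanTensor_le hlam ha.transposed ha h i j k
      have h2 := h.abs_meanTensor_le hlam ha ha.transposed ht i j k
      refine (abs_sub _ _).trans ?_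
      linarith) hε f
  have gw := h.hasWeakGradient_firstApprox hlam hε hM f
  have gwt := ht.hasWeakGradient_firstApprox hlam hε hM g
  generalize homMatrix a DN = M at *
  generalize thirdOrderOp M (fun i j k => meanTensor N (transposed a) DNt i j k -
        meanTensor Nt a DN i j k) = L at *
  set w := firstApprox ε M N f with hw
  set wt := firstApprox ε M Nt g with hwt
  set X := leadGrad ε M DN f with hX
  set Xt := leadGrad ε M DNt g with hXt
  set Y := restGrad ε M N f with hY
  set Yt := restGrad ε M Nt g with hYt
  -- The weak formulations tested with the solutions and with the approximations.
  have d1 := huw _ _ gwt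
  have d2 := hvw _ _ gw
  have d3 := hvw _ _ hu
  have hT : ∀ P Q : Fin d → L2 d, energy volume (rescaled ε (transposed a)) P Q =
      energy volume (rescaled ε a) Q P := fun P Q => energy_transposed hell P Q
  rw [hT] at d2 d3
  rw [real_inner_comm w v, real_inner_comm w g] at d2
  rw [real_inner_comm u v, real_inner_comm u g] at d3
  -- Expanding the product of the errors leaves the energy of the two approximations, which is
  -- known exactly up to `ε²`.
  have d4 : energy volume (rescaled ε a) (fun i => U i - (X i + ε • Y i))
      (fun i => V i - (Xt i + ε • Yt i)) + ⟪u - w, v - wt⟫ = ⟪u, g⟫ - ⟪f, wt⟫ - ⟪w, g⟫ +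
        (⟪constRes M (lowPass ε f), g⟫ - ε * ⟪L (lowPass ε f), g⟫ +
          ε ^ 2 * (energy volume (rescaled ε a) Y Yt +
            ⟪cutCorrector ε M N f, cutCorrector ε M Nt g⟫)) := by
    rw [energy_sub_left, energy_sub_right, energy_sub_right, inner_sub_left, inner_sub_right,
      inner_sub_right, c3]
    have e : energy volume (rescaled ε a) (fun i => X i + ε • Y i) (fun i => Xt i + ε • Yt i) =
        energy volume (rescaled ε a) X Xt + ε * (energy volume (rescaled ε a) X Yt +
          energy volume (rescaled ε a) Y Xt) + ε ^ 2 * energy volume (rescaled ε a) Y Yt := by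
      rw [energy_add_smul_left, energy_add_smul_right, energy_add_smul_right]
      ring
    rw [e, c2]
    linarith
  have d5 : ⟪f, wt⟫ = ⟪constRes M (lowPass ε f), g⟫ + ε * ⟪f, cutCorrector ε M Nt g⟫ := by
    rw [hwt, firstApprox, inner_add_right, real_inner_smul_right, ← inner_lowPass,
      ← inner_constRes hlam hM]
  have d6 : ⟪w, g⟫ = ⟪constRes M (lowPass ε f), g⟫ + ε * ⟪cutCorrector ε M N f, g⟫ := by
    rw [hw, firstApprox, inner_add_left, real_inner_smul_left, lowPass_constRes hlam hM]
  have d7 : ⟪constRes M (f - lowPass ε f), g⟫ =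
      ⟪constRes M f, g⟫ - ⟪constRes M (lowPass ε f), g⟫ := by
    rw [map_sub, inner_sub_left]
  have d8 : ⟪L (f - lowPass ε f), g⟫ = ⟪L f, g⟫ - ⟪L (lowPass ε f), g⟫ := by
    rw [map_sub, inner_sub_left]
  set Er := energy volume (rescaled ε a) (fun i => U i - (X i + ε • Y i))
      (fun i => V i - (Xt i + ε • Yt i)) + ⟪u - w, v - wt⟫ with hEr
  have d9 : ⟪u, g⟫ - ⟪constRes M f, g⟫ - ε * ⟪cutCorrector ε M N f, g⟫ -
      ε * ⟪f, cutCorrector ε M Nt g⟫ - ε * ⟪L f, g⟫ =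
      Er - ε ^ 2 * (energy volume (rescaled ε a) Y Yt +
        ⟪cutCorrector ε M N f, cutCorrector ε M Nt g⟫) -
      ⟪constRes M (f - lowPass ε f), g⟫ - ε * ⟪L (f - lowPass ε f), g⟫ := by
    rw [d4, d5, d6, d7, d8]
    ring
  -- The four error terms.
  have n1 : |Er| ≤ (1 + lam⁻¹) * firstOrderConst d lam ^ 2 * ε ^ 2 * ‖f‖ * ‖g‖ := by
    have hS1 : 0 ≤ ∑ i, ‖U i - (X i + ε • Y i)‖ := Finset.sum_nonneg fun i _ => norm_nonneg _
    have hS2 : 0 ≤ ∑ i, ‖V i - (Xt i + ε • Yt i)‖ := Finset.sum_nonneg fun i _ => norm_nonneg _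
    have m1 := hell.energy_le (fun i => U i - (X i + ε • Y i)) (fun i => V i - (Xt i + ε • Yt i))
    have m2 := abs_real_inner_le_norm (u - w) (v - wt)
    have hn1 := norm_nonneg (u - w)
    have hn2 := norm_nonneg (v - wt)
    set S1 := ∑ i, ‖U i - (X i + ε • Y i)‖
    set S2 := ∑ i, ‖V i - (Xt i + ε • Yt i)‖
    have hK : 0 ≤ firstOrderConst d lam * ε * ‖f‖ := by
      have := firstOrderConst_nonneg d hlam
      positivity
    have m3 : S1 * S2 ≤ (firstOrderConst d lam * ε * ‖f‖) * (firstOrderConst d lam * ε * ‖g‖) :=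
      mul_le_mul (by linarith) (by linarith) hS2 hK
    have m4 : ‖u - w‖ * ‖v - wt‖ ≤
        (firstOrderConst d lam * ε * ‖f‖) * (firstOrderConst d lam * ε * ‖g‖) :=
      mul_le_mul (by linarith) (by linarith) hn2 hK
    have m5 : lam⁻¹ * (S1 * S2) ≤
        lam⁻¹ * ((firstOrderConst d lam * ε * ‖f‖) * (firstOrderConst d lam * ε * ‖g‖)) := by
      gcongr
    refine (abs_add_le _ _).trans ?_
    linarith
  have n2 : |ε ^ 2 * (energy volume (rescaled ε a) Y Yt +
      ⟪cutCorrector ε M N f, cutCorrector ε M Nt g⟫)| ≤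
      (lam⁻¹ * (d ^ 2 * lam⁻¹ ^ 3) ^ 2 + (d * lam⁻¹ ^ 2 * (1 + lam⁻¹)) ^ 2) * ε ^ 2 * ‖f‖ * ‖g‖ := by
    have m1 : |energy volume (rescaled ε a) Y Yt| ≤
        lam⁻¹ * (d ^ 2 * lam⁻¹ ^ 3 * ‖f‖) * (d ^ 2 * lam⁻¹ ^ 3 * ‖g‖) :=
      (hell.energy_le Y Yt).trans (by gcongr)
    have m2 : |⟪cutCorrector ε M N f, cutCorrector ε M Nt g⟫| ≤
        (d * lam⁻¹ ^ 2 * (1 + lam⁻¹) * ‖f‖) * (d * lam⁻¹ ^ 2 * (1 + lam⁻¹) * ‖g‖) :=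
      (abs_real_inner_le_norm _ _).trans (by gcongr)
    rw [abs_mul, abs_of_nonneg (sq_nonneg ε)]
    calc _ ≤ ε ^ 2 * (lam⁻¹ * (d ^ 2 * lam⁻¹ ^ 3 * ‖f‖) * (d ^ 2 * lam⁻¹ ^ 3 * ‖g‖) +
          (d * lam⁻¹ ^ 2 * (1 + lam⁻¹) * ‖f‖) * (d * lam⁻¹ ^ 2 * (1 + lam⁻¹) * ‖g‖)) := by
          gcongr
          exact (abs_add_le _ _).trans (add_le_add m1 m2)
      _ = _ := by ring
  have n3 : |⟪constRes M (f - lowPass ε f), g⟫| ≤ lam⁻¹ * ε ^ 2 * ‖f‖ * ‖g‖ := by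
    refine (abs_real_inner_le_norm _ _).trans ?_
    calc _ ≤ (ε ^ 2 * lam⁻¹ * ‖f‖) * ‖g‖ := by gcongr
      _ = _ := by ring
  have n4 : |ε * ⟪L (f - lowPass ε f), g⟫| ≤
      d ^ 3 * (2 * (lam⁻¹ ^ 2 * lam⁻¹ ^ 3)) * lam⁻¹ ^ 2 * ε ^ 2 * ‖f‖ * ‖g‖ := by
    rw [abs_mul, abs_of_pos hε]
    calc _ ≤ ε * ((d ^ 3 * (2 * (lam⁻¹ ^ 2 * lam⁻¹ ^ 3)) * lam⁻¹ ^ 2 * ε * ‖f‖) * ‖g‖) := by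
          gcongr
          exact (abs_real_inner_le_norm _ _).trans (by gcongr)
      _ = _ := by ring
  rw [d9]
  refine (abs_sub _ _).trans ((add_le_add_left ((abs_sub _ _).trans
    (add_le_add_left (abs_sub _ _) _)) _).trans ?_)
  unfold secondOrderConst
  linarith

end SecondOrder

end Homogenization

/-! ### The estimate in the operator norm -/

namespace Homogenization

open scoped RealInnerProductSpace
open Filter

variable {d : ℕ}

attribute [local instance] isProbabilityMeasure_cell

section SteklovCorrector

variable {lam ε : ℝ} {a : MatrixField d} {N Nt : Fin d → E d → ℝ}
  {DN DNt : Fin d → Fin d → E d → ℝ} {M : Matrix (Fin d) (Fin d) ℝ}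

/-- The constant in the comparison of the Steklov and cutoff correctors. -/
noncomputable def steklovConst (d : ℕ) (lam : ℝ) : ℝ :=
  d * (lam⁻¹ ^ 2 * (1 + √d) * (√d * lam⁻¹))

/-- The corrector `N(·/ε) · S^ε∇(-div M∇ + 1)⁻¹` is a bounded operator, and replacing the Steklov
average by the cutoff `lowPass ε` changes it by `O(ε)`. -/
theorem IsCellSolution.exists_corrector (hlam : 0 < lam) (ha : IsAdmissible lam a)
    (h : IsCellSolution a N DN) (hM : ∀ ξ : E d, lam * ‖ξ‖ ^ 2 ≤ quadForm M ξ) (hε : 0 < ε) :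
    ∃ K : L2 d →L[ℝ] L2 d,
      (∀ f, K f =ᵐ[volume] fun x => ∑ j, N j (ε⁻¹ • x) * steklov ε (constResGrad M j f) x) ∧
      ∀ f, ‖K f - cutCorrector ε M N f‖ ≤ steklovConst d lam * ε * ‖f‖ := by
  have hB : 0 ≤ lam⁻¹ ^ 2 := by positivity
  choose S hS hSB using fun j =>
    exists_mul_steklov hε (h.memL2 j) hB (h.integral_corrector_sq_le hlam ha j)
  have happ : ∀ f, (∑ j, S j ∘L constResGrad M j) f = ∑ j, S j (constResGrad M j f) := fun f => by
    simp
  refine ⟨∑ j, S j ∘L constResGrad M j, fun f => ?_, fun f => ?_⟩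
  · rw [happ]
    filter_upwards [Lp.coeFn_finsetSum Finset.univ fun j => S j (constResGrad M j f),
      ae_all_iff.2 fun j => hS j (constResGrad M j f)] with x h1 h2
    rw [h1, Finset.sum_apply]
    exact Finset.sum_congr rfl fun j _ => h2 j
  · rw [happ, cutCorrector_apply, ← Finset.sum_sub_distrib]
    have hH : ∀ j, √(∑ i, ‖constResHess M i j f‖ ^ 2) ≤ √d * (lam⁻¹ * ‖f‖) := fun j => by
      have h0 : 0 ≤ lam⁻¹ * ‖f‖ := by positivity
      rw [← Real.sqrt_sq h0, ← Real.sqrt_mul (Nat.cast_nonneg d)]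
      refine Real.sqrt_le_sqrt ((Finset.sum_le_sum fun i _ =>
        pow_le_pow_left₀ (norm_nonneg _) (norm_constResHess_le hlam hM i j f) 2).trans_eq ?_)
      simp
    have h1 : ∀ j, ‖S j (constResGrad M j f) - osc ε (N j) (constResGrad M j f)‖ ≤
        lam⁻¹ ^ 2 * (1 + √d) * ε * (√d * (lam⁻¹ * ‖f‖)) := fun j =>
      (norm_mul_steklov_sub_osc_le hε (h.memL2 j) hB (h.integral_corrector_sq_le hlam ha j)
        (hS j) (hSB j) (hasWeakGradient_constResGrad hlam hM j f)).trans (by gcongr; exact hH j)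
    refine (norm_sum_le_of_le _ fun j _ => h1 j).trans (le_of_eq ?_)
    rw [Finset.sum_const, Finset.card_univ, Fintype.card_fin, nsmul_eq_mul, steklovConst]
    ring

theorem opNorm_le_of_inner_le {H : Type*} [NormedAddCommGroup H] [InnerProductSpace ℝ H]
    {T : H →L[ℝ] H} {C : ℝ} (hC : 0 ≤ C) (h : ∀ f g, |⟪T f, g⟫| ≤ C * ‖f‖ * ‖g‖) : ‖T‖ ≤ C := by
  refine T.opNorm_le_bound hC fun f => ?_
  -- Test with `g = T f`.
  rcases (norm_nonneg (T f)).eq_or_lt with h0 | h0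
  · rw [← h0]
    positivity
  · refine le_of_mul_le_mul_right ?_ h0
    have := (le_abs_self _).trans (h f (T f))
    rwa [real_inner_self_eq_norm_mul_norm] at this

/-- The second-order estimate in the operator norm, with Steklov averaging restored in both
correctors. -/
theorem IsCellSolution.norm_sub_le (hlam : 0 < lam) (ha : IsAdmissible lam a)
    (h : IsCellSolution a N DN) (ht : IsCellSolution (transposed a) Nt DNt) (hε : 0 < ε)
    {Rε K Kt : L2 d →L[ℝ] L2 d}
    (hR : ∀ f, ∃ U, HasWeakGradient (Rε f) U ∧ ∀ z Z, HasWeakGradient z Z →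
      energy volume (rescaled ε a) U Z + ⟪Rε f, z⟫ = ⟪f, z⟫)
    (hK : ∀ f, ‖K f - cutCorrector ε (homMatrix a DN) N f‖ ≤ steklovConst d lam * ε * ‖f‖)
    (hKt : ∀ f, ‖Kt f - cutCorrector ε (homMatrix a DN) Nt f‖ ≤ steklovConst d lam * ε * ‖f‖) :
    ‖Rε - constRes (homMatrix a DN) - ε • K - ε • ContinuousLinearMap.adjoint Kt -
      ε • thirdOrderOp (homMatrix a DN) (fun i j k => meanTensor N (transposed a) DNt i j k -
        meanTensor Nt a DN i j k)‖ ≤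
      (secondOrderConst d lam + 2 * steklovConst d lam) * ε ^ 2 := by
  have hs : 0 ≤ steklovConst d lam := by
    unfold steklovConst
    positivity
  have hF := firstOrderConst_nonneg d hlam
  have hS : 0 ≤ secondOrderConst d lam := by
    unfold secondOrderConst
    positivity
  refine opNorm_le_of_inner_le (by positivity) fun f g => ?_
  obtain ⟨U, hU, hUw⟩ := hR f
  obtain ⟨Rt, -, hRt⟩ := (ha.transposed.isElliptic_rescaled hε).exists_resolvent hlam
  obtain ⟨V, hV, hVw⟩ := hRt g
  have h1 := h.second_order hlam ha ht hε f g hU hUw hV hVw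
  simp only [sub_apply, smul_apply, inner_sub_left, real_inner_smul_left,
    ContinuousLinearMap.adjoint_inner_left]
  have h2 : |⟪K f - cutCorrector ε (homMatrix a DN) N f, g⟫| ≤
      steklovConst d lam * ε * ‖f‖ * ‖g‖ :=
    (abs_real_inner_le_norm _ _).trans (by gcongr; exact hK f)
  have h3 : |⟪f, Kt g - cutCorrector ε (homMatrix a DN) Nt g⟫| ≤
      ‖f‖ * (steklovConst d lam * ε * ‖g‖) :=
    (abs_real_inner_le_norm _ _).trans (by gcongr; exact hKt g)
  rw [inner_sub_left] at h2
  rw [inner_sub_right] at h3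
  have h2' := mul_le_mul_of_nonneg_left h2 hε.le
  have h3' := mul_le_mul_of_nonneg_left h3 hε.le
  rw [← abs_of_pos hε, ← abs_mul, abs_of_pos hε] at h2' h3'
  rw [abs_le] at *
  constructor <;> linarith

end SteklovCorrector

section Symmetric

variable {lam ε : ℝ} {a : MatrixField d} {N Nt : Fin d → E d → ℝ}
  {DN DNt : Fin d → Fin d → E d → ℝ}

theorem transposed_ae_eq (hs : ∀ᵐ y, (a y).IsSymm) : transposed a =ᵐ[volume] a := by
  filter_upwards [hs] with y hy using hy

/-- For a symmetric matrix field the two mean tensors coincide. -/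
theorem IsCellSolution.meanTensor_sub_eq_zero (hlam : 0 < lam) (ha : IsAdmissible lam a)
    (h : IsCellSolution a N DN) (ht : IsCellSolution (transposed a) Nt DNt)
    (hs : ∀ᵐ y, (a y).IsSymm) (i j k : Fin d) :
    meanTensor N (transposed a) DNt i j k - meanTensor Nt a DN i j k = 0 := by
  have hu := h.unique hlam ha (ht.congr (transposed_ae_eq hs))
  rw [sub_eq_zero]
  refine integral_congr_ae (ae_restrict_of_ae ?_)
  filter_upwards [transposed_ae_eq hs, (hu k).1, ae_all_iff.2 fun l => (hu j).2 l] with y h1 h2 h3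
  simp only [cellFlux, h1, h2, h3]

end Symmetric

end Homogenization


theorem theorem3p1 (d : ℕ) (hd : 2 ≤ d) (lam : ℝ) (hlam : 0 < lam) :
    ∃ C : ℝ, ∀ a : MatrixField d, IsAdmissible lam a →
      -- the two cell problems are solvable
      (∃ N DN Nt DNt, IsCellSolution a N DN ∧ IsCellSolution (transposed a) Nt DNt) ∧
      -- and, for their solutions, all operators exist and satisfy the estimate
      ∀ (N : Fin d → E d → ℝ) (DN : Fin d → Fin d → E d → ℝ)
        (Nt : Fin d → E d → ℝ) (DNt : Fin d → Fin d → E d → ℝ),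
        IsCellSolution a N DN → IsCellSolution (transposed a) Nt DNt →
        ∃ R₀ R₀s L : L2 d →L[ℝ] L2 d,
          IsResolvent (fun _ => homMatrix a DN) R₀ ∧
          IsResolvent (fun _ => (homMatrix a DN).transpose) R₀s ∧
          IsThirdOrderCorrector (homMatrix a DN)
            (fun i j k => meanTensor N (transposed a) DNt i j k - meanTensor Nt a DN i j k)
            R₀ L ∧
          ((∀ᵐ y, (a y).IsSymm) → L = 0) ∧
          ∀ ε : ℝ, 0 < ε → ε < 1 →
            ∃ Rε K Kt : L2 d →L[ℝ] L2 d,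
              IsResolvent (rescaled ε a) Rε ∧
              IsCorrector ε N R₀ K ∧
              IsCorrector ε Nt R₀s Kt ∧
              ‖Rε - R₀ - ε • K - ε • ContinuousLinearMap.adjoint Kt - ε • L‖ ≤ C * ε ^ 2 ∧
              ((∀ᵐ y, (a y).IsSymm) →
                Kt = K ∧
                ‖Rε - R₀ - ε • K - ε • ContinuousLinearMap.adjoint K‖ ≤ C * ε ^ 2) := by
  refine ⟨secondOrderConst d lam + 2 * steklovConst d lam, fun a ha => ⟨?_, ?_⟩⟩
  · obtain ⟨N, DN, h⟩ := ha.exists_isCellSolution hlam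
    obtain ⟨Nt, DNt, ht⟩ := ha.transposed.exists_isCellSolution hlam
    exact ⟨N, DN, Nt, DNt, h, ht⟩
  intro N DN Nt DNt h ht
  have hMe := h.isElliptic_homMatrix hlam ha
  have hM := hMe.quadForm_lower
  have hMte := ht.isElliptic_homMatrix hlam ha.transposed
  rw [h.homMatrix_transposed ha ht] at hMte
  have hL : (∀ᵐ y, (a y).IsSymm) → thirdOrderOp (homMatrix a DN) (fun i j k =>
      meanTensor N (transposed a) DNt i j k - meanTensor Nt a DN i j k) = 0 := fun hs => by
    simp [thirdOrderOp, h.meanTensor_sub_eq_zero hlam ha ht hs]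
  refine ⟨constRes (homMatrix a DN), constRes (homMatrix a DN).transpose, _,
    isResolvent_constRes hlam hMe, isResolvent_constRes hlam hMte,
    isThirdOrderCorrector_thirdOrderOp hlam hMe _, hL, fun ε hε _ => ?_⟩
  obtain ⟨Rε, hR, hRw⟩ := (ha.isElliptic_rescaled hε).exists_resolvent hlam
  obtain ⟨K, hK, hKc⟩ := h.exists_corrector hlam ha hM hε
  obtain ⟨Kt, hKt, hKtc⟩ := ht.exists_corrector hlam ha.transposed hM hε
  have hle := h.norm_sub_le hlam ha ht hε hRw hKc hKtc
  refine ⟨Rε, K, Kt, hR, fun f => ⟨_, hasWeakGradient_constRes hlam hM f, hK f⟩, fun f =>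
    ⟨_, by simpa only [constRes_transpose] using hasWeakGradient_constRes hlam hM f, hKt f⟩, hle,
    fun hs => ?_⟩
  have hKK : Kt = K := by
    ext1 f
    ext1
    have hN := ae_all_iff.2 fun j => (h.unique hlam ha (ht.congr (transposed_ae_eq hs)) j).1
    filter_upwards [hK f, hKt f, ae_rescale (P := fun y => ∀ j, N j y = Nt j y) hε hN]
      with x h1 h2 h3
    simp only [h1, h2, h3]
  refine ⟨hKK, ?_⟩
  rwa [hL hs, smul_zero, sub_zero, hKK] at hle
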